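/- Let $k$ be an algebraically closed field of characteristic $0$ and let $m\ge 1$ be an integer. Let $H=\bigoplus_{n\ge 0}H(n)$ be a finite-dimensional graded Hopf algebra over $k$ of the form $H=\mathfrak B(V)\# kC_{m^2}$, where $H(0)=kC_{m^2}$ is the group algebra of a cyclic group generated by a grouplike element $\chi$ of order $m^2$, and $\mathfrak B(V)$ (the algebra of right coinvariants of the projection $H\to H(0)$) is the Nichols algebra of the Yetter–Drinfeld module $V\subseteq H(1)$ spanned by elements $x_1,\dots,x_r$ such that $$\chi x_i\chi^{-1}=q^{d_i}x_i,\qquad \Delta(x_i)=x_i\otimes 1+\chi^{-b_i}\otimes x_i\qquad(1\le i\le r),$$ with $q$ a primitive $m^2$-th root of unity and $b_i,d_i\in\mathbb Z$; thus $H$ is generated as an algebra by $\chi,x_1,\dots,x_r$. Write $j'$ for the remainder of $j$ modulo $m$, $\sigma=\chi^m$, $1_i=\frac1{m^2}\sum_{l=0}^{m^2-1}q^{-li}\chi^l$, and $$J_s=\sum_{i,j=0}^{m^2-1}q^{\,s\,j(i-i')}\,1_i\otimes 1_j .$$ Let $H_{J_s}$ be the quasi-Hopf algebra obtained from $H$ by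 the twist $J_s$, that is, $H$ with comultiplication $J_s\Delta(\cdot)J_s^{-1}$, associator $\Phi_s=(1\otimes J_s)(\mathrm{id}\otimes\Delta)(J_s)\,(\Delta\otimes\mathrm{id})(J_s^{-1})(J_s^{-1}\otimes 1)$, the antipode $S$ of $H$, and $\alpha=\sum S(J^{-1})J^{-2}$, $\beta=\sum J^1S(J^2)$, where $J_s=\sum J^1\otimes J^2$ and $J_s^{-1}=\sum J^{-1}\otimes J^{-2}$. Let $s$ be an integer with $1\le s\le m-1$ and $b_i\equiv s\,d_i \pmod m$ for all $i$, and let $A=A(H,s)$ be the subalgebra of $H$ generated by $\sigma,x_1,\dots,x_r$. As usual, the antipode $(S,\alpha,\beta)$ of a quasi-Hopf algebra is considered up to $(S,\alpha,\beta)\mapsto(uS(\cdot)u^{-1},u\alpha,\beta u^{-1})$ with $u$ invertible, and homomorphisms of quasi-Hopf algebras are algebra maps that respect comultiplication, counit and associator, and that respect the antipodes up to such a change. Then $A$ has a structure of quasi-Hopf algebra for which the inclusion $A\subseteq H_{J_s}$ is a homomorphism of quasi-Hopf algebras, and for such a structure the following holds, where $C_m=\{1,h,\dots,h^{m-1}\}$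 is the cyclic group of order $m$. 1. The data $(h^i)_*(a)=\chi^{i}a\chi^{-i}$, $J_{h^i}=1\otimes 1$, $\theta_{(i,j)}=\sigma^{\frac{(i+j)-(i+j)'}{m}}$ $(0\le i,j<m,\ a\in A)$ form a $C_m$-crossed system over $A$: each $((h^i)_*,J_{h^i})$ is a twisted automorphism of $A$, the $\theta_{(\sigma,\tau)}:=\theta_{(i,j)}$ for $\sigma=h^i,\tau=h^j$ are invertible elements of $A$, and for all $\sigma,\tau,\rho\in C_m$, $a\in A$ one has $\varepsilon(\theta_{(\sigma,\tau)})=1$, $(1_*,J_1)=(\mathrm{id},1\otimes1)$, $\theta_{(\sigma,\tau)}(\sigma\tau)_*(a)=\sigma_*(\tau_*(a))\theta_{(\sigma,\tau)}$, $\theta_{(\sigma,\tau)}\theta_{(\sigma\tau,\rho)}=\sigma_*(\theta_{(\tau,\rho)})\theta_{(\sigma,\tau\rho)}$, $\theta_{(1,\sigma)}=\theta_{(\sigma,1)}=1$ and $\Delta(\theta_{(\sigma,\tau)})J_{\sigma\tau}=J_\sigma(\sigma_*\otimes\sigma_*)(J_\tau)(\theta_{(\sigma,\tau)}\otimes\theta_{(\sigma,\tau)})$.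 2. Let $A\# C_m$ be the vector space $A\otimes kC_m$ with product $(x\#\sigma)(y\#\tau)=x\,\sigma_*(y)\,\theta_{(\sigma,\tau)}\#\sigma\tau$, coproduct $\Delta(x\#\sigma)=\sum x_1J_\sigma^1\#\sigma\otimes x_2J_\sigma^2\#\sigma$, counit $\varepsilon(x\#\sigma)=\varepsilon(x)$ and associator $\sum\Phi^1\#1\otimes\Phi^2\#1\otimes\Phi^3\#1$, where $\Phi$ is the associator of $A$. There are invertible elements $\upsilon_\sigma\in A$ $(\sigma\in C_m)$ such that $S(x\#\sigma)=\upsilon_\sigma(\sigma^{-1})_*(S(x))\#\sigma^{-1}$, $\alpha\#1$, $\beta\#1$ is an antipode for $A\# C_m$, and with it $A\# C_m$ is isomorphic to $H_{J_s}$ as a quasi-Hopf algebra. 3. $\theta$ is symmetric, so the functors $F_\sigma$ on the category $\mathrm{Rep}(A)$ of finite-dimensional representations of $A$ (where $F_\sigma(V)=V$ as a vector space, with $a\cdot v=\sigma_*(a)v$ and with tensor structure given by $J_\sigma$), together with $\gamma_{\sigma,\tau}=\theta_{(\sigma,\tau)}^{-1}:F_\sigma F_\tau\to F_{\sigma\tau}$,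 form an action of $C_m$ on the tensor category $\mathrm{Rep}(A)$. There is a tensor equivalence ($k$-linear monoidal equivalence) $\mathrm{Rep}(A)^{C_m}\simeq\mathrm{Rep}(H)$, where $\mathrm{Rep}(A)^{C_m}$ is the equivariantization. -/

import Mathlib

open scoped TensorProduct
open CategoryTheory MonoidalCategory

universe u v w

namespace QuasiHopfAlg

/-! ### Quasi-bialgebras and quasi-Hopf algebras -/

section Basic

variable {k : Type u} [Field k]

/-- `Δ ⊗ id : A ⊗ B → A ⊗ (A ⊗ B)`. -/
noncomputable def comulLeft {A : Type v} [Ring A] [Algebra k A] (B : Type v) [Ring B] [Algebra k B]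
    (Δ : A →ₐ[k] A ⊗[k] A) : A ⊗[k] B →ₐ[k] A ⊗[k] (A ⊗[k] B) :=
  (Algebra.TensorProduct.assoc k k k A A B).toAlgHom.comp
    (Algebra.TensorProduct.map Δ (AlgHom.id k B))

/-- `id ⊗ f : A ⊗ B → A ⊗ C`. -/
noncomputable abbrev idTensor (A : Type v) [Ring A] [Algebra k A] {B C : Type v}
    [Ring B] [Algebra k B] [Ring C] [Algebra k C] (f : B →ₐ[k] C) :
    A ⊗[k] B →ₐ[k] A ⊗[k] C :=
  Algebra.TensorProduct.map (AlgHom.id k A) f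

/-- `b ↦ 1 ⊗ b`. -/
noncomputable abbrev oneLeft (A : Type v) [Ring A] [Algebra k A] (B : Type v) [Ring B]
    [Algebra k B] : B →ₐ[k] A ⊗[k] B :=
  Algebra.TensorProduct.includeRight

/-- `a ⊗ b ↦ a ⊗ b ⊗ 1`. -/
noncomputable abbrev oneRight₂ (k : Type u) [Field k] (A : Type v) [Ring A] [Algebra k A] :
    A ⊗[k] A →ₐ[k] A ⊗[k] (A ⊗[k] A) :=
  idTensor A Algebra.TensorProduct.includeLeft

/-- `a ⊗ b ⊗ c ↦ a ⊗ b ⊗ c ⊗ 1`. -/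
noncomputable abbrev oneRight₃ (k : Type u) [Field k] (A : Type v) [Ring A] [Algebra k A] :
    A ⊗[k] (A ⊗[k] A) →ₐ[k] A ⊗[k] (A ⊗[k] (A ⊗[k] A)) :=
  idTensor A (oneRight₂ k A)

/-- `f ⊗ f`. -/
noncomputable abbrev tensor₂ {A B : Type*} [Ring A] [Algebra k A] [Ring B] [Algebra k B]
    (f : A →ₐ[k] B) : A ⊗[k] A →ₐ[k] B ⊗[k] B :=
  Algebra.TensorProduct.map f f

/-- `f ⊗ f ⊗ f`. -/
noncomputable abbrev tensor₃ {A B : Type*} [Ring A] [Algebra k A] [Ring B] [Algebra k B]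
    (f : A →ₐ[k] B) : A ⊗[k] (A ⊗[k] A) →ₐ[k] B ⊗[k] (B ⊗[k] B) :=
  Algebra.TensorProduct.map f (Algebra.TensorProduct.map f f)

/-- `ε ⊗ id : A ⊗ B → B`. -/
noncomputable def counitLeft {A : Type v} [Ring A] [Algebra k A] {B : Type w} [Ring B]
    [Algebra k B] (ε : A →ₐ[k] k) : A ⊗[k] B →ₐ[k] B :=
  (Algebra.TensorProduct.lid k B).toAlgHom.comp
    (Algebra.TensorProduct.map ε (AlgHom.id k B))

/-- `id ⊗ ε : B ⊗ A → B`. -/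
noncomputable def counitRight {A : Type v} [Ring A] [Algebra k A] {B : Type w} [Ring B]
    [Algebra k B] (ε : A →ₐ[k] k) : B ⊗[k] A →ₐ[k] B :=
  (Algebra.TensorProduct.rid k k B).toAlgHom.comp
    (Algebra.TensorProduct.map (AlgHom.id k B) ε)

@[simp] theorem comulLeft_tmul {A : Type v} [Ring A] [Algebra k A] {B : Type v} [Ring B]
    [Algebra k B] (Δ : A →ₐ[k] A ⊗[k] A) (a : A) (b : B) :
    comulLeft B Δ (a ⊗ₜ b) = Algebra.TensorProduct.assoc k k k A A B (Δ a ⊗ₜ b) := by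
  simp [comulLeft]

@[simp] theorem counitLeft_tmul {A : Type v} [Ring A] [Algebra k A] {B : Type w} [Ring B]
    [Algebra k B] (ε : A →ₐ[k] k) (a : A) (b : B) :
    counitLeft ε (a ⊗ₜ[k] b) = ε a • b := by
  simp [counitLeft]

@[simp] theorem counitRight_tmul {A : Type v} [Ring A] [Algebra k A] {B : Type w} [Ring B]
    [Algebra k B] (ε : A →ₐ[k] k) (a : A) (b : B) :
    counitRight ε (b ⊗ₜ[k] a) = ε a • b := by
  simp [counitRight]

/-- A quasi-bialgebra structure `(Δ, ε, Φ)` on an algebra `A`. -/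
structure QuasiBialgebra (k : Type u) [Field k] (A : Type v) [Ring A] [Algebra k A] where
  /-- comultiplication -/
  Δ : A →ₐ[k] A ⊗[k] A
  /-- counit -/
  ε : A →ₐ[k] k
  /-- associator -/
  Φ : (A ⊗[k] (A ⊗[k] A))ˣ
  quasi_coassoc : ∀ h : A,
    (Φ : A ⊗[k] (A ⊗[k] A)) * comulLeft A Δ (Δ h) = idTensor A Δ (Δ h) * Φ
  counit_right : ∀ h : A, counitRight ε (Δ h) = h
  counit_left : ∀ h : A, counitLeft ε (Δ h) = h
  cocycle :
    oneLeft A (A ⊗[k] (A ⊗[k] A)) Φ * idTensor A (comulLeft A Δ) Φ * oneRight₃ k A Φ =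
      idTensor A (idTensor A Δ) Φ * comulLeft (A ⊗[k] A) Δ Φ
  counit_middle : idTensor A (counitLeft ε) (Φ : A ⊗[k] (A ⊗[k] A)) = 1

/-- The linear map `x ⊗ y ↦ S(x) α y`. -/
noncomputable def leftForm {A : Type v} [Ring A] [Algebra k A] (S : A →ₐ[k] Aᵐᵒᵖ) (α : A) :
    A ⊗[k] A →ₗ[k] A :=
  TensorProduct.lift ((LinearMap.mul k A).comp
    ((LinearMap.mulRight k α).comp ((MulOpposite.opLinearEquiv k).symm.toLinearMap.comp
      S.toLinearMap)))

/-- The linear map `x ⊗ y ↦ x β S(y)`. -/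
noncomputable def rightForm {A : Type v} [Ring A] [Algebra k A] (S : A →ₐ[k] Aᵐᵒᵖ) (β : A) :
    A ⊗[k] A →ₗ[k] A :=
  TensorProduct.lift (((LinearMap.mul k A).compl₂
    ((MulOpposite.opLinearEquiv k).symm.toLinearMap.comp S.toLinearMap)).comp
      (LinearMap.mulRight k β))

/-- The linear map `x ⊗ y ⊗ z ↦ x β S(y) α z`. -/
noncomputable def middleForm {A : Type v} [Ring A] [Algebra k A] (S : A →ₐ[k] Aᵐᵒᵖ) (α β : A) :
    A ⊗[k] (A ⊗[k] A) →ₗ[k] A :=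
  TensorProduct.lift (((LinearMap.mul k A).compl₂ (leftForm S α)).comp (LinearMap.mulRight k β))

/-- The linear map `x ⊗ y ⊗ z ↦ S(x) α y β S(z)`. -/
noncomputable def outerForm {A : Type v} [Ring A] [Algebra k A] (S : A →ₐ[k] Aᵐᵒᵖ) (α β : A) :
    A ⊗[k] (A ⊗[k] A) →ₗ[k] A :=
  TensorProduct.lift (((LinearMap.mul k A).compl₂ (rightForm S β)).comp
    ((LinearMap.mulRight k α).comp ((MulOpposite.opLinearEquiv k).symm.toLinearMap.comp
      S.toLinearMap)))

section
variable {A : Type v} [Ring A] [Algebra k A] (S : A →ₐ[k] Aᵐᵒᵖ) (α β : A)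

@[simp] theorem leftForm_tmul (x y : A) : leftForm S α (x ⊗ₜ y) = (S x).unop * α * y := by
  simp [leftForm]

@[simp] theorem rightForm_tmul (x y : A) : rightForm S β (x ⊗ₜ y) = x * β * (S y).unop := by
  simp [rightForm]

@[simp] theorem middleForm_tmul (x y z : A) :
    middleForm S α β (x ⊗ₜ (y ⊗ₜ z)) = x * β * ((S y).unop * α * z) := by
  simp [middleForm]

@[simp] theorem outerForm_tmul (x y z : A) :
    outerForm S α β (x ⊗ₜ (y ⊗ₜ z)) = (S x).unop * α * (y * β * (S z).unop) := by
  simp [outerForm]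

end

/-- An antipode `(S, α, β)` for a quasi-bialgebra; `S` is an anti-morphism of algebras. -/
structure Antipode {A : Type v} [Ring A] [Algebra k A] (Q : QuasiBialgebra k A) where
  S : A →ₐ[k] Aᵐᵒᵖ
  α : A
  β : A
  left : ∀ h : A, leftForm S α (Q.Δ h) = Q.ε h • α
  right : ∀ h : A, rightForm S β (Q.Δ h) = Q.ε h • β
  middle : middleForm S α β (Q.Φ : A ⊗[k] (A ⊗[k] A)) = 1
  outer : outerForm S α β ((Q.Φ⁻¹ : (A ⊗[k] (A ⊗[k] A))ˣ) : A ⊗[k] (A ⊗[k] A)) = 1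

/-- A quasi-Hopf algebra structure on an algebra `A`. -/
structure QuasiHopf (k : Type u) [Field k] (A : Type v) [Ring A] [Algebra k A] extends
    QuasiBialgebra k A where
  antipode : Antipode toQuasiBialgebra

/-- Morphisms of quasi-bialgebras: algebra maps compatible with `Δ`, `ε` and `Φ`. -/
structure IsQuasiBialgebraHom {A : Type v} {B : Type w} [Ring A] [Algebra k A] [Ring B]
    [Algebra k B] (Q : QuasiBialgebra k A) (R : QuasiBialgebra k B) (f : A →ₐ[k] B) : Prop where
  comul : ∀ a : A, R.Δ (f a) = tensor₂ f (Q.Δ a)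
  counit : ∀ a : A, R.ε (f a) = Q.ε a
  associator : tensor₃ f (Q.Φ : A ⊗[k] (A ⊗[k] A)) = R.Φ

/-- `f` carries the antipode `(S, α, β)` of `Q` to the antipode of `R`, up to the usual freedom
`(S, α, β) ↦ (u S(-) u⁻¹, u α, β u⁻¹)` in the choice of the antipode of a quasi-Hopf algebra. -/
def IntertwinesAntipode {A : Type v} {B : Type w} [Ring A] [Algebra k A] [Ring B]
    [Algebra k B] (Q : QuasiHopf k A) (R : QuasiHopf k B) (f : A →ₐ[k] B) : Prop :=
  ∃ U : Bˣ,
    (∀ a : A, f (Q.antipode.S a).unop = U * (R.antipode.S (f a)).unop * (U⁻¹ : Bˣ)) ∧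
    f Q.antipode.α = U * R.antipode.α ∧
    f Q.antipode.β = R.antipode.β * (U⁻¹ : Bˣ)

/-- Homomorphisms of quasi-Hopf algebras. -/
structure IsQuasiHopfHom {A : Type v} {B : Type w} [Ring A] [Algebra k A] [Ring B]
    [Algebra k B] (Q : QuasiHopf k A) (R : QuasiHopf k B) (f : A →ₐ[k] B) : Prop
    extends IsQuasiBialgebraHom Q.toQuasiBialgebra R.toQuasiBialgebra f where
  antipode : IntertwinesAntipode Q R f

/-- A twist: an invertible `J` with `(ε ⊗ id)(J) = 1 = (id ⊗ ε)(J)`. -/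
structure Twist {A : Type v} [Ring A] [Algebra k A] (Q : QuasiBialgebra k A) where
  J : (A ⊗[k] A)ˣ
  counit_left : counitLeft Q.ε (J : A ⊗[k] A) = 1
  counit_right : counitRight Q.ε (J : A ⊗[k] A) = 1

/-- `x ↦ u x u⁻¹`. -/
def conjHom {B : Type v} [Ring B] [Algebra k B] (U : Bˣ) : B →ₐ[k] B where
  toFun x := U * x * (U⁻¹ : Bˣ)
  map_one' := by simp
  map_mul' x y := by simp [mul_assoc]
  map_zero' := by simp
  map_add' x y := by simp [mul_add, add_mul]
  commutes' r := by rw [← Algebra.commutes, mul_assoc]; simp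

@[simp] theorem conjHom_apply {B : Type v} [Ring B] [Algebra k B] (U : Bˣ) (x : B) :
    conjHom (k := k) U x = U * x * (U⁻¹ : Bˣ) := rfl

end Basic

section Twisting

set_option maxSynthPendingDepth 10

variable {k : Type u} [Field k]

/-- The map induced on units by an algebra homomorphism. -/
def unitsMap {A : Type v} {B : Type w} [Ring A] [Algebra k A] [Ring B] [Algebra k B]
    (f : A →ₐ[k] B) : Aˣ →* Bˣ :=
  Units.map (f : A →* B)

@[simp] theorem coe_unitsMap {A : Type v} {B : Type w} [Ring A] [Algebra k A] [Ring B]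
    [Algebra k B] (f : A →ₐ[k] B) (x : Aˣ) : (unitsMap f x : B) = f x := rfl

variable {A : Type v} [Ring A] [Algebra k A]

/-- The twisted comultiplication `Δ_J(h) = J Δ(h) J⁻¹`. -/
def twistΔ (Δ : A →ₐ[k] A ⊗[k] A) (J : (A ⊗[k] A)ˣ) : A →ₐ[k] A ⊗[k] A :=
  (conjHom J).comp Δ

theorem twistΔ_apply (Δ : A →ₐ[k] A ⊗[k] A) (J : (A ⊗[k] A)ˣ) (h : A) :
    twistΔ Δ J h = J * Δ h * (J⁻¹ : (A ⊗[k] A)ˣ) := rfl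

/-- The twisted associator
`Φ_J = (1 ⊗ J) (id ⊗ Δ)(J) Φ (Δ ⊗ id)(J⁻¹) (J⁻¹ ⊗ 1)`. -/
noncomputable def twistΦ (Δ : A →ₐ[k] A ⊗[k] A) (Φ : (A ⊗[k] (A ⊗[k] A))ˣ)
    (J : (A ⊗[k] A)ˣ) : (A ⊗[k] (A ⊗[k] A))ˣ :=
  unitsMap (oneLeft A (A ⊗[k] A)) J * unitsMap (idTensor A Δ) J * Φ *
    unitsMap (comulLeft A Δ) J⁻¹ * unitsMap (oneRight₂ k A) J⁻¹

variable (Δ : A →ₐ[k] A ⊗[k] A)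

/-- `a ⊗ b ↦ a ⊗ (b ⊗ 1)` with `1` in an arbitrary algebra. -/
noncomputable abbrev oneRightGen (k : Type u) [Field k] (A : Type v) [Ring A] [Algebra k A]
    (B : Type v) [Ring B] [Algebra k B] : A ⊗[k] A →ₐ[k] A ⊗[k] (A ⊗[k] B) :=
  idTensor A Algebra.TensorProduct.includeLeft

/-- `b ↦ 1 ⊗ 1 ⊗ 1 ⊗ b`. -/
noncomputable abbrev last (k : Type u) [Field k] (A : Type v) [Ring A] [Algebra k A] :
    A →ₐ[k] A ⊗[k] (A ⊗[k] (A ⊗[k] A)) :=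
  (oneLeft A (A ⊗[k] (A ⊗[k] A))).comp ((oneLeft A (A ⊗[k] A)).comp (oneLeft A A))

theorem assoc_eq_oneRightGen {B : Type v} [Ring B] [Algebra k B] (p : A ⊗[k] A) :
    (Algebra.TensorProduct.assoc k k k A A B) (p ⊗ₜ 1) = oneRightGen k A B p := by
  induction p with
  | zero => simp
  | tmul x y => simp
  | add x y hx hy => simp only [map_add, hx, hy, TensorProduct.add_tmul]

theorem comulLeft_twist {B : Type v} [Ring B] [Algebra k B] (J : (A ⊗[k] A)ˣ) (z : A ⊗[k] B) :
    comulLeft B (twistΔ Δ J) z =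
      unitsMap (oneRightGen k A B) J * comulLeft B Δ z *
        ((unitsMap (oneRightGen k A B) J)⁻¹ : (A ⊗[k] (A ⊗[k] B))ˣ) := by
  rw [← map_inv]
  induction z with
  | zero => simp
  | tmul a b =>
    simp only [coe_unitsMap, comulLeft_tmul, twistΔ_apply, ← assoc_eq_oneRightGen, ← map_mul,
      Algebra.TensorProduct.tmul_mul_tmul, one_mul, mul_one]
  | add x y hx hy => simp only [map_add, mul_add, add_mul, hx, hy]

theorem idTensor_conj {B C : Type v} [Ring B] [Algebra k B] [Ring C] [Algebra k C]
    (f g : B →ₐ[k] C) (U : Cˣ) (h : ∀ z, f z = U * g z * (U⁻¹ : Cˣ)) (z : A ⊗[k] B) :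
    idTensor A f z = unitsMap (k := k) (oneLeft A C) U * idTensor A g z *
      ((unitsMap (k := k) (oneLeft A C) U)⁻¹ : (A ⊗[k] C)ˣ) := by
  rw [← map_inv]
  induction z with
  | zero => simp
  | tmul a b => simp [h, -map_inv]
  | add x y hx hy => simp only [map_add, mul_add, add_mul, hx, hy]

theorem twist_group_identity {M : Type*} [Group M] (a b c c' F G H d e f g g' h i P L o : M)
    (h1 : F * c' = c * F) (h2 : H * g' = g * H) (h3 : F * G * H = P * L) (h4 : a * i = i * a) :
    (a * b * F * d⁻¹ * e⁻¹) * (e * (d * c' * G * g⁻¹ * f⁻¹) * e⁻¹) * (e * f * H * h⁻¹ * i⁻¹) =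
      (a * (b * c * P * o⁻¹ * i⁻¹) * a⁻¹) * (i * (a * o * L * g'⁻¹ * h⁻¹) * i⁻¹) := by
  have h2' : g⁻¹ * H = H * g'⁻¹ := by
    rw [inv_mul_eq_iff_eq_mul, ← mul_assoc, eq_mul_inv_iff_mul_eq, h2]
  calc _ = a * b * (F * c') * G * (g⁻¹ * H) * h⁻¹ * i⁻¹ := by group
    _ = a * b * c * (F * G * H) * g'⁻¹ * h⁻¹ * i⁻¹ := by rw [h1, h2']; group
    _ = a * b * c * P * o⁻¹ * (i⁻¹ * a⁻¹ * (i * a)) * o * L * g'⁻¹ * h⁻¹ * i⁻¹ := by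
        rw [h3, ← h4]; group
    _ = _ := by group

namespace QuasiBialgebra

variable (Q : QuasiBialgebra k A)

theorem twist_cocycle (J : (A ⊗[k] A)ˣ) :
    oneLeft A (A ⊗[k] (A ⊗[k] A)) (twistΦ Q.Δ Q.Φ J) *
        idTensor A (comulLeft A (twistΔ Q.Δ J)) (twistΦ Q.Δ Q.Φ J) *
        oneRight₃ k A (twistΦ Q.Δ Q.Φ J) =
      idTensor A (idTensor A (twistΔ Q.Δ J)) (twistΦ Q.Δ Q.Φ J) *
        comulLeft (A ⊗[k] A) (twistΔ Q.Δ J) (twistΦ Q.Δ Q.Φ J) := by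
  rw [idTensor_conj _ _ _ (comulLeft_twist Q.Δ J), comulLeft_twist,
    idTensor_conj _ _ _ (idTensor_conj _ _ J (twistΔ_apply Q.Δ J))]
  simp only [← coe_unitsMap, ← Units.val_mul]
  refine congrArg Units.val ?_
  simp only [twistΦ, map_mul, map_inv]
  -- the composites of the maps involved
  have comp : ∀ {A₁ A₂ A₃ : Type v} [Ring A₁] [Ring A₂] [Ring A₃] [Algebra k A₁] [Algebra k A₂]
      [Algebra k A₃] (f : A₂ →ₐ[k] A₃) (g : A₁ →ₐ[k] A₂) (x : A₁ˣ),
      unitsMap f (unitsMap g x) = unitsMap (f.comp g) x := fun _ _ _ => rfl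
  have e1 : (oneRight₃ k A).comp (oneLeft A (A ⊗[k] A)) =
      (oneLeft A (A ⊗[k] (A ⊗[k] A))).comp (oneRight₂ k A) := by
    ext <;> simp
  have e2 : (oneRight₃ k A).comp (oneRight₂ k A) = oneRightGen k A (A ⊗[k] A) := by
    ext <;> simp [Algebra.TensorProduct.one_def]
  have e3 : (idTensor A (comulLeft A Q.Δ)).comp (oneLeft A (A ⊗[k] A)) =
      (oneLeft A (A ⊗[k] (A ⊗[k] A))).comp (comulLeft A Q.Δ) := by
    apply AlgHom.ext; intro x; simp
  have e4 : (idTensor A (comulLeft A Q.Δ)).comp (oneRight₂ k A) =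
      (oneRight₃ k A).comp (idTensor A Q.Δ) := by
    apply Algebra.TensorProduct.ext'
    intro x y
    simp [assoc_eq_oneRightGen]
  have e5 : (idTensor A (idTensor A Q.Δ)).comp (oneLeft A (A ⊗[k] A)) =
      (oneLeft A (A ⊗[k] (A ⊗[k] A))).comp (idTensor A Q.Δ) := by
    apply AlgHom.ext; intro x; simp
  have e6 : (idTensor A (idTensor A Q.Δ)).comp (oneRight₂ k A) =
      oneRightGen k A (A ⊗[k] A) := by
    apply Algebra.TensorProduct.ext'
    intro x y
    simp
  have e7 : (comulLeft (A ⊗[k] A) Q.Δ).comp (oneLeft A (A ⊗[k] A)) =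
      (oneLeft A (A ⊗[k] (A ⊗[k] A))).comp (oneLeft A (A ⊗[k] A)) := by
    apply AlgHom.ext; intro x; simp [Algebra.TensorProduct.one_def]
  have e8 : (comulLeft (A ⊗[k] A) Q.Δ).comp (idTensor A Q.Δ) =
      (idTensor A (idTensor A Q.Δ)).comp (comulLeft A Q.Δ) := by
    apply Algebra.TensorProduct.ext'
    intro x y
    simp only [AlgHom.comp_apply, Algebra.TensorProduct.map_tmul, AlgHom.id_apply,
      comulLeft_tmul]
    generalize Q.Δ x = p
    induction p with
    | zero => simp
    | tmul x y => simp
    | add x y hx hy => simp only [map_add, hx, hy, TensorProduct.add_tmul]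
  have e9 : (comulLeft (A ⊗[k] A) Q.Δ).comp (oneRight₂ k A) =
      (oneRight₃ k A).comp (comulLeft A Q.Δ) := by
    apply Algebra.TensorProduct.ext'
    intro x y
    simp only [AlgHom.comp_apply, Algebra.TensorProduct.map_tmul, AlgHom.id_apply,
      comulLeft_tmul, Algebra.TensorProduct.includeLeft_apply]
    generalize Q.Δ x = p
    induction p with
    | zero => simp
    | tmul x y => simp
    | add x y hx hy => simp only [map_add, hx, hy, TensorProduct.add_tmul]
  have s1 : ∀ z : A ⊗[k] A, oneLeft A (A ⊗[k] (A ⊗[k] A)) Q.Φ *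
      idTensor A (comulLeft A Q.Δ) (idTensor A Q.Δ z) =
      idTensor A (idTensor A Q.Δ) (idTensor A Q.Δ z) *
        oneLeft A (A ⊗[k] (A ⊗[k] A)) Q.Φ := by
    intro z
    induction z with
    | zero => simp
    | tmul x y => simp [Q.quasi_coassoc]
    | add x y hx hy => simp only [map_add, mul_add, add_mul, hx, hy]
  have t1 : ∀ (p : A ⊗[k] A) (b : A), idTensor A (comulLeft A Q.Δ)
      (Algebra.TensorProduct.assoc k k k A A A (p ⊗ₜ b)) =
      oneRight₃ k A (idTensor A Q.Δ p) * last k A b := by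
    intro p b
    induction p with
    | zero => simp
    | tmul x y =>
      simp only [Algebra.TensorProduct.assoc_tmul, Algebra.TensorProduct.map_tmul,
        AlgHom.id_apply, comulLeft_tmul, Algebra.TensorProduct.tmul_mul_tmul, mul_one]
      generalize Q.Δ y = p
      induction p with
      | zero => simp
      | tmul x y => simp
      | add x y hx hy =>
        simp only [map_add, hx, hy, TensorProduct.add_tmul, TensorProduct.tmul_add, add_mul]
    | add x y hx hy => simp only [map_add, hx, hy, TensorProduct.add_tmul, add_mul]
  have t2 : ∀ (p : A ⊗[k] A) (b : A), comulLeft (A ⊗[k] A) Q.Δ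
      (Algebra.TensorProduct.assoc k k k A A A (p ⊗ₜ b)) =
      oneRight₃ k A (comulLeft A Q.Δ p) * last k A b := by
    intro p b
    induction p with
    | zero => simp
    | tmul x y =>
      simp only [Algebra.TensorProduct.assoc_tmul, comulLeft_tmul]
      generalize Q.Δ x = p
      induction p with
      | zero => simp
      | tmul x y => simp
      | add x y hx hy => simp only [map_add, hx, hy, TensorProduct.add_tmul, add_mul]
    | add x y hx hy => simp only [map_add, hx, hy, TensorProduct.add_tmul, add_mul]
  have s2 : ∀ z : A ⊗[k] A, oneRight₃ k A Q.Φ *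
      comulLeft (A ⊗[k] A) Q.Δ (comulLeft A Q.Δ z) =
      idTensor A (comulLeft A Q.Δ) (comulLeft A Q.Δ z) * oneRight₃ k A Q.Φ := by
    intro z
    induction z with
    | zero => simp
    | tmul x y =>
      have cm : ∀ w, oneRight₃ k A w * last k A y =
          last k A y * oneRight₃ k A w := by
        intro w
        induction w with
        | zero => simp
        | tmul a w =>
          induction w with
          | zero => simp
          | tmul b c => simp
          | add x y hx hy =>
            simp only [map_add, hx, hy, TensorProduct.tmul_add, mul_add, add_mul]
        | add x y hx hy => simp only [map_add, hx, hy, add_mul, mul_add]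
      rw [comulLeft_tmul, t1, t2, ← mul_assoc, ← map_mul, Q.quasi_coassoc, map_mul, mul_assoc,
        mul_assoc, cm]
    | add x y hx hy => simp only [map_add, mul_add, add_mul, hx, hy]
  have s4 : ∀ z w : A ⊗[k] A,
      oneLeft A (A ⊗[k] (A ⊗[k] A)) (oneLeft A (A ⊗[k] A) z) *
        oneRightGen k A (A ⊗[k] A) w = oneRightGen k A (A ⊗[k] A) w *
      oneLeft A (A ⊗[k] (A ⊗[k] A)) (oneLeft A (A ⊗[k] A) z) := by
    intro z w
    induction w with
    | zero => simp
    | tmul x y => simp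
    | add x y hx hy => simp only [map_add, hx, hy, add_mul, mul_add]
  simp only [comp, e1, e2, e3, e4, e5, e6, e7, e8, e9]
  refine twist_group_identity _ _ _ _ _ _ _ _ _ _ _ _ _ _ _ _ _ ?_ ?_ ?_ ?_
  · exact Units.ext (s1 J)
  · exact Units.ext (s2 J)
  · exact Units.ext Q.cocycle
  · exact Units.ext (s4 J J)

theorem twist_coassoc_identity {M : Type*} [Monoid M] (a b F d e : Mˣ) (X Y : M)
    (h : F * X = Y * F) :
    ((a * b * F * d⁻¹ * e⁻¹ : Mˣ) : M) * (e * (d * X * (d⁻¹ : Mˣ)) * (e⁻¹ : Mˣ)) =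
      (a * (b * Y * (b⁻¹ : Mˣ)) * (a⁻¹ : Mˣ)) * ((a * b * F * d⁻¹ * e⁻¹ : Mˣ) : M) := by
  simp only [Units.val_mul, mul_assoc, Units.inv_mul_cancel_left]
  rw [← mul_assoc (F : M) X, h, mul_assoc]

variable {Q} in
theorem counitLeft_inv (T : Twist Q) :
    counitLeft Q.ε ((T.J⁻¹ : (A ⊗[k] A)ˣ) : A ⊗[k] A) = 1 := by
  have h := congrArg (counitLeft (B := A) Q.ε) T.J.inv_mul
  rwa [map_mul, T.counit_left, mul_one, map_one] at h

variable {Q} in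
theorem counitRight_inv (T : Twist Q) :
    counitRight Q.ε ((T.J⁻¹ : (A ⊗[k] A)ˣ) : A ⊗[k] A) = 1 := by
  have h := congrArg (counitRight (B := A) Q.ε) T.J.inv_mul
  rwa [map_mul, T.counit_right, mul_one, map_one] at h

/-- The quasi-bialgebra `(A_J, Φ_J)` obtained by twisting. -/
noncomputable def twist (T : Twist Q) : QuasiBialgebra k A where
  Δ := twistΔ Q.Δ T.J
  ε := Q.ε
  Φ := twistΦ Q.Δ Q.Φ T.J
  quasi_coassoc h := by
    rw [comulLeft_twist, idTensor_conj _ _ T.J (twistΔ_apply Q.Δ T.J), twistΔ_apply]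
    simp only [map_mul]
    exact twist_coassoc_identity (unitsMap (oneLeft A (A ⊗[k] A)) T.J)
      (unitsMap (idTensor A Q.Δ) T.J) Q.Φ (unitsMap (comulLeft A Q.Δ) T.J)
      (unitsMap (oneRight₂ k A) T.J) _ _ (Q.quasi_coassoc h)
  counit_right h := by
    rw [twistΔ_apply, map_mul, map_mul, T.counit_right, counitRight_inv, Q.counit_right]
    simp
  counit_left h := by
    rw [twistΔ_apply, map_mul, map_mul, T.counit_left, counitLeft_inv, Q.counit_left]
    simp
  cocycle := Q.twist_cocycle T.J
  counit_middle := by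
    have h1 : (idTensor A (counitLeft Q.ε)).comp (oneLeft A (A ⊗[k] A)) =
        (oneLeft A A).comp (counitLeft Q.ε) := by
      apply AlgHom.ext; intro x; simp
    have h2 : (idTensor A (counitLeft Q.ε)).comp (idTensor A Q.Δ) = AlgHom.id k (A ⊗[k] A) := by
      apply Algebra.TensorProduct.ext'
      intro x y
      simp [Q.counit_left]
    have h3 : (idTensor A (counitLeft Q.ε)).comp (comulLeft A Q.Δ) = AlgHom.id k (A ⊗[k] A) := by
      apply Algebra.TensorProduct.ext'
      intro x y
      conv_rhs => rw [← Q.counit_right x]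
      simp only [AlgHom.comp_apply, comulLeft_tmul, AlgHom.id_apply]
      generalize Q.Δ x = p
      induction p with
      | zero => simp
      | tmul x z => simp [TensorProduct.smul_tmul]
      | add x z hx hz => simp only [map_add, hx, hz, TensorProduct.add_tmul]
    have h4 : (idTensor A (counitLeft Q.ε)).comp (oneRight₂ k A) =
        Algebra.TensorProduct.includeLeft.comp (counitRight Q.ε) := by
      apply Algebra.TensorProduct.ext'
      intro x y
      simp only [AlgHom.comp_apply, Algebra.TensorProduct.map_tmul, AlgHom.id_apply,
        Algebra.TensorProduct.includeLeft_apply, counitLeft_tmul, counitRight_tmul,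
        TensorProduct.smul_tmul]
    have g : ∀ {B : Type v} [Ring B] [Algebra k B] (f : B →ₐ[k] A ⊗[k] (A ⊗[k] A)) (x : B),
        idTensor A (counitLeft Q.ε) (f x) = ((idTensor A (counitLeft Q.ε)).comp f) x :=
      fun _ _ => rfl
    simp only [twistΦ, Units.val_mul, map_mul, coe_unitsMap]
    rw [g (oneLeft A (A ⊗[k] A)), g (idTensor A Q.Δ), g (comulLeft A Q.Δ), g (oneRight₂ k A),
      h1, h2, h3, h4, Q.counit_middle]
    simp only [AlgHom.comp_apply, T.counit_left, counitRight_inv, map_one, AlgHom.id_apply,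
      one_mul, mul_one, Units.mul_inv]

end QuasiBialgebra

end Twisting
section TwistAntipode

set_option maxSynthPendingDepth 10

variable {k : Type u} [Field k] {A : Type v} [Ring A] [Algebra k A] {Q : QuasiBialgebra k A}

namespace Antipode

variable (E : Antipode Q)

theorem leftForm_twist (w z : A ⊗[k] A) :
    leftForm E.S (leftForm E.S E.α w) z = leftForm E.S E.α (w * z) := by
  induction z with
  | zero => simp
  | add p q hp hq => simp only [map_add, mul_add, hp, hq]
  | tmul x y =>
    rw [leftForm_tmul]
    induction w with
    | zero => simp
    | add p q hp hq => simp only [map_add, mul_add, add_mul, hp, hq]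
    | tmul a b => simp [mul_assoc]

theorem rightForm_twist (w z : A ⊗[k] A) :
    rightForm E.S (rightForm E.S E.β w) z = rightForm E.S E.β (z * w) := by
  induction z with
  | zero => simp
  | add p q hp hq => simp only [map_add, add_mul, hp, hq]
  | tmul x y =>
    rw [rightForm_tmul]
    induction w with
    | zero => simp
    | add p q hp hq => simp only [map_add, mul_add, add_mul, hp, hq]
    | tmul a b => simp [mul_assoc]

theorem leftForm_comul_mul (h : A) (z : A ⊗[k] A) :
    leftForm E.S E.α (Q.Δ h * z) = Q.ε h • leftForm E.S E.α z := by
  induction z with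
  | zero => simp
  | tmul a b =>
    have : ∀ p : A ⊗[k] A, leftForm E.S E.α (p * a ⊗ₜ b) =
        (E.S a).unop * leftForm E.S E.α p * b := by
      intro p
      induction p with
      | zero => simp
      | tmul x y => simp [mul_assoc]
      | add p q hp hq => simp only [map_add, add_mul, mul_add, hp, hq]
    rw [this, E.left, leftForm_tmul]
    simp
  | add p q hp hq => simp only [map_add, mul_add, hp, hq, smul_add]

theorem rightForm_mul_comul (h : A) (z : A ⊗[k] A) :
    rightForm E.S E.β (z * Q.Δ h) = Q.ε h • rightForm E.S E.β z := by
  induction z with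
  | zero => simp
  | tmul a b =>
    have : ∀ p : A ⊗[k] A, rightForm E.S E.β (a ⊗ₜ b * p) =
        a * rightForm E.S E.β p * (E.S b).unop := by
      intro p
      induction p with
      | zero => simp
      | tmul x y => simp [mul_assoc]
      | add p q hp hq => simp only [map_add, add_mul, mul_add, hp, hq]
    rw [this, E.right, rightForm_tmul]
    simp
  | add p q hp hq => simp only [map_add, add_mul, hp, hq, smul_add]

theorem middleForm_twist (w v : A ⊗[k] A) (z : A ⊗[k] (A ⊗[k] A)) :
    middleForm E.S (leftForm E.S E.α w) (rightForm E.S E.β v) z =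
      middleForm E.S E.α E.β (oneLeft A (A ⊗[k] A) w * z * oneRight₂ k A v) := by
  induction z with
  | zero => simp
  | add p q hp hq => simp only [map_add, mul_add, add_mul, hp, hq]
  | tmul x z =>
    induction z with
    | zero => simp
    | add p q hp hq => simp only [map_add, mul_add, add_mul, TensorProduct.tmul_add, hp, hq]
    | tmul y z =>
      rw [middleForm_tmul]
      induction w with
      | zero => simp
      | add p q hp hq => simp only [map_add, mul_add, add_mul, hp, hq]
      | tmul a b =>
        induction v with
        | zero => simp
        | add p q hp hq => simp only [map_add, mul_add, add_mul, hp, hq]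
        | tmul c d => simp [mul_assoc]

theorem outerForm_twist (w v : A ⊗[k] A) (z : A ⊗[k] (A ⊗[k] A)) :
    outerForm E.S (leftForm E.S E.α w) (rightForm E.S E.β v) z =
      outerForm E.S E.α E.β (oneRight₂ k A w * z * oneLeft A (A ⊗[k] A) v) := by
  induction z with
  | zero => simp
  | add p q hp hq => simp only [map_add, mul_add, add_mul, hp, hq]
  | tmul x z =>
    induction z with
    | zero => simp
    | add p q hp hq => simp only [map_add, mul_add, add_mul, TensorProduct.tmul_add, hp, hq]
    | tmul y z =>
      rw [outerForm_tmul]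
      induction w with
      | zero => simp
      | add p q hp hq => simp only [map_add, mul_add, add_mul, hp, hq]
      | tmul a b =>
        induction v with
        | zero => simp
        | add p q hp hq => simp only [map_add, mul_add, add_mul, hp, hq]
        | tmul c d => simp [mul_assoc]

theorem middleForm_idTensor_mul (w : A ⊗[k] A) (z : A ⊗[k] (A ⊗[k] A)) :
    middleForm E.S E.α E.β (idTensor A Q.Δ w * z) =
      counitRight Q.ε w * middleForm E.S E.α E.β z := by
  have gen : ∀ (a x : A) (p : A ⊗[k] A),
      middleForm E.S E.α E.β (a ⊗ₜ p) = a * E.β * leftForm E.S E.α p := by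
    intro a x p; simp [middleForm]
  induction w with
  | zero => simp
  | add p q hp hq => simp only [map_add, add_mul, hp, hq]
  | tmul a b =>
    induction z with
    | zero => simp
    | add p q hp hq => simp only [map_add, mul_add, hp, hq]
    | tmul x z =>
      simp only [Algebra.TensorProduct.map_tmul, AlgHom.id_apply,
        Algebra.TensorProduct.tmul_mul_tmul, gen _ x, leftForm_comul_mul, counitRight_tmul]
      simp [mul_assoc]

theorem outerForm_mul_idTensor (w : A ⊗[k] A) (z : A ⊗[k] (A ⊗[k] A)) :
    outerForm E.S E.α E.β (z * idTensor A Q.Δ w) =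
      (E.S (counitRight Q.ε w)).unop * outerForm E.S E.α E.β z := by
  have gen : ∀ (a : A) (p : A ⊗[k] A),
      outerForm E.S E.α E.β (a ⊗ₜ p) = (E.S a).unop * E.α * rightForm E.S E.β p := by
    intro a p; simp [outerForm]
  induction w with
  | zero => simp
  | add p q hp hq => simp only [map_add, mul_add, add_mul, hp, hq, MulOpposite.unop_add]
  | tmul a b =>
    induction z with
    | zero => simp
    | add p q hp hq => simp only [map_add, mul_add, add_mul, hp, hq]
    | tmul x z =>
      simp only [Algebra.TensorProduct.map_tmul, AlgHom.id_apply,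
        Algebra.TensorProduct.tmul_mul_tmul, gen, rightForm_mul_comul, counitRight_tmul]
      simp [mul_assoc]

theorem middleForm_assoc (p : A ⊗[k] A) (x y z b : A) :
    middleForm E.S E.α E.β
        (x ⊗ₜ (y ⊗ₜ z) * Algebra.TensorProduct.assoc k k k A A A (p ⊗ₜ b)) =
      x * rightForm E.S E.β p * ((E.S y).unop * E.α * (z * b)) := by
  induction p with
  | zero => simp
  | add p q hp hq => simp only [map_add, mul_add, add_mul, TensorProduct.add_tmul, hp, hq]
  | tmul c d => simp [mul_assoc]

theorem outerForm_assoc (p : A ⊗[k] A) (x y z b : A) :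
    outerForm E.S E.α E.β
        (Algebra.TensorProduct.assoc k k k A A A (p ⊗ₜ b) * x ⊗ₜ (y ⊗ₜ z)) =
      (E.S x).unop * leftForm E.S E.α p * (y * E.β * ((E.S z).unop * (E.S b).unop)) := by
  induction p with
  | zero => simp
  | add p q hp hq => simp only [map_add, mul_add, add_mul, TensorProduct.add_tmul, hp, hq]
  | tmul c d => simp [mul_assoc]

theorem middleForm_mul_comulLeft (w : A ⊗[k] A) (z : A ⊗[k] (A ⊗[k] A)) :
    middleForm E.S E.α E.β (z * comulLeft A Q.Δ w) =
      middleForm E.S E.α E.β z * counitLeft Q.ε w := by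
  induction w with
  | zero => simp
  | add p q hp hq => simp only [map_add, mul_add, hp, hq]
  | tmul a b =>
    induction z with
    | zero => simp
    | add p q hp hq => simp only [map_add, mul_add, add_mul, hp, hq]
    | tmul x z =>
      induction z with
      | zero => simp
      | add p q hp hq => simp only [map_add, mul_add, add_mul, TensorProduct.tmul_add, hp, hq]
      | tmul y z =>
        rw [comulLeft_tmul, middleForm_assoc, E.right]
        simp [mul_assoc]

theorem outerForm_comulLeft_mul (w : A ⊗[k] A) (z : A ⊗[k] (A ⊗[k] A)) :
    outerForm E.S E.α E.β (comulLeft A Q.Δ w * z) =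
      outerForm E.S E.α E.β z * (E.S (counitLeft Q.ε w)).unop := by
  induction w with
  | zero => simp
  | add p q hp hq => simp only [map_add, mul_add, add_mul, hp, hq, MulOpposite.unop_add]
  | tmul a b =>
    induction z with
    | zero => simp
    | add p q hp hq => simp only [map_add, mul_add, add_mul, hp, hq]
    | tmul x z =>
      induction z with
      | zero => simp
      | add p q hp hq => simp only [map_add, mul_add, add_mul, TensorProduct.tmul_add, hp, hq]
      | tmul y z =>
        rw [comulLeft_tmul, outerForm_assoc, E.left]
        simp [mul_assoc]

/-- The antipode of the twisted quasi-bialgebra: the same `S`, with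
`α_J = S(J⁻¹) α J⁻²` and `β_J = J¹ β S(J²)`, where `J = J¹ ⊗ J²`, `J⁻¹ = J⁻¹ ⊗ J⁻²`. -/
noncomputable def twist (T : Twist Q) : Antipode (Q.twist T) where
  S := E.S
  α := leftForm E.S E.α ((T.J⁻¹ : (A ⊗[k] A)ˣ) : A ⊗[k] A)
  β := rightForm E.S E.β (T.J : A ⊗[k] A)
  left h := by
    rw [leftForm_twist]
    change leftForm E.S E.α (_ * twistΔ Q.Δ T.J h) = Q.ε h • _
    rw [twistΔ_apply, mul_assoc, Units.inv_mul_cancel_left, leftForm_comul_mul]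
  right h := by
    rw [rightForm_twist]
    change rightForm E.S E.β (twistΔ Q.Δ T.J h * _) = Q.ε h • _
    rw [twistΔ_apply, Units.inv_mul_cancel_right, rightForm_mul_comul]
  middle := by
    rw [middleForm_twist]
    change middleForm E.S E.α E.β (_ * (twistΦ Q.Δ Q.Φ T.J : A ⊗[k] (A ⊗[k] A)) * _) = 1
    have : unitsMap (oneLeft A (A ⊗[k] A)) T.J⁻¹ * twistΦ Q.Δ Q.Φ T.J *
        unitsMap (oneRight₂ k A) T.J =
        unitsMap (idTensor A Q.Δ) T.J * Q.Φ * unitsMap (comulLeft A Q.Δ) T.J⁻¹ := by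
      simp only [twistΦ, map_inv]; group
    have := congrArg Units.val this
    simp only [Units.val_mul, coe_unitsMap] at this
    rw [this, middleForm_mul_comulLeft, middleForm_idTensor_mul, E.middle, T.counit_right,
      QuasiBialgebra.counitLeft_inv, one_mul, one_mul]
  outer := by
    rw [outerForm_twist]
    change outerForm E.S E.α E.β (_ * (((twistΦ Q.Δ Q.Φ T.J)⁻¹ : (A ⊗[k] (A ⊗[k] A))ˣ) :
      A ⊗[k] (A ⊗[k] A)) * _) = 1
    have : unitsMap (oneRight₂ k A) T.J⁻¹ * (twistΦ Q.Δ Q.Φ T.J)⁻¹ *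
        unitsMap (oneLeft A (A ⊗[k] A)) T.J =
        unitsMap (comulLeft A Q.Δ) T.J * Q.Φ⁻¹ * unitsMap (idTensor A Q.Δ) T.J⁻¹ := by
      simp only [twistΦ, map_inv]; group
    have := congrArg Units.val this
    simp only [Units.val_mul, coe_unitsMap] at this
    rw [this, outerForm_mul_idTensor, outerForm_comulLeft_mul, E.outer, T.counit_left,
      QuasiBialgebra.counitRight_inv]
    simp

end Antipode

/-- The quasi-Hopf algebra `A_J` obtained from `A` by a twist `J`. -/
noncomputable def QuasiHopf.twist (Q : QuasiHopf k A) (T : Twist Q.toQuasiBialgebra) :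
    QuasiHopf k A where
  toQuasiBialgebra := Q.toQuasiBialgebra.twist T
  antipode := Q.antipode.twist T

end TwistAntipode

section Hopf

set_option maxSynthPendingDepth 10

/-- A Hopf algebra, viewed as a quasi-Hopf algebra with `Φ = 1` and `α = β = 1`. -/
noncomputable def QuasiHopf.ofHopf (k : Type u) [Field k] (H : Type v) [Ring H] [HopfAlgebra k H] :
    QuasiHopf k H where
  Δ := Bialgebra.comulAlgHom k H
  ε := Bialgebra.counitAlgHom k H
  Φ := 1
  quasi_coassoc h := by
    rw [Units.val_one, one_mul, mul_one]
    exact Coalgebra.coassoc_apply h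
  counit_right h := by
    have := congrArg (TensorProduct.rid k H) (Coalgebra.lTensor_counit_comul (R := k) h)
    rw [TensorProduct.rid_tmul, one_smul] at this
    exact this
  counit_left h := by
    have := congrArg (TensorProduct.lid k H) (Coalgebra.rTensor_counit_comul (R := k) h)
    rw [TensorProduct.lid_tmul, one_smul] at this
    exact this
  cocycle := by simp only [Units.val_one, map_one, mul_one]
  counit_middle := by simp only [Units.val_one, map_one]
  antipode :=
    { S := HopfAlgebra.antipodeAlgHomOp k H
      α := 1
      β := 1
      left := fun h => by
        have := HopfAlgebra.mul_antipode_rTensor_comul_apply (R := k) h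
        rw [Algebra.algebraMap_eq_smul_one] at this
        refine Eq.trans ?_ this
        change leftForm _ _ (Coalgebra.comul (R := k) h) = _
        generalize Coalgebra.comul (R := k) h = p
        induction p with
        | zero => simp
        | tmul x y => simp
        | add x y hx hy => simp only [map_add, hx, hy]
      right := fun h => by
        have := HopfAlgebra.mul_antipode_lTensor_comul_apply (R := k) h
        rw [Algebra.algebraMap_eq_smul_one] at this
        refine Eq.trans ?_ this
        change rightForm _ _ (Coalgebra.comul (R := k) h) = _
        generalize Coalgebra.comul (R := k) h = p
        induction p with
        | zero => simp
        | tmul x y => simp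
        | add x y hx hy => simp only [map_add, hx, hy]
      middle := by simp [Algebra.TensorProduct.one_def]
      outer := by simp [Algebra.TensorProduct.one_def] }

end Hopf
/-! ### Crossed systems and crossed products -/

section Crossed

set_option maxSynthPendingDepth 10

variable {k : Type u} [Field k]

/-- `(f, J)` is a twisted homomorphism between the quasi-bialgebras `Q` and `R`. -/
structure IsTwistedHom {A B : Type v} [Ring A] [Algebra k A] [Ring B] [Algebra k B]
    (Q : QuasiBialgebra k A) (R : QuasiBialgebra k B) (f : A →ₐ[k] B) (J : (B ⊗[k] B)ˣ) :
    Prop where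
  associator : (R.Φ : B ⊗[k] (B ⊗[k] B)) * comulLeft B R.Δ J * oneRight₂ k B J =
    idTensor B R.Δ J * oneLeft B (B ⊗[k] B) J * tensor₃ f Q.Φ
  counit_left : counitLeft R.ε (J : B ⊗[k] B) = 1
  counit_right : counitRight R.ε (J : B ⊗[k] B) = 1
  counit : ∀ a : A, R.ε (f a) = Q.ε a
  comul : ∀ a : A, R.Δ (f a) * J = J * tensor₂ f (Q.Δ a)

/-- A `G`-crossed system `(σ_*, θ_(σ,τ), J_σ)` over a quasi-bialgebra. -/
structure CrossedSystem (G : Type w) [Group G] {A : Type v} [Ring A] [Algebra k A]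
    (Q : QuasiBialgebra k A) where
  /-- the automorphisms `σ_*` -/
  act : G → A ≃ₐ[k] A
  J : G → (A ⊗[k] A)ˣ
  θ : G → G → Aˣ
  twisted : ∀ σ, IsTwistedHom Q Q (act σ : A →ₐ[k] A) (J σ)
  counit_θ : ∀ σ τ, Q.ε (θ σ τ) = 1
  act_one : act 1 = AlgEquiv.refl
  J_one : J 1 = 1
  θ_act : ∀ σ τ a, θ σ τ * act (σ * τ) a = act σ (act τ a) * θ σ τ
  θ_assoc : ∀ σ τ ρ,
    (θ σ τ * θ (σ * τ) ρ : A) = act σ (θ τ ρ) * θ σ (τ * ρ)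
  θ_one_left : ∀ σ, θ 1 σ = 1
  θ_one_right : ∀ σ, θ σ 1 = 1
  comul_θ : ∀ σ τ, Q.Δ (θ σ τ) * J (σ * τ) =
    J σ * tensor₂ (act σ : A →ₐ[k] A) (J τ) * ((θ σ τ : A) ⊗ₜ[k] (θ σ τ : A))

namespace CrossedSystem

variable {G : Type w} [Group G] {A : Type v} [Ring A] [Algebra k A] {Q : QuasiBialgebra k A}
variable (C : CrossedSystem G Q)

/-- The vector space `A # G = A ⊗ kG`; the element `x # σ` is `Finsupp.single σ x`. -/
def Product (_C : CrossedSystem G Q) : Type (max w v) := G →₀ A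

noncomputable instance : AddCommGroup C.Product := inferInstanceAs (AddCommGroup (G →₀ A))

noncomputable instance : Module k C.Product := inferInstanceAs (Module k (G →₀ A))

/-- `x ↦ x # σ`. -/
noncomputable def incl (σ : G) : A →ₗ[k] C.Product := Finsupp.lsingle σ

/-- A linear map out of `A # G` from its components. -/
noncomputable def lift {M : Type*} [AddCommGroup M] [Module k M] (f : G → A →ₗ[k] M) :
    C.Product →ₗ[k] M :=
  (Finsupp.lsum k f : (G →₀ A) →ₗ[k] M)

@[simp] theorem lift_incl {M : Type*} [AddCommGroup M] [Module k M] (f : G → A →ₗ[k] M) (σ : G)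
    (x : A) : C.lift f (C.incl σ x) = f σ x := by
  unfold lift incl
  erw [Finsupp.lsum_apply]
  erw [Finsupp.lsingle_apply, Finsupp.sum_single_index]
  exact map_zero _

theorem induction {p : C.Product → Prop} (h0 : p 0) (hadd : ∀ x y, p x → p y → p (x + y))
    (hs : ∀ σ x, p (C.incl σ x)) (z : C.Product) : p z :=
  Finsupp.induction_linear z h0 hadd hs

/-- `(x # σ)(y # τ) = x σ_*(y) θ_(σ,τ) # στ`. -/
noncomputable def mulMap : C.Product →ₗ[k] C.Product →ₗ[k] C.Product :=
  C.lift fun σ => LinearMap.flip (C.lift fun τ => LinearMap.flip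
    (((LinearMap.mul k A).compl₂ ((LinearMap.mulRight k (C.θ σ τ : A)).comp
      (C.act σ).toLinearMap)).compr₂ (C.incl (σ * τ))))

noncomputable instance : Mul C.Product := ⟨fun x y => C.mulMap x y⟩

noncomputable instance : One C.Product := ⟨C.incl 1 1⟩

theorem mul_def (x y : C.Product) : x * y = C.mulMap x y := rfl

theorem one_def : (1 : C.Product) = C.incl 1 1 := rfl

@[simp] theorem incl_mul_incl (σ τ : G) (x y : A) :
    C.incl σ x * C.incl τ y = C.incl (σ * τ) (x * C.act σ y * C.θ σ τ) := by
  simp [mul_def, mulMap, mul_assoc]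

noncomputable instance : Ring C.Product :=
  { (inferInstance : AddCommGroup C.Product) with
    mul := (· * ·)
    one := 1
    left_distrib := fun x y z => by simp only [mul_def, map_add]
    right_distrib := fun x y z => by simp only [mul_def, map_add, LinearMap.add_apply]
    zero_mul := fun x => by simp only [mul_def, map_zero, LinearMap.zero_apply]
    mul_zero := fun x => by simp only [mul_def, map_zero]
    mul_assoc := fun x y z => by
      induction x using C.induction with
      | h0 => simp only [mul_def, map_zero, LinearMap.zero_apply]
      | hadd x y hx hy =>
        simp only [mul_def, map_add, LinearMap.add_apply] at hx hy ⊢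
        rw [hx, hy]
      | hs σ x =>
        induction y using C.induction with
        | h0 => simp only [mul_def, map_zero, LinearMap.zero_apply]
        | hadd x y hx hy =>
          simp only [mul_def, map_add, LinearMap.add_apply] at hx hy ⊢
          rw [hx, hy]
        | hs τ y =>
          induction z using C.induction with
          | h0 => simp only [mul_def, map_zero]
          | hadd x y hx hy =>
            simp only [mul_def, map_add] at hx hy ⊢
            rw [hx, hy]
          | hs ρ z =>
            simp only [incl_mul_incl, mul_assoc, map_mul]
            have h1 := C.θ_act σ τ z
            have h2 := C.θ_assoc σ τ ρ
            rw [← mul_assoc (C.θ σ τ : A), h1, mul_assoc, h2]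
    one_mul := fun x => by
      induction x using C.induction with
      | h0 => simp only [mul_def, map_zero]
      | hadd x y hx hy =>
        simp only [mul_def, map_add] at hx hy ⊢
        rw [hx, hy]
      | hs σ x => simp [one_def, C.act_one, C.θ_one_left]
    mul_one := fun x => by
      induction x using C.induction with
      | h0 => simp only [mul_def, map_zero, LinearMap.zero_apply]
      | hadd x y hx hy =>
        simp only [mul_def, map_add, LinearMap.add_apply] at hx hy ⊢
        rw [hx, hy]
      | hs σ x => simp [one_def, C.θ_one_right] }

noncomputable instance : Algebra k C.Product :=
  Algebra.ofModule (fun r x y => by simp only [mul_def, map_smul, LinearMap.smul_apply])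
    (fun r x y => by simp only [mul_def, map_smul])

/-- `a ↦ a # 1`, an algebra map. -/
noncomputable def inclOne : A →ₐ[k] C.Product :=
  AlgHom.ofLinearMap (C.incl 1) rfl fun x y => by simp [C.act_one, C.θ_one_left]

theorem inclOne_apply (a : A) : C.inclOne a = C.incl 1 a := rfl

/-- `x ⊗ y ↦ (x # σ) ⊗ (y # σ)`. -/
noncomputable abbrev incl₂ (σ : G) : A ⊗[k] A →ₗ[k] C.Product ⊗[k] C.Product :=
  TensorProduct.map (C.incl σ) (C.incl σ)

/-- `x ⊗ y ⊗ z ↦ (x # σ) ⊗ (y # σ) ⊗ (z # σ)`. -/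
noncomputable abbrev incl₃ (σ : G) :
    A ⊗[k] (A ⊗[k] A) →ₗ[k] C.Product ⊗[k] (C.Product ⊗[k] C.Product) :=
  TensorProduct.map (C.incl σ) (C.incl₂ σ)

theorem incl₂_mul_incl₂ (σ τ : G) (p q : A ⊗[k] A) :
    C.incl₂ σ p * C.incl₂ τ q = C.incl₂ (σ * τ)
      (p * tensor₂ (C.act σ : A →ₐ[k] A) q * ((C.θ σ τ : A) ⊗ₜ[k] (C.θ σ τ : A))) := by
  induction p with
  | zero => simp
  | add x y hx hy => simp only [map_add, add_mul, hx, hy]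
  | tmul a b =>
    induction q with
    | zero => simp
    | add x y hx hy => simp only [map_add, mul_add, add_mul, hx, hy]
    | tmul c d => simp

/-- `Δ(x # σ) = x₁ J_σ¹ # σ ⊗ x₂ J_σ² # σ`. -/
noncomputable def comulMap : C.Product →ₗ[k] C.Product ⊗[k] C.Product :=
  C.lift fun σ => (C.incl₂ σ).comp
    ((LinearMap.mulRight k (C.J σ : A ⊗[k] A)).comp Q.Δ.toLinearMap)

theorem comulMap_incl (σ : G) (x : A) :
    C.comulMap (C.incl σ x) = C.incl₂ σ (Q.Δ x * C.J σ) := by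
  simp [comulMap]

/-- `ε(x # σ) = ε(x)`. -/
noncomputable def counitMap : C.Product →ₗ[k] k :=
  C.lift fun _ => Q.ε.toLinearMap

@[simp] theorem counitMap_incl (σ : G) (x : A) : C.counitMap (C.incl σ x) = Q.ε x := by
  simp [counitMap]

/-- The comultiplication of `A # G`. -/
noncomputable def comulHom : C.Product →ₐ[k] C.Product ⊗[k] C.Product :=
  AlgHom.ofLinearMap C.comulMap
    (by rw [one_def, comulMap_incl, map_one, C.J_one, Units.val_one, mul_one,
          Algebra.TensorProduct.one_def, TensorProduct.map_tmul, ← one_def,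
          ← Algebra.TensorProduct.one_def])
    (fun x y => by
      induction x using C.induction with
      | h0 => simp only [zero_mul, map_zero]
      | hadd x y hx hy => simp only [add_mul, map_add, hx, hy]
      | hs σ x =>
        induction y using C.induction with
        | h0 => simp only [mul_zero, map_zero]
        | hadd x y hx hy => simp only [mul_add, map_add, hx, hy]
        | hs τ y =>
          rw [incl_mul_incl, comulMap_incl, comulMap_incl, comulMap_incl, incl₂_mul_incl₂]
          congr 1
          have h1 := C.comul_θ σ τ
          have h2 := (C.twisted σ).comul y
          simp only [map_mul, mul_assoc] at h1 h2 ⊢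
          rw [h1, ← mul_assoc (Q.Δ (C.act σ y))]
          erw [h2]
          simp only [mul_assoc])

/-- The counit of `A # G`. -/
noncomputable def counitHom : C.Product →ₐ[k] k :=
  AlgHom.ofLinearMap C.counitMap
    (by rw [one_def, counitMap_incl, map_one])
    (fun x y => by
      induction x using C.induction with
      | h0 => simp only [zero_mul, map_zero]
      | hadd x y hx hy => simp only [add_mul, map_add, hx, hy]
      | hs σ x =>
        induction y using C.induction with
        | h0 => simp only [mul_zero, map_zero]
        | hadd x y hx hy => simp only [mul_add, map_add, hx, hy]
        | hs τ y =>
          rw [incl_mul_incl, counitMap_incl, counitMap_incl, counitMap_incl, map_mul, map_mul,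
            C.counit_θ, mul_one]
          congr 1
          exact (C.twisted σ).counit y)

theorem comulHom_incl (σ : G) (x : A) :
    C.comulHom (C.incl σ x) = C.incl₂ σ (Q.Δ x * C.J σ) := C.comulMap_incl σ x

theorem counitHom_incl (σ : G) (x : A) : C.counitHom (C.incl σ x) = Q.ε x :=
  C.counitMap_incl σ x

theorem comulLeft_incl₂ (σ : G) (p : A ⊗[k] A) :
    comulLeft C.Product C.comulHom (C.incl₂ σ p) =
      C.incl₃ σ (comulLeft A Q.Δ p * oneRight₂ k A (C.J σ)) := by
  have key : ∀ (z : A ⊗[k] A) (b : A),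
      Algebra.TensorProduct.assoc k k k C.Product C.Product C.Product
        (C.incl₂ σ z ⊗ₜ C.incl σ b) =
        C.incl₃ σ (Algebra.TensorProduct.assoc k k k A A A (z ⊗ₜ b)) := by
    intro z b
    induction z with
    | zero => simp
    | add x y hx hy => simp only [map_add, TensorProduct.add_tmul, hx, hy]
    | tmul c d => simp
  induction p with
  | zero => simp
  | add x y hx hy => simp only [map_add, add_mul, hx, hy]
  | tmul a b =>
    rw [TensorProduct.map_tmul, comulLeft_tmul, comulHom_incl, key, comulLeft_tmul]
    rw [show oneRight₂ k A (C.J σ) = Algebra.TensorProduct.assoc k k k A A A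
      ((C.J σ : A ⊗[k] A) ⊗ₜ 1) from (assoc_eq_oneRightGen _).symm, ← map_mul,
      Algebra.TensorProduct.tmul_mul_tmul, mul_one]

theorem idTensor_incl₂ (σ : G) (p : A ⊗[k] A) :
    idTensor C.Product C.comulHom (C.incl₂ σ p) =
      C.incl₃ σ (idTensor A Q.Δ p * oneLeft A (A ⊗[k] A) (C.J σ)) := by
  induction p with
  | zero => simp
  | add x y hx hy => simp only [map_add, add_mul, hx, hy]
  | tmul a b => simp [comulHom_incl]

theorem tensor₃_mul_incl₃ (σ : G) (p q : A ⊗[k] (A ⊗[k] A)) :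
    tensor₃ C.inclOne p * C.incl₃ σ q = C.incl₃ σ (p * q) := by
  induction p with
  | zero => simp
  | add x y hx hy => simp only [map_add, add_mul, hx, hy]
  | tmul a p =>
    induction p with
    | zero => simp
    | add x y hx hy => simp only [map_add, add_mul, TensorProduct.tmul_add, hx, hy]
    | tmul b c =>
      induction q with
      | zero => simp
      | add x y hx hy => simp only [map_add, mul_add, hx, hy]
      | tmul x q =>
        induction q with
        | zero => simp
        | add x y hx hy => simp only [map_add, mul_add, TensorProduct.tmul_add, hx, hy]
        | tmul y z => simp [inclOne_apply, C.act_one, C.θ_one_left]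

theorem incl₃_mul_tensor₃ (σ : G) (p q : A ⊗[k] (A ⊗[k] A)) :
    C.incl₃ σ q * tensor₃ C.inclOne p =
      C.incl₃ σ (q * tensor₃ (C.act σ : A →ₐ[k] A) p) := by
  induction p with
  | zero => simp
  | add x y hx hy => simp only [map_add, mul_add, hx, hy]
  | tmul a p =>
    induction p with
    | zero => simp
    | add x y hx hy => simp only [map_add, mul_add, TensorProduct.tmul_add, hx, hy]
    | tmul b c =>
      induction q with
      | zero => simp
      | add x y hx hy => simp only [map_add, add_mul, hx, hy]
      | tmul x q =>
        induction q with
        | zero => simp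
        | add x y hx hy => simp only [map_add, add_mul, TensorProduct.tmul_add, hx, hy]
        | tmul y z => simp [inclOne_apply, C.θ_one_right]

theorem comulHom_inclOne (a : A) : C.comulHom (C.inclOne a) = tensor₂ C.inclOne (Q.Δ a) := by
  rw [inclOne_apply, comulHom_incl, C.J_one, Units.val_one, mul_one]
  rfl

theorem counitHom_inclOne (a : A) : C.counitHom (C.inclOne a) = Q.ε a := by
  rw [inclOne_apply, counitHom_incl]

/-- The quasi-bialgebra structure of `A # G`, with associator
`Φ¹ # 1 ⊗ Φ² # 1 ⊗ Φ³ # 1`. -/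
noncomputable def product : QuasiBialgebra k C.Product where
  Δ := C.comulHom
  ε := C.counitHom
  Φ := unitsMap (tensor₃ C.inclOne) Q.Φ
  quasi_coassoc h := by
    induction h using C.induction with
    | h0 => simp
    | hadd x y hx hy => simp only [map_add, mul_add, add_mul, hx, hy]
    | hs σ x =>
      rw [comulHom_incl, comulLeft_incl₂, idTensor_incl₂, coe_unitsMap, tensor₃_mul_incl₃,
        incl₃_mul_tensor₃]
      congr 1
      have h1 := Q.quasi_coassoc x
      have h2 := (C.twisted σ).associator
      simp only [map_mul, mul_assoc] at h1 h2 ⊢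
      rw [← mul_assoc (Q.Φ : A ⊗[k] (A ⊗[k] A)), h1, mul_assoc, h2]
  counit_right h := by
    induction h using C.induction with
    | h0 => simp
    | hadd x y hx hy => simp only [map_add, hx, hy]
    | hs σ x =>
      have : ∀ p : A ⊗[k] A, counitRight C.counitHom (C.incl₂ σ p) =
          C.incl σ (counitRight Q.ε p) := by
        intro p
        induction p with
        | zero => simp
        | add x y hx hy => simp only [map_add, hx, hy]
        | tmul x y => simp [counitHom_incl]
      rw [comulHom_incl, this, map_mul, Q.counit_right, (C.twisted σ).counit_right, mul_one]
  counit_left h := by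
    induction h using C.induction with
    | h0 => simp
    | hadd x y hx hy => simp only [map_add, hx, hy]
    | hs σ x =>
      have : ∀ p : A ⊗[k] A, counitLeft C.counitHom (C.incl₂ σ p) =
          C.incl σ (counitLeft Q.ε p) := by
        intro p
        induction p with
        | zero => simp
        | add x y hx hy => simp only [map_add, hx, hy]
        | tmul x y => simp [counitHom_incl]
      rw [comulHom_incl, this, map_mul, Q.counit_left, (C.twisted σ).counit_left, mul_one]
  cocycle := by
    let j₄ : A ⊗[k] (A ⊗[k] (A ⊗[k] A)) →ₐ[k]
        C.Product ⊗[k] (C.Product ⊗[k] (C.Product ⊗[k] C.Product)) :=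
      Algebra.TensorProduct.map C.inclOne (tensor₃ C.inclOne)
    have e0 : ∀ (p : A ⊗[k] A) (b : A),
        Algebra.TensorProduct.assoc k k k C.Product C.Product C.Product
          (tensor₂ C.inclOne p ⊗ₜ C.inclOne b) =
        tensor₃ C.inclOne (Algebra.TensorProduct.assoc k k k A A A (p ⊗ₜ b)) := by
      intro z b
      induction z with
      | zero => simp
      | add x y hx hy => simp only [map_add, TensorProduct.add_tmul, hx, hy]
      | tmul c d => simp
    have e0' : ∀ (p : A ⊗[k] A) (b : A ⊗[k] A),
        Algebra.TensorProduct.assoc k k k C.Product C.Product (C.Product ⊗[k] C.Product)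
          (tensor₂ C.inclOne p ⊗ₜ tensor₂ C.inclOne b) =
        j₄ (Algebra.TensorProduct.assoc k k k A A (A ⊗[k] A) (p ⊗ₜ b)) := by
      intro z b
      induction z with
      | zero => simp
      | add x y hx hy => simp only [map_add, TensorProduct.add_tmul, hx, hy]
      | tmul c d => simp [j₄]
    have e1 : ∀ z, oneLeft C.Product (C.Product ⊗[k] (C.Product ⊗[k] C.Product))
        (tensor₃ C.inclOne z) = j₄ (oneLeft A (A ⊗[k] (A ⊗[k] A)) z) := by
      intro z; simp [j₄]
    have e2 : ∀ z, idTensor C.Product (comulLeft C.Product C.comulHom) (tensor₃ C.inclOne z) =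
        j₄ (idTensor A (comulLeft A Q.Δ) z) := by
      intro z
      induction z with
      | zero => simp
      | add x y hx hy => simp only [map_add, hx, hy]
      | tmul a z =>
        induction z with
        | zero => simp
        | add x y hx hy => simp only [map_add, TensorProduct.tmul_add, hx, hy]
        | tmul b c => simp [j₄, comulHom_inclOne, e0]
    have e3 : ∀ z, oneRight₃ k C.Product (tensor₃ C.inclOne z) = j₄ (oneRight₃ k A z) := by
      intro z
      induction z with
      | zero => simp
      | add x y hx hy => simp only [map_add, hx, hy]
      | tmul a z =>
        induction z with
        | zero => simp
        | add x y hx hy => simp only [map_add, TensorProduct.tmul_add, hx, hy]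
        | tmul b c => simp [j₄]
    have e4 : ∀ z, idTensor C.Product (idTensor C.Product C.comulHom) (tensor₃ C.inclOne z) =
        j₄ (idTensor A (idTensor A Q.Δ) z) := by
      intro z
      induction z with
      | zero => simp
      | add x y hx hy => simp only [map_add, hx, hy]
      | tmul a z =>
        induction z with
        | zero => simp
        | add x y hx hy => simp only [map_add, TensorProduct.tmul_add, hx, hy]
        | tmul b c => simp [j₄, comulHom_inclOne]
    have e5 : ∀ z, comulLeft (C.Product ⊗[k] C.Product) C.comulHom (tensor₃ C.inclOne z) =
        j₄ (comulLeft (A ⊗[k] A) Q.Δ z) := by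
      intro z
      induction z with
      | zero => simp
      | add x y hx hy => simp only [map_add, hx, hy]
      | tmul a z =>
        rw [Algebra.TensorProduct.map_tmul, comulLeft_tmul, comulLeft_tmul, comulHom_inclOne, e0']
    rw [coe_unitsMap, e1, e2, e3, e4, e5, ← map_mul, ← map_mul, ← map_mul, Q.cocycle]
  counit_middle := by
    have : ∀ z, idTensor C.Product (counitLeft C.counitHom) (tensor₃ C.inclOne z) =
        tensor₂ C.inclOne (idTensor A (counitLeft Q.ε) z) := by
      intro z
      induction z with
      | zero => simp
      | add x y hx hy => simp only [map_add, hx, hy]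
      | tmul a z =>
        induction z with
        | zero => simp
        | add x y hx hy => simp only [map_add, TensorProduct.tmul_add, hx, hy]
        | tmul b c => simp [counitHom_inclOne]
    rw [coe_unitsMap, this, Q.counit_middle, map_one]

end CrossedSystem

end Crossed
/-! ### The tensor category of finite-dimensional representations -/

section Representations

set_option maxSynthPendingDepth 10

variable {k : Type u} [Field k] {A : Type v} [Ring A] [Algebra k A]

/-- `(a ⊗ b) · (v ⊗ w) = a · v ⊗ b · w`. -/
noncomputable def boxRep {B : Type*} [Ring B] [Algebra k B] {V W : Type*} [AddCommGroup V]
    [Module k V] [AddCommGroup W] [Module k W] (ρ : A →ₐ[k] Module.End k V)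
    (σ : B →ₐ[k] Module.End k W) : A ⊗[k] B →ₐ[k] Module.End k (V ⊗[k] W) :=
  (Module.endTensorEndAlgHom (R := k) (S := k) (A := k) (M := V) (N := W)).comp
    (Algebra.TensorProduct.map ρ σ)

@[simp] theorem boxRep_tmul {B : Type*} [Ring B] [Algebra k B] {V W : Type*} [AddCommGroup V]
    [Module k V] [AddCommGroup W] [Module k W] (ρ : A →ₐ[k] Module.End k V)
    (σ : B →ₐ[k] Module.End k W) (a : A) (b : B) :
    boxRep ρ σ (a ⊗ₜ b) = TensorProduct.map (ρ a) (σ b) := by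
  simp only [boxRep, AlgHom.comp_apply, Algebra.TensorProduct.map_tmul]
  rfl

/-- A finite-dimensional representation of the algebra `A` underlying `Q`. -/
structure Rep (Q : QuasiBialgebra k A) where
  V : Type u
  [addCommGroup : AddCommGroup V]
  [module : Module k V]
  [finite : FiniteDimensional k V]
  ρ : A →ₐ[k] Module.End k V

namespace Rep

attribute [instance] Rep.addCommGroup Rep.module Rep.finite

variable {Q : QuasiBialgebra k A}

/-- Morphisms of representations are the `A`-linear maps. -/
@[ext] structure Hom (X Y : Rep Q) where
  f : X.V →ₗ[k] Y.V
  comm : ∀ a v, f (X.ρ a v) = Y.ρ a (f v)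

instance : Category (Rep Q) where
  Hom := Hom
  id X := ⟨LinearMap.id, fun _ _ => rfl⟩
  comp g h := ⟨h.f.comp g.f, fun a v => by simp [g.comm, h.comm]⟩

@[ext] theorem hom_ext {X Y : Rep Q} {g h : X ⟶ Y} (w : ∀ v, g.f v = h.f v) : g = h :=
  Hom.ext (LinearMap.ext w)

@[simp] theorem id_f (X : Rep Q) : Hom.f (𝟙 X) = LinearMap.id := rfl

@[simp] theorem comp_f {X Y Z : Rep Q} (g : X ⟶ Y) (h : Y ⟶ Z) :
    Hom.f (g ≫ h) = h.f.comp g.f := rfl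

/-- An isomorphism from a bijective intertwiner. -/
def mkIso {X Y : Rep Q} (e : X.V ≃ₗ[k] Y.V) (h : ∀ a v, e (X.ρ a v) = Y.ρ a (e v)) : X ≅ Y where
  hom := ⟨e.toLinearMap, h⟩
  inv := ⟨e.symm.toLinearMap, fun a v => by
    apply e.injective
    simp [h]⟩
  hom_inv_id := by ext v; simp
  inv_hom_id := by ext v; simp

@[simp] theorem mkIso_hom_f {X Y : Rep Q} (e : X.V ≃ₗ[k] Y.V)
    (h : ∀ a v, e (X.ρ a v) = Y.ρ a (e v)) : (mkIso e h).hom.f = e.toLinearMap := rfl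

@[simp] theorem mkIso_inv_f {X Y : Rep Q} (e : X.V ≃ₗ[k] Y.V)
    (h : ∀ a v, e (X.ρ a v) = Y.ρ a (e v)) : (mkIso e h).inv.f = e.symm.toLinearMap := rfl

section Linear

variable {X Y : Rep Q}

/-- The `A`-linear maps form a subspace of the linear maps. -/
def homSubmodule (X Y : Rep Q) : Submodule k (X.V →ₗ[k] Y.V) where
  carrier := {f | ∀ a v, f (X.ρ a v) = Y.ρ a (f v)}
  add_mem' := fun hf hg a v => by simp [hf a v, hg a v]
  zero_mem' := fun a v => by simp
  smul_mem' := fun r f hf a v => by simp [hf a v]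

/-- Morphisms as elements of the subspace of `A`-linear maps. -/
def homEquiv (X Y : Rep Q) : (X ⟶ Y) ≃ homSubmodule X Y where
  toFun g := ⟨g.f, g.comm⟩
  invFun g := ⟨g.1, g.2⟩
  left_inv _ := rfl
  right_inv _ := rfl

instance : AddCommGroup (X ⟶ Y) := (homEquiv X Y).addCommGroup

instance : Module k (X ⟶ Y) := (homEquiv X Y).module k

@[simp] theorem add_f (g h : X ⟶ Y) : Hom.f (g + h) = g.f + h.f := rfl

@[simp] theorem smul_f (r : k) (g : X ⟶ Y) : Hom.f (r • g) = r • g.f := rfl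

end Linear

instance : Preadditive (Rep Q) where
  add_comp X Y Z g g' h := by ext v; simp
  comp_add X Y Z g h h' := by ext v; simp

instance : CategoryTheory.Linear k (Rep Q) where
  smul_comp X Y Z r g h := by ext v; simp
  comp_smul X Y Z g r h := by ext v; simp

/-- `a · (v ⊗ w) = Δ(a) (v ⊗ w)`. -/
noncomputable def tensorObj (X Y : Rep Q) : Rep Q where
  V := X.V ⊗[k] Y.V
  ρ := (boxRep X.ρ Y.ρ).comp Q.Δ

/-- `a · r = ε(a) r` on the ground field. -/
noncomputable def unitRep (ε : A →ₐ[k] k) : A →ₐ[k] Module.End k k :=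
  (Algebra.ofId k (Module.End k k)).comp ε

@[simp] theorem unitRep_apply (ε : A →ₐ[k] k) (a : A) (r : k) : unitRep ε a r = ε a * r := rfl

/-- The trivial representation, through the counit. -/
noncomputable def unit (Q : QuasiBialgebra k A) : Rep Q where
  V := k
  ρ := unitRep Q.ε

theorem tensorObj_ρ (X Y : Rep Q) (a : A) : (tensorObj X Y).ρ a = boxRep X.ρ Y.ρ (Q.Δ a) := rfl

theorem boxRep_natural {B : Type*} [Ring B] [Algebra k B] {V W V' W' : Type*} [AddCommGroup V]
    [Module k V] [AddCommGroup W] [Module k W] [AddCommGroup V'] [Module k V'] [AddCommGroup W']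
    [Module k W'] (ρ : A →ₐ[k] Module.End k V) (σ : B →ₐ[k] Module.End k W)
    (ρ' : A →ₐ[k] Module.End k V') (σ' : B →ₐ[k] Module.End k W')
    (f : V →ₗ[k] V') (g : W →ₗ[k] W') (hf : ∀ a v, f (ρ a v) = ρ' a (f v))
    (hg : ∀ a v, g (σ a v) = σ' a (g v)) (z : A ⊗[k] B) (t : V ⊗[k] W) :
    TensorProduct.map f g (boxRep ρ σ z t) = boxRep ρ' σ' z (TensorProduct.map f g t) := by
  induction z with
  | zero => simp
  | add x y hx hy => simp only [map_add, LinearMap.add_apply, hx, hy]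
  | tmul a b =>
    induction t with
    | zero => simp
    | add x y hx hy => simp only [map_add, hx, hy]
    | tmul v w => simp [hf, hg]

/-- The tensor product of morphisms. -/
noncomputable def tensorHom {X Y X' Y' : Rep Q} (g : X ⟶ X') (h : Y ⟶ Y') :
    tensorObj X Y ⟶ tensorObj X' Y' :=
  ⟨TensorProduct.map g.f h.f, fun a t =>
    boxRep_natural X.ρ Y.ρ X'.ρ Y'.ρ g.f h.f g.comm h.comm (Q.Δ a) t⟩

/-- The action of `A ⊗ A ⊗ A` on `X ⊗ Y ⊗ Z`. -/
noncomputable abbrev act₃ (X Y Z : Rep Q) :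
    A ⊗[k] (A ⊗[k] A) →ₐ[k] Module.End k (X.V ⊗[k] (Y.V ⊗[k] Z.V)) :=
  boxRep X.ρ (boxRep Y.ρ Z.ρ)

theorem assoc_boxRep {C D V W U : Type*} [Ring C] [Algebra k C] [Ring D] [Algebra k D]
    [AddCommGroup V] [Module k V] [AddCommGroup W] [Module k W] [AddCommGroup U] [Module k U]
    (ρ : A →ₐ[k] Module.End k V) (σ : C →ₐ[k] Module.End k W) (τ : D →ₐ[k] Module.End k U)
    (p : A ⊗[k] C) (b : D) (t : (V ⊗[k] W) ⊗[k] U) :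
    TensorProduct.assoc k V W U (TensorProduct.map (boxRep ρ σ p) (τ b) t) =
      boxRep ρ (boxRep σ τ) (Algebra.TensorProduct.assoc k k k A C D (p ⊗ₜ b))
        (TensorProduct.assoc k V W U t) := by
  induction t with
  | zero => simp
  | add x y hx hy => simp only [map_add, hx, hy]
  | tmul t u =>
    rw [TensorProduct.map_tmul]
    induction t with
    | zero => simp
    | add x y hx hy => simp only [map_add, TensorProduct.add_tmul, hx, hy]
    | tmul v w =>
      induction p with
      | zero => simp
      | add x y hx hy => simp only [map_add, TensorProduct.add_tmul, LinearMap.add_apply, hx, hy]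
      | tmul c d => simp

theorem assoc_boxRep_comul {B : Type v} [Ring B] [Algebra k B] {V W U : Type*}
    [AddCommGroup V] [Module k V] [AddCommGroup W] [Module k W] [AddCommGroup U] [Module k U]
    (Δ : A →ₐ[k] A ⊗[k] A) (ρ : A →ₐ[k] Module.End k V) (σ : A →ₐ[k] Module.End k W)
    (τ : B →ₐ[k] Module.End k U) (z : A ⊗[k] B) (t : (V ⊗[k] W) ⊗[k] U) :
    TensorProduct.assoc k V W U (boxRep ((boxRep ρ σ).comp Δ) τ z t) =
      boxRep ρ (boxRep σ τ) (comulLeft B Δ z) (TensorProduct.assoc k V W U t) := by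
  induction z with
  | zero => simp
  | add x y hx hy => simp only [map_add, LinearMap.add_apply, hx, hy]
  | tmul a b => rw [boxRep_tmul, comulLeft_tmul, AlgHom.comp_apply, assoc_boxRep]

theorem boxRep_idTensor {B C : Type v} [Ring B] [Algebra k B] [Ring C] [Algebra k C]
    {V W : Type*} [AddCommGroup V] [Module k V] [AddCommGroup W] [Module k W]
    (f : B →ₐ[k] C) (ρ : A →ₐ[k] Module.End k V) (σ : C →ₐ[k] Module.End k W) (z : A ⊗[k] B) :
    boxRep ρ (σ.comp f) z = boxRep ρ σ (idTensor A f z) := by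
  induction z with
  | zero => simp
  | add x y hx hy => simp only [map_add, hx, hy]
  | tmul a b => simp

/-- The action of a unit as a linear equivalence. -/
noncomputable def unitEquiv {B : Type*} [Ring B] [Algebra k B] {V : Type*} [AddCommGroup V]
    [Module k V] (ρ : B →ₐ[k] Module.End k V) (b : Bˣ) : V ≃ₗ[k] V :=
  LinearEquiv.ofLinearMap (ρ b) (ρ (b⁻¹ : Bˣ))
    (by rw [← Module.End.mul_eq_comp, ← map_mul, Units.mul_inv, map_one]; rfl)
    (by rw [← Module.End.mul_eq_comp, ← map_mul, Units.inv_mul, map_one]; rfl)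

@[simp] theorem unitEquiv_apply {B : Type*} [Ring B] [Algebra k B] {V : Type*} [AddCommGroup V]
    [Module k V] (ρ : B →ₐ[k] Module.End k V) (b : Bˣ) (v : V) : unitEquiv ρ b v = ρ b v := rfl

theorem assoc_intertwines {V W U : Type*} [AddCommGroup V] [Module k V] [AddCommGroup W]
    [Module k W] [AddCommGroup U] [Module k U] (Q : QuasiBialgebra k A)
    (ρ : A →ₐ[k] Module.End k V) (σ : A →ₐ[k] Module.End k W) (τ : A →ₐ[k] Module.End k U)
    (a : A) (t : (V ⊗[k] W) ⊗[k] U) :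
    boxRep ρ (boxRep σ τ) Q.Φ (TensorProduct.assoc k V W U
      (boxRep ((boxRep ρ σ).comp Q.Δ) τ (Q.Δ a) t)) =
    boxRep ρ ((boxRep σ τ).comp Q.Δ) (Q.Δ a) (boxRep ρ (boxRep σ τ) Q.Φ
        (TensorProduct.assoc k V W U t)) := by
  rw [assoc_boxRep_comul, boxRep_idTensor, ← Module.End.mul_apply, ← Module.End.mul_apply,
    ← map_mul, ← map_mul, Q.quasi_coassoc]

theorem lid_boxRep {B V : Type*} [Ring B] [Algebra k B] [AddCommGroup V] [Module k V]
    (ε : A →ₐ[k] k) (σ : B →ₐ[k] Module.End k V) (z : A ⊗[k] B) (t : k ⊗[k] V) :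
    TensorProduct.lid k V (boxRep (unitRep ε) σ z t) =
      σ (counitLeft ε z) (TensorProduct.lid k V t) := by
  induction z with
  | zero => simp
  | add x y hx hy => simp only [map_add, LinearMap.add_apply, hx, hy]
  | tmul a b =>
    induction t with
    | zero => simp
    | add x y hx hy => simp only [map_add, hx, hy]
    | tmul r v =>
      simp only [boxRep_tmul, TensorProduct.map_tmul, unitRep_apply, TensorProduct.lid_tmul,
        TensorProduct.rid_tmul, counitLeft_tmul, counitRight_tmul, mul_smul, map_smul,
        LinearMap.smul_apply]
      exact smul_comm _ _ _

theorem rid_boxRep {B V : Type*} [Ring B] [Algebra k B] [AddCommGroup V] [Module k V]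
    (ε : A →ₐ[k] k) (σ : B →ₐ[k] Module.End k V) (z : B ⊗[k] A) (t : V ⊗[k] k) :
    TensorProduct.rid k V (boxRep σ (unitRep ε) z t) =
      σ (counitRight ε z) (TensorProduct.rid k V t) := by
  induction z with
  | zero => simp
  | add x y hx hy => simp only [map_add, LinearMap.add_apply, hx, hy]
  | tmul a b =>
    induction t with
    | zero => simp
    | add x y hx hy => simp only [map_add, hx, hy]
    | tmul r v =>
      simp only [boxRep_tmul, TensorProduct.map_tmul, unitRep_apply, TensorProduct.lid_tmul,
        TensorProduct.rid_tmul, counitLeft_tmul, counitRight_tmul, mul_smul, map_smul,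
        LinearMap.smul_apply]
      exact smul_comm _ _ _

/-- The associativity constraint `(x ⊗ y) ⊗ z ↦ Φ · (x ⊗ (y ⊗ z))`. -/
noncomputable def assocIso (X Y Z : Rep Q) :
    tensorObj (tensorObj X Y) Z ≅ tensorObj X (tensorObj Y Z) :=
  mkIso (X := tensorObj (tensorObj X Y) Z) (Y := tensorObj X (tensorObj Y Z))
    ((TensorProduct.assoc k X.V Y.V Z.V).trans (unitEquiv (act₃ X Y Z) Q.Φ)) fun a t =>
    assoc_intertwines Q X.ρ Y.ρ Z.ρ a t

/-- The left unit constraint. -/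
noncomputable def leftIso (X : Rep Q) : tensorObj (unit Q) X ≅ X :=
  mkIso (X := tensorObj (unit Q) X) (TensorProduct.lid k X.V) fun a t => by
    conv_rhs => rw [← Q.counit_left a]
    exact lid_boxRep Q.ε X.ρ (Q.Δ a) t

/-- The right unit constraint. -/
noncomputable def rightIso (X : Rep Q) : tensorObj X (unit Q) ≅ X :=
  mkIso (X := tensorObj X (unit Q)) (TensorProduct.rid k X.V) fun a t => by
    conv_rhs => rw [← Q.counit_right a]
    exact rid_boxRep Q.ε X.ρ (Q.Δ a) t

noncomputable instance : MonoidalCategoryStruct (Rep Q) where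
  tensorObj := tensorObj
  whiskerLeft X _ _ h := tensorHom (𝟙 X) h
  whiskerRight h Y := tensorHom h (𝟙 Y)
  tensorHom := tensorHom
  tensorUnit := unit Q
  associator := assocIso
  leftUnitor := leftIso
  rightUnitor := rightIso

@[simp] theorem tensorHom_f {X Y X' Y' : Rep Q} (g : X ⟶ X') (h : Y ⟶ Y') :
    Hom.f (g ⊗ₘ h) = TensorProduct.map g.f h.f := rfl

@[simp] theorem whiskerLeft_f (X : Rep Q) {Y Y' : Rep Q} (h : Y ⟶ Y') :
    Hom.f (X ◁ h) = TensorProduct.map LinearMap.id h.f := rfl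

@[simp] theorem whiskerRight_f {X X' : Rep Q} (g : X ⟶ X') (Y : Rep Q) :
    Hom.f (g ▷ Y) = TensorProduct.map g.f LinearMap.id := rfl

theorem associator_f (X Y Z : Rep Q) (t : (X.V ⊗[k] Y.V) ⊗[k] Z.V) :
    (α_ X Y Z).hom.f t = act₃ X Y Z Q.Φ (TensorProduct.assoc k X.V Y.V Z.V t) := rfl

theorem leftUnitor_f (X : Rep Q) : (λ_ X).hom.f = (TensorProduct.lid k X.V).toLinearMap := rfl

theorem rightUnitor_f (X : Rep Q) : (ρ_ X).hom.f = (TensorProduct.rid k X.V).toLinearMap := rfl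

theorem map_assoc_natural {V W U V' W' U' : Type*}
    [AddCommGroup V] [Module k V] [AddCommGroup W] [Module k W] [AddCommGroup U] [Module k U]
    [AddCommGroup V'] [Module k V'] [AddCommGroup W'] [Module k W'] [AddCommGroup U']
    [Module k U'] (f : V →ₗ[k] V') (g : W →ₗ[k] W') (h : U →ₗ[k] U') (t : (V ⊗[k] W) ⊗[k] U) :
    TensorProduct.assoc k V' W' U' (TensorProduct.map (TensorProduct.map f g) h t) =
      TensorProduct.map f (TensorProduct.map g h) (TensorProduct.assoc k V W U t) := by
  induction t with
  | zero => simp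
  | add x y hx hy => simp only [map_add, hx, hy]
  | tmul t u =>
    induction t with
    | zero => simp
    | add x y hx hy => simp only [map_add, TensorProduct.add_tmul, hx, hy]
    | tmul v w => simp

section Coherence

variable {B C D : Type v} [Ring B] [Algebra k B] [Ring C] [Algebra k C] [Ring D] [Algebra k D]
  {V₁ V₂ V₃ V₄ : Type*} [AddCommGroup V₁] [Module k V₁] [AddCommGroup V₂] [Module k V₂]
  [AddCommGroup V₃] [Module k V₃] [AddCommGroup V₄] [Module k V₄]
  (ρ₁ : A →ₐ[k] Module.End k V₁) (ρ₂ : A →ₐ[k] Module.End k V₂)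
  (ρ₃ : A →ₐ[k] Module.End k V₃) (ρ₄ : A →ₐ[k] Module.End k V₄)

theorem map_id_boxRep (σ : B →ₐ[k] Module.End k V₂) (b : B) (t : V₁ ⊗[k] V₂) :
    TensorProduct.map LinearMap.id (σ b) t = boxRep ρ₁ σ (oneLeft A B b) t := by
  rw [Algebra.TensorProduct.includeRight_apply, boxRep_tmul, map_one]
  rfl

theorem assoc_map_boxRep_id (z : A ⊗[k] (A ⊗[k] A)) (t : (V₁ ⊗[k] (V₂ ⊗[k] V₃)) ⊗[k] V₄) :
    TensorProduct.map LinearMap.id (TensorProduct.assoc k V₂ V₃ V₄).toLinearMap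
      (TensorProduct.assoc k V₁ (V₂ ⊗[k] V₃) V₄
        (TensorProduct.map (boxRep ρ₁ (boxRep ρ₂ ρ₃) z) LinearMap.id t)) =
      boxRep ρ₁ (boxRep ρ₂ (boxRep ρ₃ ρ₄)) (oneRight₃ k A z)
        (TensorProduct.map LinearMap.id (TensorProduct.assoc k V₂ V₃ V₄).toLinearMap
          (TensorProduct.assoc k V₁ (V₂ ⊗[k] V₃) V₄ t)) := by
  have h0 : (LinearMap.id : V₄ →ₗ[k] V₄) = ρ₄ 1 := by rw [map_one]; rfl
  induction t with
  | zero => simp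
  | add x y hx hy => simp only [map_add, hx, hy]
  | tmul t v₄ =>
    induction t with
    | zero => simp
    | add x y hx hy => simp only [map_add, TensorProduct.add_tmul, hx, hy]
    | tmul v₁ t =>
      induction t with
      | zero => simp
      | add x y hx hy =>
        simp only [map_add, TensorProduct.add_tmul, TensorProduct.tmul_add, hx, hy]
      | tmul v₂ v₃ =>
        induction z with
        | zero => simp
        | add x y hx hy =>
          simp only [TensorProduct.map_tmul] at hx hy ⊢
          simp only [map_add, LinearMap.add_apply, TensorProduct.add_tmul, hx, hy]
        | tmul a z =>
          induction z with
          | zero => simp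
          | add x y hx hy =>
            simp only [TensorProduct.map_tmul, boxRep_tmul] at hx hy ⊢
            simp only [map_add, LinearMap.add_apply, TensorProduct.add_tmul,
              TensorProduct.tmul_add, hx, hy]
          | tmul b c => simp

theorem map_assoc_boxRep (Δ : A →ₐ[k] A ⊗[k] A) (z : A ⊗[k] (A ⊗[k] A))
    (t : V₁ ⊗[k] ((V₂ ⊗[k] V₃) ⊗[k] V₄)) :
    TensorProduct.map LinearMap.id (TensorProduct.assoc k V₂ V₃ V₄).toLinearMap
      (boxRep ρ₁ (boxRep ((boxRep ρ₂ ρ₃).comp Δ) ρ₄) z t) =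
      boxRep ρ₁ (boxRep ρ₂ (boxRep ρ₃ ρ₄)) (idTensor A (comulLeft A Δ) z)
        (TensorProduct.map LinearMap.id (TensorProduct.assoc k V₂ V₃ V₄).toLinearMap t) := by
  induction z with
  | zero => simp
  | add x y hx hy => simp only [map_add, LinearMap.add_apply, hx, hy]
  | tmul a z =>
    induction t with
    | zero => simp
    | add x y hx hy => simp only [map_add, hx, hy]
    | tmul v t =>
      simp only [boxRep_tmul, TensorProduct.map_tmul, Algebra.TensorProduct.map_tmul,
        LinearMap.id_apply, AlgHom.id_apply]
      congr 1
      exact assoc_boxRep_comul Δ ρ₂ ρ₃ ρ₄ z t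

theorem pentagon_modules (Q : QuasiBialgebra k A) (t : ((V₁ ⊗[k] V₂) ⊗[k] V₃) ⊗[k] V₄) :
    TensorProduct.map LinearMap.id
      ((boxRep ρ₂ (boxRep ρ₃ ρ₄) Q.Φ).comp (TensorProduct.assoc k V₂ V₃ V₄).toLinearMap)
      (boxRep ρ₁ (boxRep ((boxRep ρ₂ ρ₃).comp Q.Δ) ρ₄) Q.Φ
        (TensorProduct.assoc k V₁ (V₂ ⊗[k] V₃) V₄
          (TensorProduct.map ((boxRep ρ₁ (boxRep ρ₂ ρ₃) Q.Φ).comp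
            (TensorProduct.assoc k V₁ V₂ V₃).toLinearMap) LinearMap.id t))) =
    boxRep ρ₁ (boxRep ρ₂ ((boxRep ρ₃ ρ₄).comp Q.Δ)) Q.Φ
      (TensorProduct.assoc k V₁ V₂ (V₃ ⊗[k] V₄)
        (boxRep ((boxRep ρ₁ ρ₂).comp Q.Δ) (boxRep ρ₃ ρ₄) Q.Φ
          (TensorProduct.assoc k (V₁ ⊗[k] V₂) V₃ V₄ t))) := by
  have h1 : ∀ s, TensorProduct.map LinearMap.id
      ((boxRep ρ₂ (boxRep ρ₃ ρ₄) Q.Φ).comp (TensorProduct.assoc k V₂ V₃ V₄).toLinearMap) s =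
      boxRep ρ₁ (boxRep ρ₂ (boxRep ρ₃ ρ₄)) (oneLeft A (A ⊗[k] (A ⊗[k] A)) Q.Φ)
        (TensorProduct.map LinearMap.id (TensorProduct.assoc k V₂ V₃ V₄).toLinearMap s) := by
    intro s
    rw [← map_id_boxRep, ← LinearMap.comp_apply, ← TensorProduct.map_comp, LinearMap.id_comp]
  have h2 : TensorProduct.map ((boxRep ρ₁ (boxRep ρ₂ ρ₃) Q.Φ).comp
      (TensorProduct.assoc k V₁ V₂ V₃).toLinearMap) LinearMap.id t =
      TensorProduct.map (boxRep ρ₁ (boxRep ρ₂ ρ₃) Q.Φ) (LinearMap.id : V₄ →ₗ[k] V₄)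
        (TensorProduct.map (TensorProduct.assoc k V₁ V₂ V₃).toLinearMap LinearMap.id t) := by
    rw [← LinearMap.comp_apply, ← TensorProduct.map_comp, LinearMap.id_comp]
  have h3 : boxRep ρ₁ (boxRep ρ₂ ((boxRep ρ₃ ρ₄).comp Q.Δ)) =
      (boxRep ρ₁ (boxRep ρ₂ (boxRep ρ₃ ρ₄))).comp (idTensor A (idTensor A Q.Δ)) := by
    apply AlgHom.ext
    intro z
    rw [AlgHom.comp_apply, ← boxRep_idTensor]
    congr 2
    apply AlgHom.ext
    intro z
    rw [boxRep_idTensor]; rfl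
  have h4 : TensorProduct.map LinearMap.id (TensorProduct.assoc k V₂ V₃ V₄).toLinearMap
          (TensorProduct.assoc k V₁ (V₂ ⊗[k] V₃) V₄
        (TensorProduct.map (TensorProduct.assoc k V₁ V₂ V₃).toLinearMap LinearMap.id t)) =
      TensorProduct.assoc k V₁ V₂ (V₃ ⊗[k] V₄) (TensorProduct.assoc k (V₁ ⊗[k] V₂) V₃ V₄ t) := by
    refine LinearMap.congr_fun (f := (TensorProduct.map LinearMap.id
      (TensorProduct.assoc k V₂ V₃ V₄).toLinearMap).comp
        ((TensorProduct.assoc k V₁ (V₂ ⊗[k] V₃) V₄).toLinearMap.comp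
        (TensorProduct.map (TensorProduct.assoc k V₁ V₂ V₃).toLinearMap LinearMap.id)))
      (g := (TensorProduct.assoc k V₁ V₂ (V₃ ⊗[k] V₄)).toLinearMap.comp
        (TensorProduct.assoc k (V₁ ⊗[k] V₂) V₃ V₄).toLinearMap) ?_ t
    ext v₁ v₂ v₃ v₄
    simp
  rw [h1, h2, map_assoc_boxRep, assoc_map_boxRep_id ρ₁ ρ₂ ρ₃ ρ₄, h3, assoc_boxRep_comul, h4]
  simp only [AlgHom.comp_apply, ← Module.End.mul_apply, ← map_mul]
  rw [← mul_assoc, Q.cocycle]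

theorem triangle_modules (Q : QuasiBialgebra k A) (t : (V₁ ⊗[k] k) ⊗[k] V₂) :
    TensorProduct.map LinearMap.id (TensorProduct.lid k V₂).toLinearMap
      (boxRep ρ₁ (boxRep (unitRep Q.ε) ρ₂) Q.Φ (TensorProduct.assoc k V₁ k V₂ t)) =
      TensorProduct.map (TensorProduct.rid k V₁).toLinearMap LinearMap.id t := by
  have h1 : ∀ z s, TensorProduct.map LinearMap.id (TensorProduct.lid k V₂).toLinearMap
      (boxRep ρ₁ (boxRep (unitRep Q.ε) ρ₂) z s) =
      boxRep ρ₁ ρ₂ (idTensor A (counitLeft Q.ε) z)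
        (TensorProduct.map LinearMap.id (TensorProduct.lid k V₂).toLinearMap s) := by
    intro z s
    induction z with
    | zero => simp
    | add x y hx hy => simp only [map_add, LinearMap.add_apply, hx, hy]
    | tmul a z =>
      induction s with
      | zero => simp
      | add x y hx hy => simp only [map_add, hx, hy]
      | tmul v t =>
        simp only [boxRep_tmul, TensorProduct.map_tmul, Algebra.TensorProduct.map_tmul,
          LinearMap.id_apply, AlgHom.id_apply]
        congr 1
        exact lid_boxRep Q.ε ρ₂ z t
  rw [h1, Q.counit_middle, map_one, Module.End.one_apply]
  induction t with
  | zero => simp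
  | add x y hx hy => simp only [map_add, hx, hy]
  | tmul t v₃ =>
    induction t with
    | zero => simp
    | add x y hx hy => simp only [map_add, TensorProduct.add_tmul, hx, hy]
    | tmul v₁ v₂ => simp [TensorProduct.smul_tmul]

theorem lid_natural (f : V₁ →ₗ[k] V₂) (t : k ⊗[k] V₁) :
    TensorProduct.lid k V₂ (TensorProduct.map LinearMap.id f t) =
      f (TensorProduct.lid k V₁ t) := by
  induction t with
  | zero => simp
  | add x y hx hy => simp only [map_add, hx, hy]
  | tmul r v => simp

theorem rid_natural (f : V₁ →ₗ[k] V₂) (t : V₁ ⊗[k] k) :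
    TensorProduct.rid k V₂ (TensorProduct.map f LinearMap.id t) =
      f (TensorProduct.rid k V₁ t) := by
  induction t with
  | zero => simp
  | add x y hx hy => simp only [map_add, hx, hy]
  | tmul r v => simp

end Coherence

noncomputable instance : MonoidalCategory (Rep Q) where
  tensorHom_def f g := by
    apply Hom.ext
    change TensorProduct.map _ _ = (TensorProduct.map _ _).comp (TensorProduct.map _ _)
    rw [← TensorProduct.map_comp]
    rfl
  id_tensorHom_id X Y := by
    apply Hom.ext
    exact TensorProduct.map_id
  tensorHom_comp_tensorHom f₁ f₂ g₁ g₂ := by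
    apply Hom.ext
    exact (TensorProduct.map_comp _ _ _ _).symm
  whiskerLeft_id X Y := by
    apply Hom.ext
    exact TensorProduct.map_id
  id_whiskerRight X Y := by
    apply Hom.ext
    exact TensorProduct.map_id
  associator_naturality {X₁ X₂ X₃ Y₁ Y₂ Y₃} f₁ f₂ f₃ := by
    ext t
    change (X₁.V ⊗[k] X₂.V) ⊗[k] X₃.V at t
    change act₃ Y₁ Y₂ Y₃ Q.Φ (TensorProduct.assoc k Y₁.V Y₂.V Y₃.V
      (TensorProduct.map (TensorProduct.map f₁.f f₂.f) f₃.f t)) =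
      TensorProduct.map f₁.f (TensorProduct.map f₂.f f₃.f) (act₃ X₁ X₂ X₃ Q.Φ
        (TensorProduct.assoc k X₁.V X₂.V X₃.V t))
    rw [map_assoc_natural]
    exact (boxRep_natural _ _ _ _ _ _ f₁.comm
      (boxRep_natural _ _ _ _ _ _ f₂.comm f₃.comm) _ _).symm
  leftUnitor_naturality f := hom_ext fun t => lid_natural f.f t
  rightUnitor_naturality f := hom_ext fun t => rid_natural f.f t
  pentagon W X Y Z := hom_ext fun t => pentagon_modules W.ρ X.ρ Y.ρ Z.ρ Q t
  triangle X Y := hom_ext fun t => triangle_modules X.ρ Y.ρ Q t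

end Rep

end Representations
/-! ### Group actions on tensor categories and equivariantization -/

section Equivariantization

open Functor.LaxMonoidal Functor.OplaxMonoidal Functor.Monoidal

universe u₁ v₁

/-- An action of the group `G` on the `k`-linear tensor category `D`: tensor functors `F_σ` with
natural tensor isomorphisms `γ_(σ,τ) : F_σ ∘ F_τ → F_(στ)` and `ι : id → F_1`, satisfying the
coherence conditions of a monoidal functor from `G` to the tensor auto-equivalences of `D`. -/
structure TensorAction (k : Type u) [Field k] (G : Type w) [Group G] (D : Type u₁)
    [Category.{v₁} D] [Preadditive D] [CategoryTheory.Linear k D] [MonoidalCategory D] where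
  F : G → D ⥤ D
  [additive : ∀ σ, (F σ).Additive]
  [linear : ∀ σ, (F σ).Linear k]
  [monoidal : ∀ σ, (F σ).Monoidal]
  γ : ∀ σ τ, F τ ⋙ F σ ≅ F (σ * τ)
  ι : 𝟭 D ≅ F 1
  [γ_monoidal : ∀ σ τ, NatTrans.IsMonoidal (γ σ τ).hom]
  [ι_monoidal : NatTrans.IsMonoidal ι.hom]
  assoc : ∀ σ τ ρ X,
    (γ σ τ).hom.app ((F ρ).obj X) ≫ (γ (σ * τ) ρ).hom.app X ≫
      eqToHom (by rw [mul_assoc]) =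
    (F σ).map ((γ τ ρ).hom.app X) ≫ (γ σ (τ * ρ)).hom.app X
  unit_left : ∀ σ X,
    ι.hom.app ((F σ).obj X) ≫ (γ 1 σ).hom.app X = eqToHom (by rw [one_mul]; rfl)
  unit_right : ∀ σ X,
    (F σ).map (ι.hom.app X) ≫ (γ σ 1).hom.app X = eqToHom (by rw [mul_one]; rfl)

attribute [instance] TensorAction.additive TensorAction.linear TensorAction.monoidal
  TensorAction.γ_monoidal TensorAction.ι_monoidal

variable {k : Type u} [Field k] {G : Type w} [Group G] {D : Type u₁}
  [Category.{v₁} D] [Preadditive D] [CategoryTheory.Linear k D] [MonoidalCategory D]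

/-- An equivariant object `(X, u)`. -/
structure Equivariant (T : TensorAction k G D) where
  X : D
  u : ∀ σ, (T.F σ).obj X ≅ X
  comp : ∀ σ τ, (T.γ σ τ).hom.app X ≫ (u (σ * τ)).hom = (T.F σ).map (u τ).hom ≫ (u σ).hom

namespace Equivariant

variable {T : TensorAction k G D}

/-- A morphism of equivariant objects. -/
@[ext] structure Hom (M N : Equivariant T) where
  f : M.X ⟶ N.X
  comm : ∀ σ, (M.u σ).hom ≫ f = (T.F σ).map f ≫ (N.u σ).hom

instance : Category (Equivariant T) where
  Hom := Hom
  id M := ⟨𝟙 M.X, fun σ => by simp⟩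
  comp g h := ⟨g.f ≫ h.f, fun σ => by
    rw [← Category.assoc, g.comm, Category.assoc, h.comm, Functor.map_comp, Category.assoc]⟩
  id_comp g := Hom.ext (Category.id_comp g.f)
  comp_id g := Hom.ext (Category.comp_id g.f)
  assoc g h i := Hom.ext (Category.assoc g.f h.f i.f)

@[ext] theorem hom_ext {M N : Equivariant T} {g h : M ⟶ N} (w : g.f = h.f) : g = h := Hom.ext w

@[simp] theorem id_f (M : Equivariant T) : Hom.f (𝟙 M) = 𝟙 M.X := rfl

@[simp] theorem comp_f {M N P : Equivariant T} (g : M ⟶ N) (h : N ⟶ P) :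
    Hom.f (g ≫ h) = g.f ≫ h.f := rfl

/-- The forgetful functor. -/
def forget (T : TensorAction k G D) : Equivariant T ⥤ D where
  obj M := M.X
  map g := g.f

instance : (forget T).Faithful where
  map_injective w := Hom.ext w

/-- An isomorphism of equivariant objects from an isomorphism of the underlying objects. -/
def mkIso {M N : Equivariant T} (e : M.X ≅ N.X)
    (h : ∀ σ, (M.u σ).hom ≫ e.hom = (T.F σ).map e.hom ≫ (N.u σ).hom) : M ≅ N where
  hom := ⟨e.hom, h⟩
  inv := ⟨e.inv, fun σ => by
    rw [← cancel_mono e.hom, Category.assoc, Category.assoc, h, e.inv_hom_id, Category.comp_id,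
      ← Functor.map_comp_assoc, e.inv_hom_id, CategoryTheory.Functor.map_id, Category.id_comp]⟩
  hom_inv_id := Hom.ext e.hom_inv_id
  inv_hom_id := Hom.ext e.inv_hom_id

section Linear

variable {M N : Equivariant T}

/-- Equivariant morphisms form a subspace. -/
def homSubmodule (M N : Equivariant T) : Submodule k (M.X ⟶ N.X) where
  carrier := {f | ∀ σ, (M.u σ).hom ≫ f = (T.F σ).map f ≫ (N.u σ).hom}
  add_mem' := fun hf hg σ => by
    rw [Preadditive.comp_add, hf σ, hg σ, Functor.map_add, Preadditive.add_comp]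
  zero_mem' := fun σ => by simp
  smul_mem' := fun r f hf σ => by
    rw [Linear.comp_smul, hf σ, Functor.map_smul, Linear.smul_comp]

/-- Equivariant morphisms as elements of a subspace. -/
def homEquiv (M N : Equivariant T) : (M ⟶ N) ≃ homSubmodule M N where
  toFun g := ⟨g.f, g.comm⟩
  invFun g := ⟨g.1, g.2⟩
  left_inv _ := rfl
  right_inv _ := rfl

instance : AddCommGroup (M ⟶ N) := (homEquiv M N).addCommGroup

instance : Module k (M ⟶ N) := (homEquiv M N).module k

@[simp] theorem add_f (g h : M ⟶ N) : Hom.f (g + h) = g.f + h.f := rfl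

@[simp] theorem smul_f (r : k) (g : M ⟶ N) : Hom.f (r • g) = r • g.f := rfl

end Linear

instance : Preadditive (Equivariant T) where
  add_comp X Y Z g g' h := by ext; simp
  comp_add X Y Z g h h' := by ext; simp

instance : CategoryTheory.Linear k (Equivariant T) where
  smul_comp X Y Z r g h := by ext; simp
  comp_smul X Y Z g r h := by ext; simp

theorem γ_comp_δ (T : TensorAction k G D) (σ τ : G) (X Y : D) :
    (T.γ σ τ).hom.app (X ⊗ Y) ≫ δ (T.F (σ * τ)) X Y =
      (T.F σ).map (δ (T.F τ) X Y) ≫ δ (T.F σ) _ _ ≫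
        ((T.γ σ τ).hom.app X ⊗ₘ (T.γ σ τ).hom.app Y) := by
  have h := NatTrans.IsMonoidal.tensor (τ := (T.γ σ τ).hom) X Y
  have h' : (T.γ σ τ).hom.app (X ⊗ Y) ≫ δ (T.F (σ * τ)) X Y =
      δ (T.F τ ⋙ T.F σ) X Y ≫ ((T.γ σ τ).hom.app X ⊗ₘ (T.γ σ τ).hom.app Y) := by
    rw [← cancel_epi (μ (T.F τ ⋙ T.F σ) X Y), ← Category.assoc, h, Category.assoc, μ_δ,
      Category.comp_id, μ_δ_assoc]
  rw [h', comp_δ, Category.assoc]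

theorem γ_comp_η (T : TensorAction k G D) (σ τ : G) :
    (T.γ σ τ).hom.app (𝟙_ D) ≫ η (T.F (σ * τ)) = (T.F σ).map (η (T.F τ)) ≫ η (T.F σ) := by
  have h := NatTrans.IsMonoidal.unit (τ := (T.γ σ τ).hom)
  rw [← comp_η, ← cancel_epi (ε (T.F τ ⋙ T.F σ)), ← Category.assoc, h, ε_η, ε_η]

/-- `(V, u) ⊗ (W, u') = (V ⊗ W, (u_σ ⊗ u'_σ) ζ_σ⁻¹)`. -/
def tensorObj (M N : Equivariant T) : Equivariant T where
  X := M.X ⊗ N.X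
  u σ := (μIso (T.F σ) M.X N.X).symm ≪≫ (M.u σ ⊗ᵢ N.u σ)
  comp σ τ := by
    simp only [Iso.trans_hom, Iso.symm_hom, μIso_inv, tensorIso_hom, Functor.map_comp,
      Category.assoc]
    rw [← Category.assoc, γ_comp_δ]
    simp only [Category.assoc, tensorHom_comp_tensorHom, M.comp, N.comp]
    rw [← δ_natural_assoc, tensorHom_comp_tensorHom]

@[simp] theorem tensorObj_u (M N : Equivariant T) (σ : G) :
    ((tensorObj M N).u σ).hom = δ (T.F σ) M.X N.X ≫ ((M.u σ).hom ⊗ₘ (N.u σ).hom) := rfl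

/-- The unit object, with the structure isomorphisms `F_σ(1) ≅ 1` of the tensor functors. -/
def unit (T : TensorAction k G D) : Equivariant T where
  X := 𝟙_ D
  u σ := (εIso (T.F σ)).symm
  comp σ τ := γ_comp_η T σ τ

@[simp] theorem unit_u (σ : G) : ((unit T).u σ).hom = η (T.F σ) := rfl

theorem tensorHom_comm (F : D ⥤ D) [F.Monoidal] {X X' Y Y' : D} (a : F.obj X ⟶ X)
    (a' : F.obj X' ⟶ X') (b : F.obj Y ⟶ Y) (b' : F.obj Y' ⟶ Y') (g : X ⟶ X') (h : Y ⟶ Y')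
    (hg : a ≫ g = F.map g ≫ a') (hh : b ≫ h = F.map h ≫ b') :
    (δ F X Y ≫ (a ⊗ₘ b)) ≫ (g ⊗ₘ h) = F.map (g ⊗ₘ h) ≫ δ F X' Y' ≫ (a' ⊗ₘ b') := by
  rw [Category.assoc, tensorHom_comp_tensorHom, hg, hh, ← δ_natural_assoc,
    tensorHom_comp_tensorHom]

theorem associator_comm (F : D ⥤ D) [F.Monoidal] {X Y Z : D} (a : F.obj X ⟶ X)
    (b : F.obj Y ⟶ Y) (c : F.obj Z ⟶ Z) :
    (δ F (X ⊗ Y) Z ≫ ((δ F X Y ≫ (a ⊗ₘ b)) ⊗ₘ c)) ≫ (α_ X Y Z).hom =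
      F.map (α_ X Y Z).hom ≫ δ F X (Y ⊗ Z) ≫ (a ⊗ₘ (δ F Y Z ≫ (b ⊗ₘ c))) := by
  have e1 : (δ F X Y ≫ (a ⊗ₘ b)) ⊗ₘ c = δ F X Y ▷ F.obj Z ≫ ((a ⊗ₘ b) ⊗ₘ c) := by
    rw [← tensorHom_id, tensorHom_comp_tensorHom, Category.id_comp]
  have e2 : a ⊗ₘ (δ F Y Z ≫ (b ⊗ₘ c)) = F.obj X ◁ δ F Y Z ≫ (a ⊗ₘ (b ⊗ₘ c)) := by
    rw [← id_tensorHom, tensorHom_comp_tensorHom, Category.id_comp]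
  rw [e1, e2]
  simp only [Category.assoc, associator_naturality]
  rw [reassoc_of% (oplax_associativity F X Y Z)]

theorem leftUnitor_comm (F : D ⥤ D) [F.Monoidal] {X : D} (a : F.obj X ⟶ X) :
    (δ F (𝟙_ D) X ≫ (η F ⊗ₘ a)) ≫ (λ_ X).hom = F.map (λ_ X).hom ≫ a := by
  rw [MonoidalCategory.tensorHom_def, Category.assoc, Category.assoc, leftUnitor_naturality,
    Functor.OplaxMonoidal.left_unitality_hom_assoc]

theorem rightUnitor_comm (F : D ⥤ D) [F.Monoidal] {X : D} (a : F.obj X ⟶ X) :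
    (δ F X (𝟙_ D) ≫ (a ⊗ₘ η F)) ≫ (ρ_ X).hom = F.map (ρ_ X).hom ≫ a := by
  rw [MonoidalCategory.tensorHom_def', Category.assoc, Category.assoc, rightUnitor_naturality,
    Functor.OplaxMonoidal.right_unitality_hom_assoc]

/-- The tensor product of morphisms. -/
def tensorHom {M N M' N' : Equivariant T} (g : M ⟶ M') (h : N ⟶ N') :
    tensorObj M N ⟶ tensorObj M' N' :=
  ⟨g.f ⊗ₘ h.f, fun σ => tensorHom_comm (T.F σ) _ _ _ _ g.f h.f (g.comm σ) (h.comm σ)⟩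

instance : MonoidalCategoryStruct (Equivariant T) where
  tensorObj := tensorObj
  whiskerLeft X _ _ h := ⟨X.X ◁ h.f, fun σ => by
    rw [← id_tensorHom]; exact (tensorHom (𝟙 X) h).comm σ⟩
  whiskerRight h Y := ⟨h.f ▷ Y.X, fun σ => by
    rw [← tensorHom_id]; exact (tensorHom h (𝟙 Y)).comm σ⟩
  tensorHom := tensorHom
  tensorUnit := unit T
  associator M N P := mkIso (M := tensorObj (tensorObj M N) P) (N := tensorObj M (tensorObj N P))
    (α_ M.X N.X P.X) fun σ => associator_comm (T.F σ) _ _ _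
  leftUnitor M := mkIso (M := tensorObj (unit T) M) (λ_ M.X) fun σ => leftUnitor_comm (T.F σ) _
  rightUnitor M := mkIso (M := tensorObj M (unit T)) (ρ_ M.X) fun σ => rightUnitor_comm (T.F σ) _

instance : MonoidalCategory (Equivariant T) where
  tensorHom_def f g := Hom.ext (MonoidalCategory.tensorHom_def f.f g.f)
  id_tensorHom_id X Y := Hom.ext (id_tensorHom_id X.X Y.X)
  tensorHom_comp_tensorHom f₁ f₂ g₁ g₂ := Hom.ext (tensorHom_comp_tensorHom f₁.f f₂.f g₁.f g₂.f)
  whiskerLeft_id X Y := Hom.ext (whiskerLeft_id X.X Y.X)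
  id_whiskerRight X Y := Hom.ext (id_whiskerRight X.X Y.X)
  associator_naturality f₁ f₂ f₃ := Hom.ext (associator_naturality f₁.f f₂.f f₃.f)
  leftUnitor_naturality f := Hom.ext (leftUnitor_naturality f.f)
  rightUnitor_naturality f := Hom.ext (rightUnitor_naturality f.f)
  pentagon W X Y Z := Hom.ext (pentagon W.X X.X Y.X Z.X)
  triangle X Y := Hom.ext (triangle X.X Y.X)

end Equivariant

end Equivariantization
/-! ### The action on representations given by a crossed system -/

section CrossedAction

set_option maxSynthPendingDepth 10

variable {k : Type u} [Field k] {A : Type v} [Ring A] [Algebra k A] {Q : QuasiBialgebra k A}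

namespace CrossedSystem

section Functors

variable {G : Type w} [Group G] (C : CrossedSystem G Q)

/-- The functor `F_σ`: the same vector space, with action `a · v = σ_*(a) v`. -/
def restrict (σ : G) : Rep Q ⥤ Rep Q where
  obj X := { V := X.V, ρ := X.ρ.comp (C.act σ : A →ₐ[k] A) }
  map f := ⟨f.f, fun a v => f.comm _ v⟩

@[simp] theorem restrict_map_f (σ : G) {X Y : Rep Q} (f : X ⟶ Y) :
    ((C.restrict σ).map f).f = f.f := rfl

theorem restrict_obj_ρ (σ : G) (X : Rep Q) (a : A) :
    ((C.restrict σ).obj X).ρ a = X.ρ (C.act σ a) := rfl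

instance (σ : G) : (C.restrict σ).Additive where
  map_add := rfl

instance (σ : G) : (C.restrict σ).Linear k where
  map_smul _ _ := rfl

theorem boxRep_comp {B B' V W : Type*} {A' : Type v} [Ring A'] [Algebra k A'] [Ring B]
    [Algebra k B] [Ring B'] [Algebra k B'] [AddCommGroup V] [Module k V] [AddCommGroup W]
    [Module k W] (ρ : A →ₐ[k] Module.End k V) (τ : B →ₐ[k] Module.End k W) (f : A' →ₐ[k] A)
    (g : B' →ₐ[k] B) (z : A' ⊗[k] B') :
    boxRep (ρ.comp f) (τ.comp g) z = boxRep ρ τ (Algebra.TensorProduct.map f g z) := by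
  induction z with
  | zero => simp
  | add x y hx hy => simp only [map_add, hx, hy]
  | tmul a b => simp

theorem tensorator_comm (σ : G) (X Y : Rep Q) (a : A) (t : X.V ⊗[k] Y.V) :
    boxRep X.ρ Y.ρ (C.J σ) (boxRep (X.ρ.comp (C.act σ : A →ₐ[k] A))
      (Y.ρ.comp (C.act σ : A →ₐ[k] A)) (Q.Δ a) t) =
    boxRep X.ρ Y.ρ (Q.Δ (C.act σ a)) (boxRep X.ρ Y.ρ (C.J σ) t) := by
  rw [boxRep_comp, ← Module.End.mul_apply, ← Module.End.mul_apply, ← map_mul, ← map_mul]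
  have := (C.twisted σ).comul a
  erw [this]

theorem twisted_assoc_modules {V₁ V₂ V₃ : Type*} [AddCommGroup V₁] [Module k V₁]
    [AddCommGroup V₂] [Module k V₂] [AddCommGroup V₃] [Module k V₃]
    (ρ₁ : A →ₐ[k] Module.End k V₁) (ρ₂ : A →ₐ[k] Module.End k V₂) (ρ₃ : A →ₐ[k] Module.End k V₃)
    (f : A →ₐ[k] A) (J : (A ⊗[k] A)ˣ) (h : IsTwistedHom Q Q f J)
    (t : (V₁ ⊗[k] V₂) ⊗[k] V₃) :
    boxRep ρ₁ (boxRep ρ₂ ρ₃) Q.Φ (TensorProduct.assoc k V₁ V₂ V₃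
      (boxRep ((boxRep ρ₁ ρ₂).comp Q.Δ) ρ₃ J
        (TensorProduct.map (boxRep ρ₁ ρ₂ J) LinearMap.id t))) =
    boxRep ρ₁ ((boxRep ρ₂ ρ₃).comp Q.Δ) J (TensorProduct.map LinearMap.id (boxRep ρ₂ ρ₃ J)
      (boxRep (ρ₁.comp f) (boxRep (ρ₂.comp f) (ρ₃.comp f)) Q.Φ
        (TensorProduct.assoc k V₁ V₂ V₃ t))) := by
  have h0 : (LinearMap.id : V₃ →ₗ[k] V₃) = ρ₃ 1 := by rw [map_one]; rfl
  have h1 : boxRep (ρ₁.comp f) (boxRep (ρ₂.comp f) (ρ₃.comp f)) (Q.Φ : A ⊗[k] (A ⊗[k] A)) =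
      boxRep ρ₁ (boxRep ρ₂ ρ₃) (tensor₃ f Q.Φ) := by
    have : boxRep (ρ₂.comp f) (ρ₃.comp f) =
        (boxRep ρ₂ ρ₃).comp (Algebra.TensorProduct.map f f) :=
      AlgHom.ext fun z => boxRep_comp ρ₂ ρ₃ f f z
    rw [this, boxRep_comp]
  rw [h0, Rep.assoc_boxRep_comul, Rep.assoc_boxRep, assoc_eq_oneRightGen, Rep.boxRep_idTensor,
    Rep.map_id_boxRep ρ₁, h1]
  simp only [← Module.End.mul_apply, ← map_mul]
  congr 2
  rw [← mul_assoc, ← mul_assoc]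
  exact h.associator

theorem lid_twisted {V : Type*} [AddCommGroup V] [Module k V] (ε : A →ₐ[k] k)
    (ρ : A →ₐ[k] Module.End k V) (J : A ⊗[k] A) (h : counitLeft ε J = 1) (t : k ⊗[k] V) :
    TensorProduct.lid k V (boxRep (Rep.unitRep ε) ρ J
      (TensorProduct.map LinearMap.id LinearMap.id t)) = TensorProduct.lid k V t := by
  rw [Rep.lid_boxRep, h, map_one, Module.End.one_apply, TensorProduct.map_id]
  rfl

theorem rid_twisted {V : Type*} [AddCommGroup V] [Module k V] (ε : A →ₐ[k] k)
    (ρ : A →ₐ[k] Module.End k V) (J : A ⊗[k] A) (h : counitRight ε J = 1) (t : V ⊗[k] k) :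
    TensorProduct.rid k V (boxRep ρ (Rep.unitRep ε) J
      (TensorProduct.map LinearMap.id LinearMap.id t)) = TensorProduct.rid k V t := by
  rw [Rep.rid_boxRep, h, map_one, Module.End.one_apply, TensorProduct.map_id]
  rfl

/-- `F_σ` preserves the trivial representation. -/
noncomputable def restrictUnit (σ : G) : 𝟙_ (Rep Q) ≅ (C.restrict σ).obj (𝟙_ (Rep Q)) :=
  Rep.mkIso (X := 𝟙_ (Rep Q)) (Y := (C.restrict σ).obj (𝟙_ (Rep Q)))
    (LinearEquiv.refl k k) fun a (r : k) => by
      have h := (C.twisted σ).counit a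
      change Q.ε a * r = Q.ε (C.act σ a) * r
      rw [← h]
      rfl

/-- `ζ(v ⊗ w) = J_σ (v ⊗ w)`. -/
noncomputable def tensorator (σ : G) (X Y : Rep Q) :
    (C.restrict σ).obj X ⊗ (C.restrict σ).obj Y ≅ (C.restrict σ).obj (X ⊗ Y) :=
  Rep.mkIso (X := (C.restrict σ).obj X ⊗ (C.restrict σ).obj Y)
    (Y := (C.restrict σ).obj (X ⊗ Y)) (Rep.unitEquiv (boxRep X.ρ Y.ρ) (C.J σ))
    fun a t => C.tensorator_comm σ X Y a t

theorem tensorator_hom_f (σ : G) (X Y : Rep Q) (t : X.V ⊗[k] Y.V) :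
    (C.tensorator σ X Y).hom.f t = boxRep X.ρ Y.ρ (C.J σ) t := rfl

theorem tensorator_assoc (σ : G) (X Y Z : Rep Q) :
    (C.tensorator σ X Y).hom ▷ (C.restrict σ).obj Z ≫ (C.tensorator σ (X ⊗ Y) Z).hom ≫
        (C.restrict σ).map (α_ X Y Z).hom =
      (α_ ((C.restrict σ).obj X) ((C.restrict σ).obj Y) ((C.restrict σ).obj Z)).hom ≫
        (C.restrict σ).obj X ◁ (C.tensorator σ Y Z).hom ≫ (C.tensorator σ X (Y ⊗ Z)).hom := by
  refine Rep.hom_ext fun t => ?_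
  have h := twisted_assoc_modules X.ρ Y.ρ Z.ρ (C.act σ : A →ₐ[k] A) (C.J σ) (C.twisted σ) t
  simp only [Rep.comp_f, LinearMap.comp_apply, Rep.whiskerRight_f, Rep.whiskerLeft_f,
    restrict_map_f]
  refine Eq.trans ?_ (h.trans ?_)
  · rfl
  · rfl

/-- The tensor structure `ζ(v ⊗ w) = J_σ (v ⊗ w)` of `F_σ`. -/
noncomputable def restrictCore (σ : G) : (C.restrict σ).CoreMonoidal where
  εIso := C.restrictUnit σ
  μIso X Y := C.tensorator σ X Y
  μIso_hom_natural_left {X Y} f X' := Rep.hom_ext fun t =>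
    (Rep.boxRep_natural X.ρ X'.ρ Y.ρ X'.ρ f.f LinearMap.id f.comm (fun _ _ => rfl)
      (C.J σ) t).symm
  μIso_hom_natural_right {X Y} X' f := Rep.hom_ext fun t =>
    (Rep.boxRep_natural X'.ρ X.ρ X'.ρ Y.ρ LinearMap.id f.f (fun _ _ => rfl) f.comm
      (C.J σ) t).symm
  associativity X Y Z := C.tensorator_assoc σ X Y Z
  left_unitality X := Rep.hom_ext fun t =>
    (lid_twisted Q.ε X.ρ (C.J σ) (C.twisted σ).counit_left t).symm
  right_unitality X := Rep.hom_ext fun t =>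
    (rid_twisted Q.ε X.ρ (C.J σ) (C.twisted σ).counit_right t).symm

noncomputable instance (σ : G) : (C.restrict σ).Monoidal := (C.restrictCore σ).toMonoidal

end Functors

section Action

variable {G : Type w} [CommGroup G] (C : CrossedSystem G Q)

theorem restrict_eqToHom {σ τ : G} (h : σ = τ) (X : Rep Q)
    (e : (C.restrict σ).obj X = (C.restrict τ).obj X) :
    (eqToHom e).f = (LinearMap.id : X.V →ₗ[k] X.V) := by
  subst h; rfl

theorem inv_θ_act (hθ : ∀ σ τ, C.θ σ τ = C.θ τ σ) (σ τ : G) (a : A) :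
    (↑(C.θ σ τ)⁻¹ : A) * C.act τ (C.act σ a) = C.act (σ * τ) a * (↑(C.θ σ τ)⁻¹ : A) := by
  rw [Units.inv_mul_eq_iff_eq_mul, ← mul_assoc, Units.eq_mul_inv_iff_mul_eq, hθ σ τ, mul_comm σ τ]
  exact (C.θ_act τ σ a).symm

theorem inv_θ_comul (hθ : ∀ σ τ, C.θ σ τ = C.θ τ σ) (σ τ : G) :
    Q.Δ (↑(C.θ σ τ)⁻¹ : A) * (C.J τ * tensor₂ (C.act τ : A →ₐ[k] A) (C.J σ)) =
      C.J (σ * τ) * ((↑(C.θ σ τ)⁻¹ : A) ⊗ₜ[k] (↑(C.θ σ τ)⁻¹ : A)) := by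
  have h := C.comul_θ τ σ
  rw [hθ τ σ, mul_comm τ σ] at h
  have h1 : Q.Δ (↑(C.θ σ τ)⁻¹ : A) * Q.Δ (C.θ σ τ : A) = 1 := by
    rw [← map_mul, Units.inv_mul, map_one]
  have h2 : ((C.θ σ τ : A) ⊗ₜ[k] (C.θ σ τ : A)) *
      ((↑(C.θ σ τ)⁻¹ : A) ⊗ₜ[k] (↑(C.θ σ τ)⁻¹ : A)) = 1 := by
    rw [Algebra.TensorProduct.tmul_mul_tmul, Units.mul_inv, Algebra.TensorProduct.one_def]
  calc _ = Q.Δ (↑(C.θ σ τ)⁻¹ : A) * (C.J τ * tensor₂ (C.act τ : A →ₐ[k] A) (C.J σ) *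
        (((C.θ σ τ : A) ⊗ₜ[k] (C.θ σ τ : A)) *
          ((↑(C.θ σ τ)⁻¹ : A) ⊗ₜ[k] (↑(C.θ σ τ)⁻¹ : A)))) := by rw [h2, mul_one]
    _ = Q.Δ (↑(C.θ σ τ)⁻¹ : A) * (Q.Δ (C.θ σ τ : A) * C.J (σ * τ)) *
          ((↑(C.θ σ τ)⁻¹ : A) ⊗ₜ[k] (↑(C.θ σ τ)⁻¹ : A)) := by
        rw [h]; simp only [mul_assoc]
    _ = _ := by rw [← mul_assoc (Q.Δ _), h1, one_mul]

theorem inv_θ_assoc (hθ : ∀ σ τ, C.θ σ τ = C.θ τ σ) (σ τ ρ : G) :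
    (↑(C.θ (σ * τ) ρ)⁻¹ : A) * C.act ρ (↑(C.θ σ τ)⁻¹ : A) =
      (↑(C.θ σ (τ * ρ))⁻¹ : A) * (↑(C.θ τ ρ)⁻¹ : A) := by
  have h := C.θ_assoc ρ τ σ
  rw [hθ ρ τ, mul_comm ρ τ, hθ (τ * ρ) σ, hθ τ σ, mul_comm τ σ, hθ ρ (σ * τ)] at h
  have h1 : C.act ρ (↑(C.θ σ τ)⁻¹ : A) * C.act ρ (C.θ σ τ : A) = 1 := by
    rw [← map_mul, Units.inv_mul, map_one]
  rw [Units.inv_mul_eq_iff_eq_mul, ← mul_assoc, Units.eq_mul_inv_iff_mul_eq,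
    Units.eq_mul_inv_iff_mul_eq, mul_assoc, h, ← mul_assoc, h1, one_mul]

theorem counit_inv_θ (σ τ : G) : Q.ε (↑(C.θ σ τ)⁻¹ : A) = 1 := by
  have h : Q.ε (↑(C.θ σ τ)⁻¹ : A) * Q.ε (C.θ σ τ : A) = 1 := by
    rw [← map_mul, Units.inv_mul, map_one]
  rwa [C.counit_θ, mul_one] at h

/-- `γ_(σ,τ)(v) = θ_(σ,τ)⁻¹ v`. -/
noncomputable def compIso (hθ : ∀ σ τ, C.θ σ τ = C.θ τ σ) (σ τ : G) :
    C.restrict τ ⋙ C.restrict σ ≅ C.restrict (σ * τ) :=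
  NatIso.ofComponents (fun X => Rep.mkIso
    (X := (C.restrict τ ⋙ C.restrict σ).obj X) (Y := (C.restrict (σ * τ)).obj X)
    (Rep.unitEquiv X.ρ (C.θ σ τ)⁻¹) fun a (v : X.V) => by
      change X.ρ _ (X.ρ (C.act τ (C.act σ a)) v) = X.ρ (C.act (σ * τ) a) (X.ρ _ v)
      rw [← Module.End.mul_apply, ← Module.End.mul_apply, ← map_mul, ← map_mul,
        C.inv_θ_act hθ]) fun f => Rep.hom_ext fun v => (f.comm _ v).symm

theorem compIso_app_f (hθ : ∀ σ τ, C.θ σ τ = C.θ τ σ) (σ τ : G) (X : Rep Q) :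
    ((C.compIso hθ σ τ).hom.app X).f = X.ρ (↑(C.θ σ τ)⁻¹ : A) := rfl

/-- The identity functor is `F_1`. -/
noncomputable def idIso : 𝟭 (Rep Q) ≅ C.restrict 1 :=
  NatIso.ofComponents (fun X => Rep.mkIso (X := X) (Y := (C.restrict 1).obj X)
    (LinearEquiv.refl k X.V) fun a (v : X.V) => by
      change X.ρ a v = X.ρ (C.act 1 a) v
      rw [C.act_one]; rfl) fun f => Rep.hom_ext fun v => rfl

theorem idIso_app_f (X : Rep Q) : (C.idIso.hom.app X).f = (LinearMap.id : X.V →ₗ[k] X.V) := rfl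

theorem comp_tensorator_modules {V W : Type*} [AddCommGroup V] [Module k V] [AddCommGroup W]
    [Module k W] (hθ : ∀ σ τ, C.θ σ τ = C.θ τ σ) (σ τ : G) (ρ : A →ₐ[k] Module.End k V)
    (ρ' : A →ₐ[k] Module.End k W) (t : V ⊗[k] W) :
    boxRep ρ ρ' (Q.Δ (↑(C.θ σ τ)⁻¹ : A)) (boxRep ρ ρ' (C.J τ)
      (boxRep (ρ.comp (C.act τ : A →ₐ[k] A)) (ρ'.comp (C.act τ : A →ₐ[k] A)) (C.J σ) t)) =
    boxRep ρ ρ' (C.J (σ * τ)) (TensorProduct.map (ρ (↑(C.θ σ τ)⁻¹ : A))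
      (ρ' (↑(C.θ σ τ)⁻¹ : A)) t) := by
  rw [boxRep_comp, ← boxRep_tmul]
  simp only [← Module.End.mul_apply, ← map_mul]
  rw [C.inv_θ_comul hθ]

open Functor.LaxMonoidal

theorem comp_tensorator (hθ : ∀ σ τ, C.θ σ τ = C.θ τ σ) (σ τ : G) (X Y : Rep Q) :
    (C.tensorator σ ((C.restrict τ).obj X) ((C.restrict τ).obj Y)).hom ≫
      (C.restrict σ).map (C.tensorator τ X Y).hom ≫ (C.compIso hθ σ τ).hom.app (X ⊗ Y) =
    ((C.compIso hθ σ τ).hom.app X ⊗ₘ (C.compIso hθ σ τ).hom.app Y) ≫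
      (C.tensorator (σ * τ) X Y).hom := by
  refine Rep.hom_ext fun t => ?_
  have h := C.comp_tensorator_modules hθ σ τ X.ρ Y.ρ t
  rw [Rep.comp_f, Rep.comp_f, Rep.comp_f, restrict_map_f, Rep.tensorHom_f, compIso_app_f,
    compIso_app_f, compIso_app_f]
  refine Eq.trans ?_ (h.trans ?_)
  · rfl
  · rfl

instance (hθ : ∀ σ τ, C.θ σ τ = C.θ τ σ) (σ τ : G) :
    NatTrans.IsMonoidal (C.compIso hθ σ τ).hom where
  unit := Rep.hom_ext fun (r : k) => by
    change Q.ε (↑(C.θ σ τ)⁻¹ : A) * r = r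
    rw [C.counit_inv_θ, one_mul]
  tensor X Y := by
    have h := C.comp_tensorator hθ σ τ X Y
    rw [← Category.assoc] at h
    exact h

instance : NatTrans.IsMonoidal C.idIso.hom where
  unit := Rep.hom_ext fun (r : k) => rfl
  tensor X Y := Rep.hom_ext fun (t : X.V ⊗[k] Y.V) => by
    change t = boxRep X.ρ Y.ρ (C.J 1) (TensorProduct.map LinearMap.id LinearMap.id t)
    rw [C.J_one, Units.val_one, map_one, TensorProduct.map_id]
    rfl

theorem compIso_assoc (hθ : ∀ σ τ, C.θ σ τ = C.θ τ σ) (σ τ ρ : G) (X : Rep Q)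
    (e : (C.restrict (σ * τ * ρ)).obj X = (C.restrict (σ * (τ * ρ))).obj X) :
    (C.compIso hθ σ τ).hom.app ((C.restrict ρ).obj X) ≫ (C.compIso hθ (σ * τ) ρ).hom.app X ≫
        eqToHom e =
      (C.restrict σ).map ((C.compIso hθ τ ρ).hom.app X) ≫ (C.compIso hθ σ (τ * ρ)).hom.app X := by
  refine Rep.hom_ext fun (v : X.V) => ?_
  have h : X.ρ (↑(C.θ (σ * τ) ρ)⁻¹ : A) (X.ρ (C.act ρ (↑(C.θ σ τ)⁻¹ : A)) v) =
      X.ρ (↑(C.θ σ (τ * ρ))⁻¹ : A) (X.ρ (↑(C.θ τ ρ)⁻¹ : A) v) := by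
    rw [← Module.End.mul_apply, ← Module.End.mul_apply, ← map_mul, ← map_mul,
      C.inv_θ_assoc hθ]
  have h' := C.restrict_eqToHom (mul_assoc σ τ ρ) X e
  generalize eqToHom e = g at h'
  exact (LinearMap.congr_fun h' _).trans h

theorem unit_compIso (hθ : ∀ σ τ, C.θ σ τ = C.θ τ σ) (σ : G) (X : Rep Q)
    (e : (C.restrict σ).obj X = (C.restrict (1 * σ)).obj X) :
    C.idIso.hom.app ((C.restrict σ).obj X) ≫ (C.compIso hθ 1 σ).hom.app X = eqToHom e := by
  refine Rep.hom_ext fun (v : X.V) => ?_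
  have h : X.ρ (↑(C.θ 1 σ)⁻¹ : A) v = v := by
    rw [C.θ_one_left, inv_one, Units.val_one, map_one]
    rfl
  have h' := C.restrict_eqToHom (one_mul σ).symm X e
  generalize eqToHom e = g at h'
  exact h.trans (LinearMap.congr_fun h' v).symm

theorem compIso_unit (hθ : ∀ σ τ, C.θ σ τ = C.θ τ σ) (σ : G) (X : Rep Q)
    (e : (C.restrict σ).obj X = (C.restrict (σ * 1)).obj X) :
    (C.restrict σ).map (C.idIso.hom.app X) ≫ (C.compIso hθ σ 1).hom.app X = eqToHom e := by
  refine Rep.hom_ext fun (v : X.V) => ?_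
  have h : X.ρ (↑(C.θ σ 1)⁻¹ : A) v = v := by
    rw [C.θ_one_right, inv_one, Units.val_one, map_one]
    rfl
  have h' := C.restrict_eqToHom (mul_one σ).symm X e
  generalize eqToHom e = g at h'
  exact h.trans (LinearMap.congr_fun h' v).symm

/-- For `G` abelian and `θ` symmetric, the functors `F_σ` together with
`γ_(σ,τ)(v) = θ_(σ,τ)⁻¹ v` form an action of `G` on the tensor category of representations. -/
noncomputable def action (hθ : ∀ σ τ, C.θ σ τ = C.θ τ σ) : TensorAction k G (Rep Q) where
  F := C.restrict
  γ := C.compIso hθ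
  ι := C.idIso
  assoc σ τ ρ X := C.compIso_assoc hθ σ τ ρ X _
  unit_left σ X := C.unit_compIso hθ σ X _
  unit_right σ X := C.compIso_unit hθ σ X _

end Action

end CrossedSystem

end CrossedAction
/-! ### The twist `J_s` -/

section CyclicTwist

set_option maxSynthPendingDepth 10

variable {k : Type u} [Field k] {H : Type v} [Ring H]

/-- `1_i = (1/N) ∑_l q^(-li) χ^l`, for `q` a primitive `N`-th root of unity and `χ^N = 1`. -/
noncomputable def idem [Algebra k H] (N : ℕ) (q : k) (χ : Hˣ) (i : ℕ) : H :=
  (N : k)⁻¹ • ∑ l ∈ Finset.range N, (q⁻¹) ^ (l * i) • (χ : H) ^ l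

theorem geom_sum_root {N : ℕ} {q : k} (hq : IsPrimitiveRoot q N) {i j : ℕ} (hi : i < N)
    (hj : j < N) : ∑ l ∈ Finset.range N, (q⁻¹) ^ (l * i) * q ^ (l * j) =
      if i = j then (N : k) else 0 := by
  have hq0 : q ≠ 0 := hq.ne_zero (by omega)
  have h1 : ∀ l, (q⁻¹) ^ (l * i) * q ^ (l * j) = ((q⁻¹) ^ i * q ^ j) ^ l := fun l => by
    rw [mul_pow, ← pow_mul, ← pow_mul, mul_comm i, mul_comm j]
  simp only [h1]
  split_ifs with h
  · subst h
    rw [← mul_pow, inv_mul_cancel₀ hq0]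
    simp
  · have hw : (q⁻¹) ^ i * q ^ j ≠ 1 := fun h' => h <| by
      rw [inv_pow, inv_mul_eq_iff_eq_mul₀ (pow_ne_zero _ hq0), mul_one] at h'
      exact (hq.pow_inj hj hi h').symm
    have hN : ((q⁻¹) ^ i * q ^ j) ^ N = 1 := by
      rw [mul_pow, ← pow_mul, ← pow_mul, mul_comm i, mul_comm j, pow_mul, pow_mul, inv_pow,
        hq.pow_eq_one]
      simp
    have := mul_geom_sum ((q⁻¹) ^ i * q ^ j) N
    rw [hN, sub_self] at this
    exact (mul_eq_zero.1 this).resolve_left (sub_ne_zero.2 hw)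

theorem pow_mul_idem [Algebra k H] {N : ℕ} {q : k} (hN : N ≠ 0) (hq : IsPrimitiveRoot q N)
    {χ : Hˣ} (hχ : χ ^ N = 1) (j l : ℕ) :
    (χ : H) ^ l * idem N q χ j = q ^ (l * j) • idem N q χ j := by
  have hq0 : q ≠ 0 := hq.ne_zero hN
  have hχ' : (χ : H) ^ N = 1 := by rw [← Units.val_pow_eq_pow_val, hχ, Units.val_one]
  have key : (χ : H) * idem N q χ j = q ^ j • idem N q χ j := by
    have h1 : ∀ l, (χ : H) * ((q⁻¹) ^ (l * j) • (χ : H) ^ l) =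
        q ^ j • ((q⁻¹) ^ ((l + 1) * j) • (χ : H) ^ (l + 1)) := fun l => by
      rw [mul_smul_comm, ← pow_succ', smul_smul]
      congr 1
      rw [add_mul, one_mul, pow_add (q⁻¹), mul_comm (q ^ j), mul_assoc, ← mul_pow,
        inv_mul_cancel₀ hq0, one_pow, mul_one]
    have h2 : ∑ l ∈ Finset.range N, (q⁻¹) ^ ((l + 1) * j) • (χ : H) ^ (l + 1) =
        ∑ l ∈ Finset.range N, (q⁻¹) ^ (l * j) • (χ : H) ^ l := by
      have h3 := Finset.sum_range_succ (fun l => (q⁻¹) ^ (l * j) • (χ : H) ^ l) N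
      have hN1 : (q⁻¹) ^ (N * j) = 1 := by rw [pow_mul, inv_pow, hq.pow_eq_one, inv_one, one_pow]
      rw [Finset.sum_range_succ', hχ', hN1, zero_mul, pow_zero, pow_zero] at h3
      exact add_right_cancel h3
    unfold idem
    rw [mul_smul_comm, Finset.mul_sum]
    simp only [h1]
    rw [← Finset.smul_sum, h2, smul_comm]
  induction l with
  | zero => simp
  | succ l ih =>
    rw [pow_succ, mul_assoc, key, mul_smul_comm, ih, smul_smul, ← pow_add]
    congr 2
    ring

theorem idem_mul_idem [Algebra k H] [CharZero k] {N : ℕ} {q : k} (hN : N ≠ 0)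
    (hq : IsPrimitiveRoot q N) {χ : Hˣ} (hχ : χ ^ N = 1) {i j : ℕ} (hi : i < N) (hj : j < N) :
    idem N q χ i * idem N q χ j = if i = j then idem N q χ j else 0 := by
  have hN' : (N : k) ≠ 0 := Nat.cast_ne_zero.2 hN
  conv_lhs => rw [idem]
  rw [smul_mul_assoc, Finset.sum_mul]
  simp only [smul_mul_assoc, pow_mul_idem hN hq hχ, smul_smul]
  rw [← Finset.sum_smul, geom_sum_root hq hi hj, smul_smul]
  split_ifs
  · rw [inv_mul_cancel₀ hN', one_smul]
  · rw [mul_zero, zero_smul]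

theorem sum_idem [Algebra k H] [CharZero k] {N : ℕ} {q : k} (hN : N ≠ 0)
    (hq : IsPrimitiveRoot q N) (χ : Hˣ) : ∑ i ∈ Finset.range N, idem N q χ i = 1 := by
  have hN' : (N : k) ≠ 0 := Nat.cast_ne_zero.2 hN
  unfold idem
  rw [← Finset.smul_sum, Finset.sum_comm]
  simp only [← Finset.sum_smul]
  have h : ∀ l ∈ Finset.range N, (∑ i ∈ Finset.range N, (q⁻¹) ^ (l * i)) • (χ : H) ^ l =
      if l = 0 then (N : k) • 1 else 0 := fun l hl => by
    have := geom_sum_root hq (Finset.mem_range.1 hl) (Nat.pos_of_ne_zero hN)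
    simp only [mul_zero, pow_zero, mul_one, mul_comm _ l] at this
    rw [this]
    split_ifs with h0
    · rw [h0, pow_zero]
    · rw [zero_smul]
  rw [Finset.sum_congr rfl h, Finset.sum_ite_eq' (Finset.range N) 0,
    if_pos (Finset.mem_range.2 (Nat.pos_of_ne_zero hN)), smul_smul, inv_mul_cancel₀ hN', one_smul]

theorem counit_idem [Algebra k H] [CharZero k] {N : ℕ} {q : k} (hN : N ≠ 0)
    (hq : IsPrimitiveRoot q N) {χ : Hˣ} (ε : H →ₐ[k] k) (hε : ε χ = 1) {i : ℕ} (hi : i < N) :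
    ε (idem N q χ i) = if i = 0 then 1 else 0 := by
  have hN' : (N : k) ≠ 0 := Nat.cast_ne_zero.2 hN
  have h := geom_sum_root hq hi (Nat.pos_of_ne_zero hN)
  simp only [mul_zero, pow_zero, mul_one] at h
  simp only [idem, map_smul, map_sum, map_pow, hε, one_pow, smul_eq_mul, mul_one]
  rw [h]
  split_ifs
  · exact inv_mul_cancel₀ hN'
  · exact mul_zero _

/-- `∑_(i,j) c(i,j) 1_i ⊗ 1_j`. -/
noncomputable def idemSum [Algebra k H] (N : ℕ) (q : k) (χ : Hˣ) (c : ℕ → ℕ → k) : H ⊗[k] H :=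
  ∑ i ∈ Finset.range N, ∑ j ∈ Finset.range N, c i j • (idem N q χ i ⊗ₜ[k] idem N q χ j)

theorem idemSum_mul [Algebra k H] [CharZero k] {N : ℕ} {q : k} (hN : N ≠ 0)
    (hq : IsPrimitiveRoot q N) {χ : Hˣ} (hχ : χ ^ N = 1) (c d : ℕ → ℕ → k) :
    idemSum N q χ c * idemSum N q χ d = idemSum N q χ fun i j => c i j * d i j := by
  have h1 : ∀ i ∈ Finset.range N, ∀ j ∈ Finset.range N,
      c i j • (idem N q χ i ⊗ₜ[k] idem N q χ j) * idemSum N q χ d =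
        (c i j * d i j) • (idem N q χ i ⊗ₜ[k] idem N q χ j) := by
    intro i hi j hj
    unfold idemSum
    rw [Finset.mul_sum, Finset.sum_eq_single_of_mem i hi, Finset.mul_sum,
      Finset.sum_eq_single_of_mem j hj]
    · rw [smul_mul_smul_comm, Algebra.TensorProduct.tmul_mul_tmul,
        idem_mul_idem hN hq hχ (Finset.mem_range.1 hi) (Finset.mem_range.1 hi),
        idem_mul_idem hN hq hχ (Finset.mem_range.1 hj) (Finset.mem_range.1 hj), if_pos rfl,
        if_pos rfl]
    · intro b hb hbj
      rw [smul_mul_smul_comm, Algebra.TensorProduct.tmul_mul_tmul,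
        idem_mul_idem hN hq hχ (Finset.mem_range.1 hj) (Finset.mem_range.1 hb),
        if_neg hbj.symm, TensorProduct.tmul_zero, smul_zero]
    · intro b hb hbi
      rw [Finset.mul_sum]
      refine Finset.sum_eq_zero fun e he => ?_
      rw [smul_mul_smul_comm, Algebra.TensorProduct.tmul_mul_tmul,
        idem_mul_idem hN hq hχ (Finset.mem_range.1 hi) (Finset.mem_range.1 hb),
        if_neg hbi.symm, TensorProduct.zero_tmul, smul_zero]
  conv_lhs => enter [1]; unfold idemSum
  rw [Finset.sum_mul]
  refine Finset.sum_congr rfl fun i hi => ?_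
  rw [Finset.sum_mul]
  exact Finset.sum_congr rfl fun j hj => h1 i hi j hj

theorem idemSum_one [Algebra k H] [CharZero k] {N : ℕ} {q : k} (hN : N ≠ 0)
    (hq : IsPrimitiveRoot q N) (χ : Hˣ) : idemSum N q χ (fun _ _ => 1) = 1 := by
  unfold idemSum
  simp only [one_smul, ← TensorProduct.tmul_sum, ← TensorProduct.sum_tmul, sum_idem hN hq]
  rfl

/-- `c(i,j) = q^(j(i - i'))`, with `i'` the remainder of `i` modulo `m`. -/
def twistCoeff (m : ℕ) (q : k) (i j : ℕ) : k := q ^ (j * (i - i % m))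

/-- The twist `J_s = ∑_(i,j) c(i,j)^s 1_i ⊗ 1_j`, with inverse `∑_(i,j) c(i,j)^(-s) 1_i ⊗ 1_j`. -/
noncomputable def cyclicTwist {k : Type u} [Field k] {H : Type v} [Ring H] [CharZero k]
    [HopfAlgebra k H] {m : ℕ} (hm : m ≠ 0) {q : k}
    (hq : IsPrimitiveRoot q (m ^ 2)) {χ : Hˣ} (hχ : IsGroupLikeElem k (χ : H))
    (hm' : χ ^ m ^ 2 = 1) (s : ℕ) : Twist (QuasiHopf.ofHopf k H).toQuasiBialgebra where
  J :=
    { val := idemSum (m ^ 2) q χ fun i j => twistCoeff m q i j ^ s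
      inv := idemSum (m ^ 2) q χ fun i j => (twistCoeff m q i j ^ s)⁻¹
      val_inv := by
        rw [idemSum_mul (pow_ne_zero 2 hm) hq hm', ← idemSum_one (pow_ne_zero 2 hm) hq χ]
        congr 1
        funext i j
        exact mul_inv_cancel₀ (pow_ne_zero _ (pow_ne_zero _ (hq.ne_zero (pow_ne_zero 2 hm))))
      inv_val := by
        rw [idemSum_mul (pow_ne_zero 2 hm) hq hm', ← idemSum_one (pow_ne_zero 2 hm) hq χ]
        congr 1
        funext i j
        exact inv_mul_cancel₀ (pow_ne_zero _ (pow_ne_zero _ (hq.ne_zero (pow_ne_zero 2 hm)))) }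
  counit_left := by
    have hN : m ^ 2 ≠ 0 := pow_ne_zero 2 hm
    have hε : (QuasiHopf.ofHopf k H).ε χ = 1 := hχ.counit_eq_one
    change counitLeft _ (idemSum (m ^ 2) q χ _) = 1
    unfold idemSum
    simp only [map_sum, map_smul, counitLeft_tmul]
    rw [Finset.sum_eq_single_of_mem 0 (Finset.mem_range.2 (Nat.pos_of_ne_zero hN))]
    · simp only [counit_idem hN hq _ hε (Nat.pos_of_ne_zero hN), if_true, one_smul, twistCoeff,
        Nat.zero_mod, Nat.sub_self, mul_zero, pow_zero, one_pow, sum_idem hN hq]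
    · intro i hi hi0
      refine Finset.sum_eq_zero fun j _ => ?_
      rw [counit_idem hN hq _ hε (Finset.mem_range.1 hi), if_neg hi0, zero_smul, smul_zero]
  counit_right := by
    have hN : m ^ 2 ≠ 0 := pow_ne_zero 2 hm
    have hε : (QuasiHopf.ofHopf k H).ε χ = 1 := hχ.counit_eq_one
    change counitRight _ (idemSum (m ^ 2) q χ _) = 1
    unfold idemSum
    simp only [map_sum, map_smul, counitRight_tmul]
    rw [Finset.sum_comm,
      Finset.sum_eq_single_of_mem 0 (Finset.mem_range.2 (Nat.pos_of_ne_zero hN))]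
    · simp only [counit_idem hN hq _ hε (Nat.pos_of_ne_zero hN), if_true, one_smul, twistCoeff,
        zero_mul, pow_zero, one_pow, sum_idem hN hq]
    · intro i hi hi0
      refine Finset.sum_eq_zero fun j _ => ?_
      rw [counit_idem hN hq _ hε (Finset.mem_range.1 hi), if_neg hi0, zero_smul, smul_zero]

end CyclicTwist
/-! ### The Hopf algebras `H = B(V) # k C_{m²}` and the quasi-Hopf algebras `A(H,s)` -/

section Basic

variable {k : Type u} [Field k] {H : Type v} [Ring H] [HopfAlgebra k H]

/-- `{r | (id ⊗ π) Δ(r) = r ⊗ 1}`, for `π` the projection of the graded algebra `H` onto its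
degree zero part: the algebra `R` of coinvariants. -/
noncomputable def coinvariants (𝒢 : ℕ → Submodule k H) [GradedAlgebra 𝒢] : Submodule k H :=
  LinearMap.eqLocus (TensorProduct.map LinearMap.id (GradedAlgebra.proj 𝒢 0) ∘ₗ Coalgebra.comul)
    ((TensorProduct.mk k H H).flip 1)

/-- The primitive elements of the braided Hopf algebra `R` of coinvariants: those `r` in `R` such
that `Δ(r) = r ⊗ 1 + (π ⊗ id) Δ(r)`. -/
noncomputable def braidedPrimitives (𝒢 : ℕ → Submodule k H) [GradedAlgebra 𝒢] : Submodule k H :=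
  coinvariants 𝒢 ⊓ LinearMap.eqLocus Coalgebra.comul ((TensorProduct.mk k H H).flip 1 +
    TensorProduct.map (GradedAlgebra.proj 𝒢 0) LinearMap.id ∘ₗ Coalgebra.comul)

/-- `H = ⨁ H(n)` is a graded Hopf algebra of the form `B(V) # k C_{m²}`, where the cyclic group
`C_{m²}` is generated by the grouplike element `χ` and `B(V)` is the Nichols algebra of the
Yetter-Drinfeld module `V` spanned by the skew primitive elements `x_i`. -/
structure IsCyclicBosonization (m : ℕ) {r : ℕ} (q : k) (χ : Hˣ) (x : Fin r → H)
    (b d : Fin r → ℤ) (𝒢 : ℕ → Submodule k H) [GradedAlgebra 𝒢] : Prop where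
  primitiveRoot : IsPrimitiveRoot q (m ^ 2)
  grouplike : IsGroupLikeElem k (χ : H)
  order : orderOf χ = m ^ 2
  conj : ∀ i, (χ : H) * x i * (χ⁻¹ : Hˣ) = q ^ d i • x i
  comul : ∀ i, Coalgebra.comul (R := k) (x i) = x i ⊗ₜ[k] 1 + ((χ ^ (-b i) : Hˣ) : H) ⊗ₜ[k] x i
  /-- `H` is generated by `χ` and the `x_i` -/
  generated : Algebra.adjoin k (insert (χ : H) (Set.range x)) = ⊤
  /-- the comultiplication respects the grading -/
  comul_graded : ∀ n, ∀ h ∈ 𝒢 n, Coalgebra.comul (R := k) h ∈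
    ⨆ p ∈ Finset.HasAntidiagonal.antidiagonal n,
      LinearMap.range (TensorProduct.map (𝒢 p.1).subtype (𝒢 p.2).subtype)
  /-- `H(0)` is the group algebra of the cyclic group generated by `χ` -/
  degree_zero : 𝒢 0 = Submodule.span k (Set.range fun n : ℕ => (χ : H) ^ n)
  degree_one : ∀ i, x i ∈ 𝒢 1
  /-- `R` is generated by the `x_i` -/
  coinvariants_eq :
    coinvariants 𝒢 = Subalgebra.toSubmodule (Algebra.adjoin k (Set.range x))
  /-- the primitive elements of `R` are the elements of `V` -/
  primitives_eq : braidedPrimitives 𝒢 = Submodule.span k (Set.range x)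

/-- `Υ(H) = {1 ≤ s ≤ m - 1 : b_i ≡ s d_i mod m for all i}`. -/
def upsilonSet (m : ℕ) {r : ℕ} (b d : Fin r → ℤ) : Set ℕ :=
  {s | 1 ≤ s ∧ s ≤ m - 1 ∧ ∀ i, b i ≡ s * d i [ZMOD m]}

/-- The subalgebra `A(H,s)` of `H`, generated by `σ = χ^m` and the `x_i`. -/
def basicSubalgebra (m : ℕ) {r : ℕ} (χ : Hˣ) (x : Fin r → H) : Subalgebra k H :=
  Algebra.adjoin k (insert ((χ ^ m : Hˣ) : H) (Set.range x))

/-- The quasi-Hopf algebra `H_{J_s}`. -/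
noncomputable def IsCyclicBosonization.twisted [CharZero k] {m : ℕ} [NeZero m] {r : ℕ} {q : k}
    {χ : Hˣ} {x : Fin r → H} {b d : Fin r → ℤ} {𝒢 : ℕ → Submodule k H} [GradedAlgebra 𝒢]
    (h : IsCyclicBosonization m q χ x b d 𝒢) (s : ℕ) : QuasiHopf k H :=
  (QuasiHopf.ofHopf k H).twist
    (cyclicTwist (NeZero.ne m) h.primitiveRoot h.grouplike (h.order ▸ pow_orderOf_eq_one χ) s)

end Basic

end QuasiHopfAlg

open QuasiHopfAlg

/-! Diagonal elements. The group algebra of `χ` is the algebra of functions on `ZMod (m ^ 2)`: the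
idempotents `1_i` are the points, `Δ` is pullback along addition, `S` is pullback along negation,
and an eigenvector of conjugation by `χ` with eigenvalue `q ^ d` moves past a function by shifting
its argument by `d`. A function lies in the span of the powers of `σ = χ ^ m` exactly when it is
`m`-periodic, because the idempotents of `σ` are the sums of the `1_i` over residue classes modulo
`m`. Whether a structure constant of `H_{J_s}` belongs to `A` or its tensor powers thus becomes a
question about periodicity in each variable (`scal_mem`, `scal₂_mem_range`, `scal₃_mem_range`).

The subalgebra. `J_s` is the function `q ^ (s j m ⌊i/m⌋)` of two variables. The associator is the
function `q ^ (s l m (⌊i/m⌋ + ⌊j/m⌋ - ⌊(i+j)/m⌋))`, which is periodic in all variables. The twisted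
coproduct of `x_i` is `(x_i ⊗ 1) c + (1 ⊗ x_i) c'` with functions `c` and `c'`; all their
periodicities are automatic except that of `c'` in the first variable, which is the congruence `b_i
≡ s d_i` modulo `m` (`twistFun_char_periodic_left`). The element `β` of `H_{J_s}` is not periodic,
so the antipode is first changed by the unit `β` to one with `β = 1`; its `α`, and its values on the
generators, then lie in `A`. Since `A → H` stays injective on tensor powers, all axioms for `A` are
inherited from `H_{J_s}`.

The crossed product. `J_s` commutes with `χ ^ n ⊗ χ ^ n`, so the powers of `χ` remain grouplike in
`H_{J_s}`; they normalize `A` and fix the associator. The elements `e_i = χ ^ i`, `0 ≤ i < m`, are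
multiplicative up to the cocycle `e_i e_j e_(i+j)⁻¹`, a power of `σ` given by the carry, and every
axiom of a crossed system with `J = 1` follows formally. The map `a # h^i ↦ a χ ^ i` is onto because
`χ` and the `x_i` generate `H`. It is injective because `(id ⊗ f) Δ`, for the character `f` with `χ
↦ q ^ m` and `x_i ↦ 0`, fixes `A` and has `A χ ^ i` in its eigenspace for `q ^ (m i)`; these
eigenvalues are distinct. The antipode of `A # C_m` is transported along this isomorphism.

The equivalence. An equivariant object `(X, u)` is the same as a representation of `A # C_m`, with
`a # σ` acting by `a u_σ⁻¹`, and the tensor products coincide on the nose. The inverse of `A # C_m ≅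
H_{J_s}`, together with `J_s`, is a twisted homomorphism from `H` to `A # C_m`; restriction along it
is a tensor functor, and an equivalence because the underlying algebra map is bijective. -/

namespace QuasiHopfAlg

/-! ### Structures pulled back along injective algebra maps -/

section Pullback

set_option maxSynthPendingDepth 10

variable {k : Type u} [Field k]

/-- An algebra map lifts through an injective one that contains its range. -/
theorem exists_algHom_lift {A B C : Type*} [Ring A] [Algebra k A] [Ring B] [Algebra k B]
    [Ring C] [Algebra k C] (ι : B →ₐ[k] C) (hι : Function.Injective ι) (g : A →ₐ[k] C)
    (hg : ∀ a, g a ∈ ι.range) : ∃ l : A →ₐ[k] B, ∀ a, ι (l a) = g a := by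
  refine ⟨(AlgEquiv.ofInjective ι hι).symm.toAlgHom.comp (g.codRestrict ι.range hg), fun a => ?_⟩
  exact congrArg Subtype.val ((AlgEquiv.ofInjective ι hι).apply_symm_apply ⟨g a, hg a⟩)

/-- A unit whose value and inverse lie in the image of an injective algebra map is the image of
a unit. -/
theorem exists_unit_lift {B C : Type*} [Ring B] [Algebra k B] [Ring C] [Algebra k C]
    (ι : B →ₐ[k] C) (hι : Function.Injective ι) (c : Cˣ) (h : (c : C) ∈ ι.range)
    (h' : ((c⁻¹ : Cˣ) : C) ∈ ι.range) : ∃ b : Bˣ, ι b = c := by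
  obtain ⟨x, hx⟩ := h
  obtain ⟨y, hy⟩ := h'
  have hx' : ι x = c := hx
  have hy' : ι y = (c⁻¹ : Cˣ) := hy
  exact ⟨⟨x, y, hι (by rw [map_mul, hx', hy', Units.mul_inv, map_one]),
    hι (by rw [map_mul, hx', hy', Units.inv_mul, map_one])⟩, hx'⟩

/-- Modules over a field are flat. This is what allows an identity in a tensor power of `A` to be
checked in the same tensor power of a larger algebra. -/
theorem map_injective {A B A' B' : Type*} [Ring A] [Algebra k A] [Ring B] [Algebra k B]
    [Ring A'] [Algebra k A'] [Ring B'] [Algebra k B'] (f : A →ₐ[k] A') (g : B →ₐ[k] B')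
    (hf : Function.Injective f) (hg : Function.Injective g) :
    Function.Injective (Algebra.TensorProduct.map f g) :=
  TensorProduct.map_injective_of_flat_flat f.toLinearMap g.toLinearMap hf hg

variable {A : Type v} [Ring A] [Algebra k A] {B : Type v} [Ring B] [Algebra k B]

theorem tensor₂_injective {f : A →ₐ[k] B} (hf : Function.Injective f) :
    Function.Injective (tensor₂ f) := map_injective f f hf hf

theorem tensor₃_injective {f : A →ₐ[k] B} (hf : Function.Injective f) :
    Function.Injective (tensor₃ f) := map_injective f _ hf (tensor₂_injective hf)

/-- Naturality of `Δ ⊗ id`. Together with the analogues for `id ⊗ F`, `ε ⊗ id` and `id ⊗ ε` below,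
it carries the axioms of a quasi-bialgebra across an algebra map that respects the structure. -/
theorem map_comulLeft {A' B' : Type v} [Ring A'] [Algebra k A'] [Ring B'] [Algebra k B']
    (f : A →ₐ[k] B) (g : A' →ₐ[k] B') (Δ : A →ₐ[k] A ⊗[k] A) (Δ' : B →ₐ[k] B ⊗[k] B)
    (h : ∀ a, Δ' (f a) = tensor₂ f (Δ a)) (z : A ⊗[k] A') :
    Algebra.TensorProduct.map f (Algebra.TensorProduct.map f g) (comulLeft A' Δ z) =
      comulLeft B' Δ' (Algebra.TensorProduct.map f g z) := by
  induction z with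
  | zero => simp
  | add x y hx hy => simp only [map_add, hx, hy]
  | tmul a b =>
    rw [Algebra.TensorProduct.map_tmul, comulLeft_tmul, comulLeft_tmul, h]
    generalize Δ a = p
    induction p with
    | zero => simp
    | add x y hx hy => simp only [map_add, TensorProduct.add_tmul, hx, hy]
    | tmul c d => simp

theorem map_idTensor {A' B' A'' B'' : Type v} [Ring A'] [Algebra k A'] [Ring B'] [Algebra k B']
    [Ring A''] [Algebra k A''] [Ring B''] [Algebra k B'']
    (f : A →ₐ[k] B) (g : A' →ₐ[k] B') (l : A'' →ₐ[k] B'') (F : A' →ₐ[k] A'') (F' : B' →ₐ[k] B'')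
    (h : ∀ a, F' (g a) = l (F a)) (z : A ⊗[k] A') :
    Algebra.TensorProduct.map f l (idTensor A F z) =
      idTensor B F' (Algebra.TensorProduct.map f g z) := by
  induction z with
  | zero => simp
  | add x y hx hy => simp only [map_add, hx, hy]
  | tmul a b => simp [h]

theorem map_counitLeft {A' : Type v} {B' : Type w} [Ring A'] [Algebra k A'] [Ring B']
    [Algebra k B'] (f : A →ₐ[k] B) (g : A' →ₐ[k] B') (ε : A →ₐ[k] k) (ε' : B →ₐ[k] k)
    (h : ∀ a, ε' (f a) = ε a) (z : A ⊗[k] A') :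
    counitLeft ε' (Algebra.TensorProduct.map f g z) = g (counitLeft ε z) := by
  induction z with
  | zero => simp
  | add x y hx hy => simp only [map_add, hx, hy]
  | tmul a b => simp [h]

theorem map_counitRight {A' : Type v} {B' : Type w} [Ring A'] [Algebra k A'] [Ring B']
    [Algebra k B'] (f : A →ₐ[k] B) (g : A' →ₐ[k] B') (ε : A →ₐ[k] k) (ε' : B →ₐ[k] k)
    (h : ∀ a, ε' (f a) = ε a) (z : A' ⊗[k] A) :
    counitRight ε' (Algebra.TensorProduct.map g f z) = g (counitRight ε z) := by
  induction z with
  | zero => simp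
  | add x y hx hy => simp only [map_add, hx, hy]
  | tmul a b => simp [h]

/-- The quasi-bialgebra structure on `A` induced by an injective algebra map into a
quasi-bialgebra. -/
noncomputable def QuasiBialgebra.pullback (f : A →ₐ[k] B) (hf : Function.Injective f)
    (R : QuasiBialgebra k B) (Δ : A →ₐ[k] A ⊗[k] A) (hΔ : ∀ a, R.Δ (f a) = tensor₂ f (Δ a))
    (Φ : (A ⊗[k] (A ⊗[k] A))ˣ) (hΦ : tensor₃ f (Φ : A ⊗[k] (A ⊗[k] A)) = R.Φ) :
    QuasiBialgebra k A where
  Δ := Δ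
  ε := R.ε.comp f
  Φ := Φ
  quasi_coassoc a := by
    apply tensor₃_injective hf
    rw [map_mul, map_mul, hΦ, map_comulLeft f f Δ R.Δ hΔ, map_idTensor f f _ Δ R.Δ hΔ, ← hΔ]
    exact R.quasi_coassoc (f a)
  counit_right a := by
    apply hf
    rw [← map_counitRight f f (R.ε.comp f) R.ε (fun _ => rfl), ← hΔ, R.counit_right]
  counit_left a := by
    apply hf
    rw [← map_counitLeft f f (R.ε.comp f) R.ε (fun _ => rfl), ← hΔ, R.counit_left]
  cocycle := by
    have h1 := map_comulLeft f f Δ R.Δ hΔ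
    have h2 := map_idTensor f f _ Δ R.Δ hΔ
    -- The pentagon is compared in the fourth tensor power of `B`, which contains that of `A`.
    apply map_injective f (tensor₃ f) hf (tensor₃_injective hf)
    rw [map_mul, map_mul, map_mul, map_idTensor f (tensor₂ f) _ _ _ (fun z => (h1 z).symm),
      map_idTensor f (tensor₂ f) _ _ _ (fun z => (h2 z).symm),
      map_comulLeft f (tensor₂ f) Δ R.Δ hΔ,
      map_idTensor f (tensor₂ f) _ _ (oneRight₂ k B)
        (fun z => (map_idTensor f f (tensor₂ f) _ _ (fun a => by simp) z).symm),
      Algebra.TensorProduct.includeRight_apply, Algebra.TensorProduct.map_tmul, map_one, hΦ]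
    exact R.cocycle
  counit_middle := by
    apply tensor₂_injective hf
    rw [map_idTensor f (tensor₂ f) f _ _
      (map_counitLeft f f (R.ε.comp f) R.ε (fun _ => rfl)), hΦ, R.counit_middle, map_one]

theorem QuasiBialgebra.isQuasiBialgebraHom_pullback (f : A →ₐ[k] B) (hf : Function.Injective f)
    (R : QuasiBialgebra k B) (Δ : A →ₐ[k] A ⊗[k] A) (hΔ : ∀ a, R.Δ (f a) = tensor₂ f (Δ a))
    (Φ : (A ⊗[k] (A ⊗[k] A))ˣ) (hΦ : tensor₃ f (Φ : A ⊗[k] (A ⊗[k] A)) = R.Φ) :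
    IsQuasiBialgebraHom (R.pullback f hf Δ hΔ Φ hΦ) R f :=
  ⟨hΔ, fun _ => rfl, hΦ⟩

/-! ### Compatibility of the forms in the antipode axioms with algebra maps -/

section Forms

variable (f : A →ₐ[k] B) (S : A →ₐ[k] Aᵐᵒᵖ) (S' : B →ₐ[k] Bᵐᵒᵖ)

theorem map_leftForm (hS : ∀ a, f (S a).unop = (S' (f a)).unop) (α : A) (z : A ⊗[k] A) :
    f (leftForm S α z) = leftForm S' (f α) (tensor₂ f z) := by
  induction z with
  | zero => simp
  | add x y hx hy => simp only [map_add, hx, hy]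
  | tmul a b => simp [hS]

theorem map_rightForm (hS : ∀ a, f (S a).unop = (S' (f a)).unop) (β : A) (z : A ⊗[k] A) :
    f (rightForm S β z) = rightForm S' (f β) (tensor₂ f z) := by
  induction z with
  | zero => simp
  | add x y hx hy => simp only [map_add, hx, hy]
  | tmul a b => simp [hS]

theorem map_middleForm (hS : ∀ a, f (S a).unop = (S' (f a)).unop)
    (α β : A) (z : A ⊗[k] (A ⊗[k] A)) :
    f (middleForm S α β z) = middleForm S' (f α) (f β) (tensor₃ f z) := by
  induction z with
  | zero => simp
  | add x y hx hy => simp only [map_add, hx, hy]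
  | tmul a z =>
    induction z with
    | zero => simp
    | add x y hx hy => simp only [map_add, TensorProduct.tmul_add, hx, hy]
    | tmul b c => simp [hS]

theorem map_outerForm (hS : ∀ a, f (S a).unop = (S' (f a)).unop) (α β : A) (z : A ⊗[k] (A ⊗[k] A)) :
    f (outerForm S α β z) = outerForm S' (f α) (f β) (tensor₃ f z) := by
  induction z with
  | zero => simp
  | add x y hx hy => simp only [map_add, hx, hy]
  | tmul a z =>
    induction z with
    | zero => simp
    | add x y hx hy => simp only [map_add, TensorProduct.tmul_add, hx, hy]
    | tmul b c => simp [hS]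

end Forms

/-- An antipode restricted along an injective morphism of quasi-bialgebras. -/
noncomputable def Antipode.pullback {Q : QuasiBialgebra k A} {R : QuasiBialgebra k B}
    {f : A →ₐ[k] B} (hf : Function.Injective f) (h : IsQuasiBialgebraHom Q R f) (E : Antipode R)
    (S : A →ₐ[k] Aᵐᵒᵖ) (hS : ∀ a, f (S a).unop = (E.S (f a)).unop) (α β : A) (hα : f α = E.α)
    (hβ : f β = E.β) : Antipode Q where
  S := S
  α := α
  β := β
  left a := by
    apply hf
    rw [map_leftForm f S E.S hS, ← h.comul, hα, E.left, h.counit, map_smul, hα]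
  right a := by
    apply hf
    rw [map_rightForm f S E.S hS, ← h.comul, hβ, E.right, h.counit, map_smul, hβ]
  middle := by
    apply hf
    rw [map_middleForm f S E.S hS, h.associator, hα, hβ, E.middle, map_one]
  outer := by
    apply hf
    have hinv : tensor₃ f ((Q.Φ⁻¹ : (A ⊗[k] (A ⊗[k] A))ˣ) : A ⊗[k] (A ⊗[k] A)) =
        ((R.Φ⁻¹ : (B ⊗[k] (B ⊗[k] B))ˣ) : B ⊗[k] (B ⊗[k] B)) := by
      have e : unitsMap (tensor₃ f) Q.Φ = R.Φ := Units.ext h.associator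
      rw [← e, ← map_inv, coe_unitsMap]
    rw [map_outerForm f S E.S hS, hinv, hα, hβ, E.outer, map_one]

/-- `x ↦ U S(x) U⁻¹`. -/
def conjAntipode (S : A →ₐ[k] Aᵐᵒᵖ) (U : Aˣ) : A →ₐ[k] Aᵐᵒᵖ :=
  -- `S` takes values in the opposite algebra, where left and right are exchanged: conjugation by
  -- `U` in `A` is conjugation by `U⁻¹` there.
  (conjHom (Units.opEquiv.symm (MulOpposite.op U⁻¹))).comp S

theorem conjAntipode_apply (S : A →ₐ[k] Aᵐᵒᵖ) (U : Aˣ) (a : A) :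
    (conjAntipode S U a).unop = U * (S a).unop * (U⁻¹ : Aˣ) :=
  (mul_assoc (U : A) (S a).unop (U⁻¹ : Aˣ)).symm

/-- The antipode `(U S(-) U⁻¹, U α, β U⁻¹)`. -/
noncomputable def Antipode.conj {Q : QuasiBialgebra k A} (E : Antipode Q) (U : Aˣ) :
    Antipode Q where
  S := conjAntipode E.S U
  α := U * E.α
  β := E.β * (U⁻¹ : Aˣ)
  left a := by
    have : ∀ z, leftForm (conjAntipode E.S U) (U * E.α) z = U * leftForm E.S E.α z := by
      intro z
      induction z with
      | zero => simp
      | add x y hx hy => simp only [map_add, mul_add, hx, hy]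
      | tmul a b => simp [conjAntipode_apply, mul_assoc]
    rw [this, E.left, mul_smul_comm]
  right a := by
    have : ∀ z, rightForm (conjAntipode E.S U) (E.β * (U⁻¹ : Aˣ)) z =
        rightForm E.S E.β z * (U⁻¹ : Aˣ) := by
      intro z
      induction z with
      | zero => simp
      | add x y hx hy => simp only [map_add, add_mul, hx, hy]
      | tmul a b => simp [conjAntipode_apply, mul_assoc]
    rw [this, E.right, smul_mul_assoc]
  middle := by
    have : ∀ z, middleForm (conjAntipode E.S U) (U * E.α) (E.β * (U⁻¹ : Aˣ)) z =
        middleForm E.S E.α E.β z := by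
      intro z
      induction z with
      | zero => simp
      | add x y hx hy => simp only [map_add, hx, hy]
      | tmul a z =>
        induction z with
        | zero => simp
        | add x y hx hy => simp only [map_add, TensorProduct.tmul_add, hx, hy]
        | tmul b c => simp [conjAntipode_apply, mul_assoc]
    rw [this, E.middle]
  outer := by
    have : ∀ z, outerForm (conjAntipode E.S U) (U * E.α) (E.β * (U⁻¹ : Aˣ)) z =
        U * outerForm E.S E.α E.β z * (U⁻¹ : Aˣ) := by
      intro z
      induction z with
      | zero => simp
      | add x y hx hy => simp only [map_add, mul_add, add_mul, hx, hy]
      | tmul a z =>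
        induction z with
        | zero => simp
        | add x y hx hy => simp only [map_add, mul_add, add_mul, TensorProduct.tmul_add, hx, hy]
        | tmul b c => simp [conjAntipode_apply, mul_assoc]
    rw [this, E.outer, mul_one, Units.mul_inv]

/-- The algebra map `x # σ ↦ f(x) X_σ`. -/
noncomputable def CrossedSystem.liftHom {G : Type w} [Group G] {Q : QuasiBialgebra k A}
    (C : CrossedSystem G Q) {M : Type*} [Ring M] [Algebra k M] (f : A →ₐ[k] M) (X : G → M)
    (h1 : X 1 = 1) (hact : ∀ σ a, X σ * f a = f (C.act σ a) * X σ)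
    (hmul : ∀ σ τ, X σ * X τ = f (C.θ σ τ) * X (σ * τ)) : C.Product →ₐ[k] M :=
  AlgHom.ofLinearMap (C.lift fun σ => (LinearMap.mulRight k (X σ)).comp f.toLinearMap)
    (by rw [C.one_def, C.lift_incl]; simp [h1])
    (fun x y => by
      induction x using C.induction with
      | h0 => simp only [zero_mul, map_zero]
      | hadd x y hx hy => simp only [add_mul, map_add, hx, hy]
      | hs σ x =>
        induction y using C.induction with
        | h0 => simp only [mul_zero, map_zero]
        | hadd x y hx hy => simp only [mul_add, map_add, hx, hy]
        | hs τ y =>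
          simp only [CrossedSystem.incl_mul_incl, CrossedSystem.lift_incl, LinearMap.comp_apply,
            AlgHom.toLinearMap_apply, LinearMap.mulRight_apply, map_mul, mul_assoc, ← hmul]
          rw [← mul_assoc (X σ), hact, mul_assoc])

@[simp] theorem CrossedSystem.liftHom_incl {G : Type w} [Group G] {Q : QuasiBialgebra k A}
    (C : CrossedSystem G Q) {M : Type*} [Ring M] [Algebra k M] (f : A →ₐ[k] M) (X : G → M)
    (h1 : X 1 = 1) (hact : ∀ σ a, X σ * f a = f (C.act σ a) * X σ)
    (hmul : ∀ σ τ, X σ * X τ = f (C.θ σ τ) * X (σ * τ)) (σ : G) (a : A) :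
    C.liftHom f X h1 hact hmul (C.incl σ a) = f a * X σ :=
  C.lift_incl _ σ a

end Pullback

end QuasiHopfAlg

namespace QuasiHopfAlg

/-! ### Restriction of representations along twisted homomorphisms -/

section Restriction

set_option maxSynthPendingDepth 10

variable {k : Type u} [Field k] {A B : Type v} [Ring A] [Algebra k A] [Ring B] [Algebra k B]

/-- Once the associativity isomorphism is moved to the inside, both sides are the action of a single
element of `B ⊗ B ⊗ B`, and the two elements agree by the associator axiom of a twisted
homomorphism. This is the hexagon for the tensor structure `J`. -/
theorem IsTwistedHom.assoc_modules {V₁ V₂ V₃ : Type*} [AddCommGroup V₁] [Module k V₁]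
    [AddCommGroup V₂] [Module k V₂] [AddCommGroup V₃] [Module k V₃] {Q : QuasiBialgebra k A}
    {R : QuasiBialgebra k B} {f : A →ₐ[k] B} {J : (B ⊗[k] B)ˣ} (h : IsTwistedHom Q R f J)
    (ρ₁ : B →ₐ[k] Module.End k V₁) (ρ₂ : B →ₐ[k] Module.End k V₂) (ρ₃ : B →ₐ[k] Module.End k V₃)
    (t : (V₁ ⊗[k] V₂) ⊗[k] V₃) :
    boxRep ρ₁ (boxRep ρ₂ ρ₃) R.Φ (TensorProduct.assoc k V₁ V₂ V₃
      (boxRep ((boxRep ρ₁ ρ₂).comp R.Δ) ρ₃ J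
        (TensorProduct.map (boxRep ρ₁ ρ₂ J) LinearMap.id t))) =
    boxRep ρ₁ ((boxRep ρ₂ ρ₃).comp R.Δ) J (TensorProduct.map LinearMap.id (boxRep ρ₂ ρ₃ J)
      (boxRep (ρ₁.comp f) (boxRep (ρ₂.comp f) (ρ₃.comp f)) Q.Φ
        (TensorProduct.assoc k V₁ V₂ V₃ t))) := by
  -- The identity of the third factor is written as the action of `1`, so that the map on the whole
  -- is the action of `J ⊗ 1`.
  have h0 : (LinearMap.id : V₃ →ₗ[k] V₃) = ρ₃ 1 := by rw [map_one]; rfl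
  have h1 : boxRep (ρ₁.comp f) (boxRep (ρ₂.comp f) (ρ₃.comp f)) (Q.Φ : A ⊗[k] (A ⊗[k] A)) =
      boxRep ρ₁ (boxRep ρ₂ ρ₃) (tensor₃ f Q.Φ) := by
    have : boxRep (ρ₂.comp f) (ρ₃.comp f) =
        (boxRep ρ₂ ρ₃).comp (Algebra.TensorProduct.map f f) :=
      AlgHom.ext fun z => CrossedSystem.boxRep_comp ρ₂ ρ₃ f f z
    rw [this, CrossedSystem.boxRep_comp]
  rw [h0, Rep.assoc_boxRep_comul, Rep.assoc_boxRep, assoc_eq_oneRightGen, Rep.boxRep_idTensor,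
    Rep.map_id_boxRep ρ₁, h1]
  simp only [← Module.End.mul_apply, ← map_mul]
  congr 2
  rw [← mul_assoc, ← mul_assoc]
  exact h.associator

namespace Rep

/-- Restriction of representations along an algebra map. -/
def restriction (Q : QuasiBialgebra k A) (R : QuasiBialgebra k B) (f : A →ₐ[k] B) :
    Rep R ⥤ Rep Q where
  obj X := { V := X.V, ρ := X.ρ.comp f }
  map g := ⟨g.f, fun a v => g.comm (f a) v⟩

@[simp] theorem restriction_map_f (Q : QuasiBialgebra k A) (R : QuasiBialgebra k B)
    (f : A →ₐ[k] B) {X Y : Rep R} (g : X ⟶ Y) : ((restriction Q R f).map g).f = g.f := rfl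

instance (Q : QuasiBialgebra k A) (R : QuasiBialgebra k B) (f : A →ₐ[k] B) :
    (restriction Q R f).Additive where
  map_add := rfl

theorem restriction_isEquivalence (Q : QuasiBialgebra k A) (R : QuasiBialgebra k B)
    (e : A ≃ₐ[k] B) : (restriction Q R e.toAlgHom).IsEquivalence where
  faithful := ⟨fun {X Y} g g' h => Hom.ext (congrArg
    (fun l : (restriction Q R e.toAlgHom).obj X ⟶ (restriction Q R e.toAlgHom).obj Y => l.f) h)⟩
  full := ⟨fun {X Y} g => ⟨⟨g.f, fun b v => by
    have h := g.comm (e.symm b) v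
    change g.f (X.ρ (e (e.symm b)) v) = Y.ρ (e (e.symm b)) (g.f v) at h
    rwa [e.apply_symm_apply] at h⟩, rfl⟩⟩
  essSurj := ⟨fun X => ⟨{ V := X.V, ρ := X.ρ.comp e.symm.toAlgHom },
    ⟨mkIso (Y := X) (LinearEquiv.refl k X.V) fun a (v : X.V) => by
      change X.ρ (e.symm (e a)) v = X.ρ a v
      rw [e.symm_apply_apply]⟩⟩⟩

variable {Q : QuasiBialgebra k A} {R : QuasiBialgebra k B} {f : A →ₐ[k] B} {J : (B ⊗[k] B)ˣ}

/-- The unit constraint of restriction along a twisted homomorphism. -/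
noncomputable def restrictionUnit (h : IsTwistedHom Q R f J) :
    𝟙_ (Rep Q) ≅ (restriction Q R f).obj (𝟙_ (Rep R)) :=
  mkIso (X := 𝟙_ (Rep Q)) (Y := (restriction Q R f).obj (𝟙_ (Rep R)))
    (LinearEquiv.refl k k) fun a (r : k) => by
      change Q.ε a * r = R.ε (f a) * r
      rw [h.counit]

/-- The tensor structure `v ⊗ w ↦ J (v ⊗ w)` of restriction along a twisted homomorphism. -/
noncomputable def restrictionTensor (h : IsTwistedHom Q R f J) (X Y : Rep R) :
    (restriction Q R f).obj X ⊗ (restriction Q R f).obj Y ≅ (restriction Q R f).obj (X ⊗ Y) :=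
  mkIso (X := (restriction Q R f).obj X ⊗ (restriction Q R f).obj Y)
    (Y := (restriction Q R f).obj (X ⊗ Y)) (unitEquiv (boxRep X.ρ Y.ρ) J)
    fun a (t : X.V ⊗[k] Y.V) => by
      change boxRep X.ρ Y.ρ J (boxRep (X.ρ.comp f) (Y.ρ.comp f) (Q.Δ a) t) =
        boxRep X.ρ Y.ρ (R.Δ (f a)) (boxRep X.ρ Y.ρ J t)
      rw [CrossedSystem.boxRep_comp, ← Module.End.mul_apply, ← Module.End.mul_apply, ← map_mul,
        ← map_mul, h.comul]

theorem restrictionTensor_assoc (h : IsTwistedHom Q R f J) (X Y Z : Rep R) :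
    (restrictionTensor h X Y).hom ▷ (restriction Q R f).obj Z ≫
        (restrictionTensor h (X ⊗ Y) Z).hom ≫ (restriction Q R f).map (α_ X Y Z).hom =
      (α_ ((restriction Q R f).obj X) ((restriction Q R f).obj Y)
          ((restriction Q R f).obj Z)).hom ≫
        (restriction Q R f).obj X ◁ (restrictionTensor h Y Z).hom ≫
          (restrictionTensor h X (Y ⊗ Z)).hom := by
  refine hom_ext fun t => ?_
  have h := h.assoc_modules X.ρ Y.ρ Z.ρ t
  simp only [comp_f, LinearMap.comp_apply, whiskerRight_f, whiskerLeft_f, restriction_map_f]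
  refine Eq.trans ?_ (h.trans ?_)
  · rfl
  · rfl

/-- Restriction along a twisted homomorphism is a tensor functor. -/
@[reducible] noncomputable def restrictionMonoidal (h : IsTwistedHom Q R f J) :
    (restriction Q R f).Monoidal :=
  Functor.CoreMonoidal.toMonoidal
    { εIso := restrictionUnit h
      μIso := fun X Y => restrictionTensor h X Y
      μIso_hom_natural_left := fun {X Y} g X' => hom_ext fun t =>
        (boxRep_natural X.ρ X'.ρ Y.ρ X'.ρ g.f LinearMap.id g.comm (fun _ _ => rfl) J t).symm
      μIso_hom_natural_right := fun {X Y} X' g => hom_ext fun t =>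
        (boxRep_natural X'.ρ X.ρ X'.ρ Y.ρ LinearMap.id g.f (fun _ _ => rfl) g.comm J t).symm
      associativity := fun X Y Z => restrictionTensor_assoc h X Y Z
      left_unitality := fun X => hom_ext fun t =>
        (CrossedSystem.lid_twisted R.ε X.ρ J h.counit_left t).symm
      right_unitality := fun X => hom_ext fun t =>
        (CrossedSystem.rid_twisted R.ε X.ρ J h.counit_right t).symm }

end Rep

/-- A twist `J` of `Q` makes an isomorphism `Q_J ≅ R` of quasi-bialgebras a twisted homomorphism
from `Q` to `R`. -/
theorem isTwistedHom_of_twist {Q : QuasiBialgebra k A} (T : Twist Q) {R : QuasiBialgebra k B}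
    {f : A →ₐ[k] B} (hf : IsQuasiBialgebraHom (Q.twist T) R f) :
    IsTwistedHom Q R f (unitsMap (tensor₂ f) T.J) where
  associator := by
    have h1 := map_comulLeft f f (twistΔ Q.Δ T.J) R.Δ hf.comul T.J
    have h2 := map_idTensor f f _ (twistΔ Q.Δ T.J) R.Δ hf.comul T.J
    have h3 : oneRight₂ k B (tensor₂ f T.J) = tensor₃ f (oneRight₂ k A T.J) :=
      (map_idTensor f f (tensor₂ f) _ _ (fun a => by simp) _).symm
    have h4 : oneLeft B (B ⊗[k] B) (tensor₂ f T.J) = tensor₃ f (oneLeft A (A ⊗[k] A) T.J) := by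
      simp
    rw [coe_unitsMap, ← h1, ← h2, h3, h4, ← hf.associator, ← map_mul, ← map_mul, ← map_mul,
      ← map_mul]
    congr 1
    -- What remains is an identity in `A ⊗ A ⊗ A`: the twisted coproducts of `J` are conjugates of
    -- the untwisted ones, and after cancellation this is the definition of `Φ_J` solved for `(1 ⊗
    -- J)(id ⊗ Δ)(J) Φ`.
    rw [comulLeft_twist, idTensor_conj _ _ T.J (twistΔ_apply Q.Δ T.J)]
    change ((twistΦ Q.Δ Q.Φ T.J : (A ⊗[k] (A ⊗[k] A))ˣ) : A ⊗[k] (A ⊗[k] A)) * _ * _ = _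
    simp only [← coe_unitsMap, ← Units.val_mul]
    refine congrArg Units.val ?_
    simp only [twistΦ, map_inv]
    group
  counit_left := by
    rw [coe_unitsMap, map_counitLeft f f Q.ε R.ε hf.counit, T.counit_left, map_one]
  counit_right := by
    rw [coe_unitsMap, map_counitRight f f Q.ε R.ε hf.counit, T.counit_right, map_one]
  counit := hf.counit
  comul a := by
    rw [hf.comul, coe_unitsMap, ← map_mul, ← map_mul]
    congr 1
    change twistΔ Q.Δ T.J a * _ = _
    rw [twistΔ_apply, Units.inv_mul_cancel_right]

end Restriction

end QuasiHopfAlg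

namespace QuasiHopfAlg

/-! ### Equivariant objects are representations of the crossed product -/

section EquivariantRep

set_option maxSynthPendingDepth 10

open Functor.LaxMonoidal Functor.OplaxMonoidal Functor.Monoidal

variable {k : Type u} [Field k] {A : Type v} [Ring A] [Algebra k A] {Q : QuasiBialgebra k A}
  {G : Type w} [CommGroup G] {C : CrossedSystem G Q} {hθ : ∀ σ τ, C.θ σ τ = C.θ τ σ}

namespace CrossedSystem

/-- The linear map underlying `u_σ`. -/
def uMap (M : Equivariant (C.action hθ)) (σ : G) : Module.End k M.X.V := (M.u σ).hom.f

/-- The linear map underlying `u_σ⁻¹`. -/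
def uInv (M : Equivariant (C.action hθ)) (σ : G) : Module.End k M.X.V := (M.u σ).inv.f

theorem uMap_uInv (M : Equivariant (C.action hθ)) (σ : G) (v : M.X.V) :
    uMap M σ (uInv M σ v) = v :=
  LinearMap.congr_fun (congrArg (fun g : M.X ⟶ M.X => g.f) (M.u σ).inv_hom_id) v

theorem uInv_uMap (M : Equivariant (C.action hθ)) (σ : G) (v : M.X.V) :
    uInv M σ (uMap M σ v) = v :=
  LinearMap.congr_fun (congrArg (fun g : (C.restrict σ).obj M.X ⟶ (C.restrict σ).obj M.X => g.f)
    (M.u σ).hom_inv_id) v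

/-- The source of `u_σ` is `F_σ(X)`, on which `a` acts by `σ_*(a)`. Hence it is `u_σ⁻¹`, rather than
`u_σ`, that satisfies the commutation rule `(1 # σ)(a # 1) = (σ_*(a) # 1)(1 # σ)` of the crossed
product. -/
theorem uInv_ρ (M : Equivariant (C.action hθ)) (σ : G) (a : A) (v : M.X.V) :
    uInv M σ (M.X.ρ a v) = M.X.ρ (C.act σ a) (uInv M σ v) :=
  (M.u σ).inv.comm a v

theorem uMap_comp (M : Equivariant (C.action hθ)) (σ τ : G) (v : M.X.V) :
    uMap M (σ * τ) (M.X.ρ (↑(C.θ σ τ)⁻¹ : A) v) = uMap M σ (uMap M τ v) :=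
  LinearMap.congr_fun (congrArg
    (fun g : (C.restrict τ ⋙ C.restrict σ).obj M.X ⟶ M.X => g.f) (M.comp σ τ)) v

/-- Inverting the equivariance condition reverses the order of the factors, so the condition is
taken for the pair `(τ, σ)`; commutativity of `G` and the symmetry of `θ` bring back `(σ, τ)`. -/
theorem uInv_mul (M : Equivariant (C.action hθ)) (σ τ : G) (v : M.X.V) :
    uInv M σ (uInv M τ v) = M.X.ρ (C.θ σ τ) (uInv M (σ * τ) v) := by
  have h := uMap_comp M τ σ (uInv M σ (uInv M τ v))
  rw [uMap_uInv, uMap_uInv, mul_comm τ σ, hθ τ σ] at h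
  have h' := congrArg (uInv M (σ * τ)) h
  rw [uInv_uMap] at h'
  rw [← h', ← Module.End.mul_apply (M.X.ρ (C.θ σ τ)), ← map_mul, Units.mul_inv, map_one,
    Module.End.one_apply]

/-- The definition of an equivariant object does not normalize `u_1`. The multiplication rule at `σ
= τ = 1` makes `u_1⁻¹` idempotent, and an invertible idempotent is the identity. -/
theorem uInv_one (M : Equivariant (C.action hθ)) (v : M.X.V) : uInv M 1 v = v := by
  have h := congrArg (uMap M 1) (uInv_mul M 1 1 v)
  rwa [uMap_uInv, C.θ_one_left, Units.val_one, map_one, mul_one, Module.End.one_apply,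
    uMap_uInv] at h

theorem uMap_intertwines {M N : Equivariant (C.action hθ)} (g : M ⟶ N) (σ : G) (v : M.X.V) :
    g.f.f (uMap M σ v) = uMap N σ (g.f.f v) :=
  LinearMap.congr_fun (congrArg (fun g : (C.restrict σ).obj M.X ⟶ N.X => g.f) (g.comm σ)) v

theorem uInv_intertwines {M N : Equivariant (C.action hθ)} (g : M ⟶ N) (σ : G) (v : M.X.V) :
    g.f.f (uInv M σ v) = uInv N σ (g.f.f v) := by
  rw [← uInv_uMap N σ (g.f.f (uInv M σ v)), ← uMap_intertwines, uMap_uInv]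

/-- `x # σ` acts on an equivariant object by `x u_σ⁻¹`. -/
noncomputable def productRep (M : Equivariant (C.action hθ)) :
    C.Product →ₐ[k] Module.End k M.X.V :=
  C.liftHom M.X.ρ (uInv M) (LinearMap.ext (uInv_one M))
    (fun σ a => LinearMap.ext (uInv_ρ M σ a)) (fun σ τ => LinearMap.ext (uInv_mul M σ τ))

theorem productRep_incl (M : Equivariant (C.action hθ)) (σ : G) (a : A) :
    productRep M (C.incl σ a) = M.X.ρ a * uInv M σ :=
  C.liftHom_incl ..

theorem rep_hom_comm {V W : Type*} [AddCommGroup V] [Module k V] [AddCommGroup W] [Module k W]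
    (ρ : C.Product →ₐ[k] Module.End k V) (ρ' : C.Product →ₐ[k] Module.End k W) (f : V →ₗ[k] W)
    (h : ∀ σ a v, f (ρ (C.incl σ a) v) = ρ' (C.incl σ a) (f v)) (z : C.Product) (v : V) :
    f (ρ z v) = ρ' z (f v) := by
  induction z using C.induction with
  | h0 => simp only [map_zero, LinearMap.zero_apply]
  | hadd x y hx hy => simp only [map_add, LinearMap.add_apply, hx, hy]
  | hs σ x => exact h σ x v

theorem algHom_ext {M : Type*} [Ring M] [Algebra k M] {f g : C.Product →ₐ[k] M}
    (h : ∀ σ a, f (C.incl σ a) = g (C.incl σ a)) : f = g := by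
  refine AlgHom.ext fun z => ?_
  induction z using C.induction with
  | h0 => rw [map_zero, map_zero]
  | hadd x y hx hy => rw [map_add, map_add, hx, hy]
  | hs σ x => exact h σ x

/-- The functor from equivariant objects to representations of the crossed product. -/
noncomputable def toProductRep (C : CrossedSystem G Q) (hθ : ∀ σ τ, C.θ σ τ = C.θ τ σ) :
    Equivariant (C.action hθ) ⥤ Rep C.product where
  obj M := { V := M.X.V, ρ := productRep M }
  map {M N} g := ⟨g.f.f, rep_hom_comm (productRep M) (productRep N) g.f.f fun σ a v => by
    rw [productRep_incl, productRep_incl, Module.End.mul_apply, Module.End.mul_apply,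
      ← uInv_intertwines]
    exact g.f.comm a _⟩

instance : (toProductRep C hθ).Additive where
  map_add := rfl

theorem incl_mul_incl_inv (σ : G) :
    C.incl σ 1 * C.incl σ⁻¹ ((C.act σ).symm (↑(C.θ σ σ⁻¹)⁻¹ : A)) = 1 := by
  rw [incl_mul_incl, mul_inv_cancel, AlgEquiv.apply_symm_apply, one_mul, Units.inv_mul]
  rfl

theorem incl_inv_mul_incl (σ : G) :
    C.incl σ⁻¹ (↑(C.θ σ⁻¹ σ)⁻¹ : A) * C.incl σ 1 = 1 := by
  rw [incl_mul_incl, inv_mul_cancel, map_one, mul_one, Units.inv_mul]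
  rfl

/-- The element `1 # σ`, as a unit. -/
noncomputable def inclUnit (C : CrossedSystem G Q) (σ : G) : C.Productˣ where
  val := C.incl σ 1
  inv := C.incl σ⁻¹ (↑(C.θ σ⁻¹ σ)⁻¹ : A)
  val_inv := by
    -- The left and the right inverse of `1 # σ` come from different formulas, through `θ σ⁻¹ σ` and
    -- `θ σ σ⁻¹`; associativity forces them to be equal.
    have h := left_inv_eq_right_inv (C.incl_inv_mul_incl σ) (C.incl_mul_incl_inv σ)
    rw [h, incl_mul_incl_inv]
  inv_val := C.incl_inv_mul_incl σ

theorem inclUnit_mul_inclOne (σ : G) (a : A) :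
    (C.inclUnit σ : C.Product) * C.inclOne a = C.inclOne (C.act σ a) * C.inclUnit σ := by
  simp [inclUnit, inclOne_apply, θ_one_left, θ_one_right, act_one]

theorem inclUnit_mul_inclUnit (σ τ : G) :
    (C.inclUnit σ : C.Product) * C.inclUnit τ = C.inclOne (C.θ σ τ) * C.inclUnit (σ * τ) := by
  simp [inclUnit, inclOne_apply, θ_one_left, act_one]

theorem inclOne_mul_inclUnit (σ : G) (a : A) :
    C.inclOne a * (C.inclUnit σ : C.Product) = C.incl σ a := by
  simp [inclUnit, inclOne_apply, θ_one_left]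

/-- The underlying representation of `A`. -/
noncomputable def baseRep (X : Rep C.product) : Rep Q := { V := X.V, ρ := X.ρ.comp C.inclOne }

/-- The equivariant object given by a representation of the crossed product. -/
noncomputable def ofProductRep (C : CrossedSystem G Q) (hθ : ∀ σ τ, C.θ σ τ = C.θ τ σ)
    (X : Rep C.product) : Equivariant (C.action hθ) where
  X := baseRep X
  u σ := Rep.mkIso (X := (C.restrict σ).obj (baseRep X)) (Y := baseRep X)
    (Rep.unitEquiv X.ρ (C.inclUnit σ)⁻¹) fun a (v : X.V) => by
      change X.ρ (↑(C.inclUnit σ)⁻¹ : C.Product) (X.ρ (C.inclOne (C.act σ a)) v) =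
        X.ρ (C.inclOne a) (X.ρ (↑(C.inclUnit σ)⁻¹ : C.Product) v)
      rw [← Module.End.mul_apply, ← Module.End.mul_apply, ← map_mul, ← map_mul]
      congr 2
      rw [Units.inv_mul_eq_iff_eq_mul, ← mul_assoc, Units.eq_mul_inv_iff_mul_eq]
      exact (C.inclUnit_mul_inclOne σ a).symm
  comp σ τ := Rep.hom_ext fun (v : X.V) => by
    change X.ρ (↑(C.inclUnit (σ * τ))⁻¹ : C.Product) (X.ρ (C.inclOne (↑(C.θ σ τ)⁻¹ : A)) v) =
      X.ρ (↑(C.inclUnit σ)⁻¹ : C.Product) (X.ρ (↑(C.inclUnit τ)⁻¹ : C.Product) v)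
    rw [← Module.End.mul_apply, ← Module.End.mul_apply, ← map_mul, ← map_mul]
    congr 2
    -- The factors are taken in the order `τ`, `σ` because the structure maps are inverses of the
    -- units `1 # σ`.
    have h := C.inclUnit_mul_inclUnit τ σ
    rw [mul_comm τ σ, hθ τ σ] at h
    have h' : C.inclUnit τ * C.inclUnit σ =
        unitsMap C.inclOne (C.θ σ τ) * C.inclUnit (σ * τ) := Units.ext h
    have h'' := congrArg (fun x : C.Productˣ => ((x⁻¹ : C.Productˣ) : C.Product)) h'
    simp only [mul_inv_rev, Units.val_mul] at h''
    rw [h'', ← map_inv, coe_unitsMap]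

theorem uInv_ofProductRep (X : Rep C.product) (σ : G) (v : X.V) :
    uInv (ofProductRep C hθ X) σ v = X.ρ (C.inclUnit σ) v := by
  change X.ρ ((((C.inclUnit σ)⁻¹)⁻¹ : C.Productˣ) : C.Product) v = _
  rw [inv_inv]

/-- On both sides a morphism is a linear map commuting with the action of `A` and with all `u_σ`.
Conversely, a representation of the crossed product is recovered from its restriction to `A` and the
inverses of the operators of `1 # σ`, on the same vector space. -/
theorem toProductRep_isEquivalence : (toProductRep C hθ).IsEquivalence where
  faithful := ⟨fun {M N} g g' h => Equivariant.Hom.ext (Rep.Hom.ext (congrArg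
    (fun l : (toProductRep C hθ).obj M ⟶ (toProductRep C hθ).obj N => l.f) h))⟩
  full := ⟨fun {M N} g => by
    obtain ⟨f, hf⟩ : ∃ f : M.X.V →ₗ[k] N.X.V, f = g.f := ⟨g.f, rfl⟩
    have hg : ∀ σ a v, f (M.X.ρ a (uInv M σ v)) = N.X.ρ a (uInv N σ (f v)) := by
      intro σ a v
      have h := g.comm (C.incl σ a) v
      rw [← hf] at h
      change f (productRep M (C.incl σ a) v) = productRep N (C.incl σ a) (f v) at h
      rwa [productRep_incl, productRep_incl] at h
    -- Compatibility with the elements `a # 1` is `A`-linearity.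
    let g₀ : M.X ⟶ N.X := ⟨f, fun a v => by
      have h := hg 1 a v
      rwa [uInv_one, uInv_one] at h⟩
    refine ⟨⟨g₀, fun σ => Rep.hom_ext fun (v : M.X.V) => ?_⟩, Rep.Hom.ext hf⟩
    change f (uMap M σ v) = uMap N σ (f v)
    -- Compatibility with `1 # σ`, evaluated at `u_σ v`, is equivariance.
    have h := hg σ 1 (uMap M σ v)
    rw [map_one, map_one, Module.End.one_apply, Module.End.one_apply, uInv_uMap] at h
    rw [h, uMap_uInv]⟩
  essSurj := ⟨fun X => ⟨ofProductRep C hθ X,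
    ⟨Rep.mkIso (X := (toProductRep C hθ).obj (ofProductRep C hθ X)) (Y := X)
      (LinearEquiv.refl k X.V) fun z (v : X.V) =>
        rep_hom_comm (productRep (ofProductRep C hθ X)) X.ρ (LinearMap.id : X.V →ₗ[k] X.V)
          (fun σ a (v : X.V) => by
            rw [productRep_incl]
            refine (congrArg (X.ρ (C.inclOne a)) (uInv_ofProductRep X σ v)).trans ?_
            change (X.ρ (C.inclOne a) * X.ρ (C.inclUnit σ)) v = X.ρ (C.incl σ a) v
            rw [← map_mul, inclOne_mul_inclUnit]) z v⟩⟩⟩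

/-- Each `x # σ` factors as `(x # 1)(1 # σ)`. This separates the action of `A ⊗ A` from the
operators `u_σ⁻¹ ⊗ u_σ⁻¹` in a coproduct. -/
theorem boxRep_incl₂ {V W : Type*} [AddCommGroup V] [Module k V] [AddCommGroup W] [Module k W]
    (ρ : C.Product →ₐ[k] Module.End k V) (ρ' : C.Product →ₐ[k] Module.End k W) (σ : G)
    (p : A ⊗[k] A) (t : V ⊗[k] W) :
    boxRep ρ ρ' (C.incl₂ σ p) t = boxRep (ρ.comp C.inclOne) (ρ'.comp C.inclOne) p
      (TensorProduct.map (ρ (C.inclUnit σ)) (ρ' (C.inclUnit σ)) t) := by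
  induction p with
  | zero => simp
  | add x y hx hy => simp only [map_add, LinearMap.add_apply, hx, hy]
  | tmul a b =>
    rw [TensorProduct.map_tmul, boxRep_tmul, boxRep_tmul, ← LinearMap.comp_apply,
      ← TensorProduct.map_comp, ← inclOne_mul_inclUnit, ← inclOne_mul_inclUnit, map_mul, map_mul]
    rfl

theorem productRep_inclOne (M : Equivariant (C.action hθ)) :
    (productRep M).comp C.inclOne = M.X.ρ := by
  refine AlgHom.ext fun a => LinearMap.ext fun v => ?_
  rw [AlgHom.comp_apply, inclOne_apply, productRep_incl, Module.End.mul_apply, uInv_one]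

theorem productRep_inclUnit (M : Equivariant (C.action hθ)) (σ : G) :
    productRep M (C.inclUnit σ) = uInv M σ := by
  change productRep M (C.incl σ 1) = _
  rw [productRep_incl, map_one, one_mul]

/-- Both sides send `x # σ` to `Δ(x) J_σ (u_σ⁻¹ ⊗ u'_σ⁻¹)`: on the left by the coproduct of the
crossed product, on the right because the structure map of `M ⊗ N` is `(u_σ ⊗ u'_σ) J_σ⁻¹`. The
identity map can therefore serve as the tensor constraint. -/
theorem productRep_tensor (M N : Equivariant (C.action hθ)) :
    (boxRep (productRep M) (productRep N)).comp C.comulHom = productRep (M ⊗ N) := by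
  refine algHom_ext fun σ x => LinearMap.ext fun t => ?_
  refine Eq.trans ?_ (LinearMap.congr_fun (productRep_incl (M ⊗ N) σ x) t).symm
  rw [AlgHom.comp_apply, comulHom_incl, boxRep_incl₂, productRep_inclOne,
    productRep_inclOne, productRep_inclUnit, productRep_inclUnit, map_mul]
  rfl

theorem productRep_unit :
    Rep.unitRep C.counitHom = productRep (𝟙_ (Equivariant (C.action hθ))) := by
  refine algHom_ext fun σ x => LinearMap.ext fun r => ?_
  refine Eq.trans ?_ (LinearMap.congr_fun (productRep_incl (𝟙_ _) σ x) r).symm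
  rw [Rep.unitRep_apply, counitHom_incl]
  rfl

theorem boxRep_map {D D' E E' V W : Type*} [Ring D] [Algebra k D] [Ring D'] [Algebra k D']
    [Ring E] [Algebra k E] [Ring E'] [Algebra k E'] [AddCommGroup V] [Module k V]
    [AddCommGroup W] [Module k W] (ρ : D →ₐ[k] Module.End k V) (τ : E →ₐ[k] Module.End k W)
    (f : D' →ₐ[k] D) (g : E' →ₐ[k] E) (z : D' ⊗[k] E') :
    boxRep ρ τ (Algebra.TensorProduct.map f g z) = boxRep (ρ.comp f) (τ.comp g) z := by
  induction z with
  | zero => simp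
  | add x y hx hy => simp only [map_add, hx, hy]
  | tmul a b => simp

theorem act₂_productRep (X Y : Equivariant (C.action hθ)) :
    (boxRep (productRep X) (productRep Y)).comp (tensor₂ C.inclOne) = boxRep X.X.ρ Y.X.ρ := by
  refine AlgHom.ext fun z => (boxRep_map (productRep X) (productRep Y) C.inclOne C.inclOne
    z).trans ?_
  rw [productRep_inclOne, productRep_inclOne]

theorem act₃_productRep (X Y Z : Equivariant (C.action hθ)) (z : A ⊗[k] (A ⊗[k] A)) :
    boxRep (productRep X) (boxRep (productRep Y) (productRep Z)) (tensor₃ C.inclOne z) =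
      boxRep X.X.ρ (boxRep Y.X.ρ Z.X.ρ) z := by
  refine (boxRep_map (productRep X) (boxRep (productRep Y) (productRep Z)) C.inclOne
    (tensor₂ C.inclOne) z).trans ?_
  rw [act₂_productRep, productRep_inclOne]

/-- The tensor structure of the functor to representations of the crossed product. -/
@[reducible] noncomputable def toProductRepMonoidal : (toProductRep C hθ).Monoidal :=
  Functor.CoreMonoidal.toMonoidal
    { εIso := Rep.mkIso (X := 𝟙_ (Rep C.product))
        (Y := (toProductRep C hθ).obj (𝟙_ (Equivariant (C.action hθ)))) (LinearEquiv.refl k k)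
        fun z r => LinearMap.congr_fun (AlgHom.congr_fun productRep_unit z) r
      μIso := fun M N => Rep.mkIso
        (X := (toProductRep C hθ).obj M ⊗ (toProductRep C hθ).obj N)
        (Y := (toProductRep C hθ).obj (M ⊗ N)) (LinearEquiv.refl k (M.X.V ⊗[k] N.X.V))
        fun z t => LinearMap.congr_fun (AlgHom.congr_fun (productRep_tensor M N) z) t
      μIso_hom_natural_left := fun {M N} g M' => rfl
      μIso_hom_natural_right := fun {M N} M' g => rfl
      associativity := fun X Y Z => Rep.hom_ext fun (t : (X.X.V ⊗[k] Y.X.V) ⊗[k] Z.X.V) => by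
        -- With identity constraints the hexagon only compares the associators, and that of the
        -- crossed product is the image of `Φ` under `a ↦ a # 1`.
        change boxRep X.X.ρ (boxRep Y.X.ρ Z.X.ρ) Q.Φ (TensorProduct.assoc k X.X.V Y.X.V Z.X.V
          (TensorProduct.map LinearMap.id LinearMap.id t)) =
          TensorProduct.map LinearMap.id LinearMap.id
            (boxRep (productRep X) (boxRep (productRep Y) (productRep Z)) (tensor₃ C.inclOne Q.Φ)
              (TensorProduct.assoc k X.X.V Y.X.V Z.X.V t))
        rw [act₃_productRep, TensorProduct.map_id, TensorProduct.map_id]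
        rfl
      left_unitality := fun X => Rep.hom_ext fun (t : k ⊗[k] X.X.V) => by
        change TensorProduct.lid k X.X.V t = TensorProduct.lid k X.X.V
          (TensorProduct.map LinearMap.id LinearMap.id t)
        rw [TensorProduct.map_id]
        rfl
      right_unitality := fun X => Rep.hom_ext fun (t : X.X.V ⊗[k] k) => by
        change TensorProduct.rid k X.X.V t = TensorProduct.rid k X.X.V
          (TensorProduct.map LinearMap.id LinearMap.id t)
        rw [TensorProduct.map_id]
        rfl }

end CrossedSystem

end EquivariantRep

end QuasiHopfAlg

namespace QuasiHopfAlg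

/-! ### Diagonal elements with respect to complete orthogonal idempotents -/

section Diagonal

set_option maxSynthPendingDepth 10

variable {k : Type u} [Field k] {H : Type v} [Ring H] [Algebra k H] {ι : Type*} [Fintype ι]
  {e : ι → H} (he : CompleteOrthogonalIdempotents e)

/-- Orthogonality kills the cross terms. The coefficients lie in an arbitrary algebra so that the
construction can be iterated over tensor factors; identities between diagonal elements then reduce
to pointwise identities of scalar functions. -/
theorem sum_idem_mul_sum_idem [DecidableEq ι] (he : CompleteOrthogonalIdempotents e)
    {B : Type*} [Ring B] [Algebra k B] (c d : ι → B) :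
    (∑ i, e i ⊗ₜ[k] c i) * ∑ i, e i ⊗ₜ[k] d i = ∑ i, e i ⊗ₜ[k] (c i * d i) := by
  rw [Finset.sum_mul]
  refine Finset.sum_congr rfl fun i _ => ?_
  rw [Finset.mul_sum, Finset.sum_eq_single i]
  · rw [Algebra.TensorProduct.tmul_mul_tmul, (he.idem i).eq]
  · intro j _ hj
    rw [Algebra.TensorProduct.tmul_mul_tmul, he.ortho hj.symm, TensorProduct.zero_tmul]
  · exact fun h => absurd (Finset.mem_univ i) h

/-- `c ↦ ∑ e_i ⊗ c_i`. -/
noncomputable def diag {B : Type*} [Ring B] [Algebra k B] : (ι → B) →ₐ[k] H ⊗[k] B := by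
  classical
  exact AlgHom.ofLinearMap
    (∑ i, (TensorProduct.mk k H B (e i)).comp (LinearMap.proj i))
    (by simp [← TensorProduct.sum_tmul, he.complete, Algebra.TensorProduct.one_def])
    (fun c d => by simpa using (sum_idem_mul_sum_idem he c d).symm)

theorem diag_apply {B : Type*} [Ring B] [Algebra k B] (c : ι → B) :
    diag he c = ∑ i, e i ⊗ₜ[k] c i := by
  simp [diag]

/-- `c ↦ ∑ c_i e_i`. -/
noncomputable def scal : (ι → k) →ₐ[k] H :=
  (Algebra.TensorProduct.rid k k H).toAlgHom.comp (diag he)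

theorem scal_apply (c : ι → k) : scal he c = ∑ i, c i • e i := by
  simp [scal, diag_apply]

/-- `c ↦ ∑ c_(i,j) e_i ⊗ e_j`. -/
noncomputable def scal₂ : (ι → ι → k) →ₐ[k] H ⊗[k] H :=
  (diag he).comp ((scal he).compLeft ι)

theorem scal₂_apply (c : ι → ι → k) : scal₂ he c = ∑ i, e i ⊗ₜ[k] scal he (c i) := by
  simp [scal₂, diag_apply]

/-- `c ↦ ∑ c_(i,j,l) e_i ⊗ e_j ⊗ e_l`. -/
noncomputable def scal₃ : (ι → ι → ι → k) →ₐ[k] H ⊗[k] (H ⊗[k] H) :=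
  (diag he).comp ((scal₂ he).compLeft ι)

theorem scal₃_apply (c : ι → ι → ι → k) : scal₃ he c = ∑ i, e i ⊗ₜ[k] scal₂ he (c i) := by
  simp [scal₃, diag_apply]

/-- Completeness of the idempotents: `1` is the diagonal element with constant coefficient one. -/
theorem one_tmul_eq_diag {B : Type*} [Ring B] [Algebra k B] (b : B) :
    (1 : H) ⊗ₜ[k] b = diag he fun _ => b := by
  rw [diag_apply, ← TensorProduct.sum_tmul, he.complete]

theorem scal_tmul_eq_diag {B : Type*} [Ring B] [Algebra k B] (c : ι → k) (b : B) :
    scal he c ⊗ₜ[k] b = diag he fun i => c i • b := by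
  rw [diag_apply, scal_apply, TensorProduct.sum_tmul]
  exact Finset.sum_congr rfl fun i _ => TensorProduct.smul_tmul ..

theorem scal_tmul_scal (c d : ι → k) :
    scal he c ⊗ₜ[k] scal he d = scal₂ he fun i j => c i * d j := by
  rw [scal_tmul_eq_diag, diag_apply, scal₂_apply]
  refine Finset.sum_congr rfl fun i _ => ?_
  rw [← map_smul]
  rfl

theorem scal_tmul_one (c : ι → k) : scal he c ⊗ₜ[k] (1 : H) = scal₂ he fun i _ => c i := by
  have h := scal_tmul_scal he c 1
  rw [map_one] at h
  simpa using h

theorem one_tmul_scal₂ (d : ι → ι → k) :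
    (1 : H) ⊗ₜ[k] scal₂ he d = scal₃ he fun _ j l => d j l := by
  rw [one_tmul_eq_diag he, diag_apply, scal₃_apply]

theorem oneRight₂_scal₂ (d : ι → ι → k) :
    oneRight₂ k H (scal₂ he d) = scal₃ he fun i j _ => d i j := by
  rw [scal₂_apply, scal₃_apply, map_sum]
  refine Finset.sum_congr rfl fun i _ => ?_
  rw [Algebra.TensorProduct.map_tmul, Algebra.TensorProduct.includeLeft_apply, scal_tmul_one]
  rfl

/-- Diagonal elements commute. -/
theorem scal_mul_comm (c d : ι → k) : scal he c * scal he d = scal he d * scal he c := by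
  rw [← map_mul, ← map_mul, mul_comm]

/-- The idempotents are the indicator functions, so statements about all diagonal elements
specialize to them. -/
theorem idem_eq_scal [DecidableEq ι] (i : ι) : e i = scal (k := k) he (Pi.single i 1) := by
  rw [scal_apply, Finset.sum_eq_single i]
  · simp
  · intro j _ hj
    simp [hj]
  · exact fun h => absurd (Finset.mem_univ i) h

end Diagonal

/-! ### The idempotents of a cyclic group -/

section CyclicIdempotents

set_option maxSynthPendingDepth 10

variable {k : Type u} [Field k] {N : ℕ} {q : k} {B : Type v} [Ring B] [Algebra k B]

/-- Used with `f = Δ`: the coproduct of `1_i` is the `i`-th idempotent of the unit `Δ(X)`, hence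
determined by the eigenvalues of `Δ(X)`. -/
theorem map_idem {B' : Type*} [Ring B'] [Algebra k B'] (f : B →ₐ[k] B') (X : Bˣ) (i : ℕ) :
    f (idem N q X i) = idem N q (unitsMap f X) i := by
  simp [idem]

variable [NeZero N]

/-- The indices are moved to `ZMod N`, where sums, negatives and shifts of indices need no
reduction. -/
theorem sum_range_eq_sum_zmod {M : Type*} [AddCommMonoid M] (f : ℕ → M) :
    ∑ i ∈ Finset.range N, f i = ∑ i : ZMod N, f i.val := by
  refine Finset.sum_nbij' (fun i => (i : ZMod N)) ZMod.val (fun _ _ => Finset.mem_univ _)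
    (fun i _ => Finset.mem_range.2 (ZMod.val_lt i))
    (fun i hi => ZMod.val_cast_of_lt (Finset.mem_range.1 hi)) (fun i _ => ZMod.natCast_zmod_val i)
    (fun i hi => ?_)
  rw [ZMod.val_cast_of_lt (Finset.mem_range.1 hi)]

theorem zpow_eq_zpow (hq : IsPrimitiveRoot q N) {a b : ℤ} (h : (N : ℤ) ∣ a - b) :
    q ^ a = q ^ b := by
  obtain ⟨t, ht⟩ := h
  rw [eq_add_of_sub_eq ht, zpow_add₀ (hq.ne_zero (NeZero.ne N)), zpow_mul, zpow_natCast,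
    hq.pow_eq_one, one_zpow, one_mul]

theorem pow_val_intCast (hq : IsPrimitiveRoot q N) (a : ℤ) :
    q ^ (a : ZMod N).val = q ^ a := by
  rw [← zpow_natCast, ZMod.val_intCast]
  exact zpow_eq_zpow hq (Int.ModEq.dvd (Int.mod_modEq a N).symm)

theorem zpow_mul_idem (hq : IsPrimitiveRoot q N) (hX : X ^ N = 1) (n : ℤ) (j : ZMod N) :
    ((X ^ n : Bˣ) : B) * idem N q X j.val = q ^ (n * j.val) • idem N q X j.val := by
  have hq0 : q ≠ 0 := hq.ne_zero (NeZero.ne N)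
  have h : ∀ l : ℕ, ((X ^ l : Bˣ) : B) * idem N q X j.val =
      q ^ ((l : ℤ) * j.val) • idem N q X j.val := fun l => by
    rw [Units.val_pow_eq_pow_val, pow_mul_idem (NeZero.ne N) hq hX, ← zpow_natCast]
    push_cast
    rfl
  obtain ⟨l, rfl | rfl⟩ := n.eq_nat_or_neg
  · rw [zpow_natCast, h]
  · rw [zpow_neg, zpow_natCast, Units.inv_mul_eq_iff_eq_mul, mul_smul_comm, h, smul_smul,
      ← zpow_add₀ hq0]
    simp

variable [CharZero k]

/-- `X y = q^j y` implies `1_i y = δ_(i,j) y`. -/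
theorem idem_mul_of_eigenvector (hq : IsPrimitiveRoot q N) (X : Bˣ) (i j : ZMod N) (y : B)
    (h : (X : B) * y = q ^ j.val • y) :
    idem N q X i.val * y = if i = j then y else 0 := by
  have hl : ∀ l : ℕ, (X : B) ^ l * y = q ^ (l * j.val) • y := by
    intro l
    induction l with
    | zero => simp
    | succ l ih =>
      rw [pow_succ, mul_assoc, h, mul_smul_comm, ih, smul_smul, ← pow_add]
      congr 2
      ring
  rw [idem, smul_mul_assoc, Finset.sum_mul]
  simp only [smul_mul_assoc, hl, smul_smul]
  rw [← Finset.sum_smul, geom_sum_root hq (ZMod.val_lt i) (ZMod.val_lt j), smul_smul]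
  by_cases hij : i = j
  · rw [if_pos (congrArg ZMod.val hij), if_pos hij,
      inv_mul_cancel₀ (Nat.cast_ne_zero.2 (NeZero.ne N)), one_smul]
  · rw [if_neg (fun h => hij (ZMod.val_injective N h)), if_neg hij, mul_zero, zero_smul]

theorem completeOrthogonalIdempotents_idem (hq : IsPrimitiveRoot q N) {X : Bˣ} (hX : X ^ N = 1) :
    CompleteOrthogonalIdempotents fun i : ZMod N => idem N q X i.val := by
  rw [CompleteOrthogonalIdempotents.iff_ortho_complete]
  refine ⟨fun i j hij => ?_, ?_⟩
  · change idem N q X i.val * idem N q X j.val = 0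
    rw [idem_mul_idem (NeZero.ne N) hq hX (ZMod.val_lt i) (ZMod.val_lt j),
      if_neg fun h => hij (ZMod.val_injective N h)]
  · rw [← sum_range_eq_sum_zmod (fun i => idem N q X i), sum_idem (NeZero.ne N) hq]

variable (hq : IsPrimitiveRoot q N) {X : Bˣ} (hX : X ^ N = 1)

theorem idemSum_eq_scal₂ (c : ℕ → ℕ → k) :
    idemSum N q X c =
      scal₂ (completeOrthogonalIdempotents_idem hq hX) fun i j => c i.val j.val := by
  rw [idemSum, scal₂_apply, sum_range_eq_sum_zmod]
  refine Finset.sum_congr rfl fun i _ => ?_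
  rw [sum_range_eq_sum_zmod, scal_apply, TensorProduct.tmul_sum]
  exact Finset.sum_congr rfl fun j _ => (TensorProduct.tmul_smul _ _ _).symm

theorem zpow_eq_scal (n : ℤ) :
    ((X ^ n : Bˣ) : B) =
      scal (completeOrthogonalIdempotents_idem hq hX) fun i => q ^ (n * i.val) := by
  rw [scal_apply, ← mul_one ((X ^ n : Bˣ) : B),
    ← (completeOrthogonalIdempotents_idem hq hX).complete, Finset.mul_sum]
  exact Finset.sum_congr rfl fun j _ => zpow_mul_idem hq hX n j

/-- Diagonal elements move past an eigenvector of conjugation by `X`. -/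
theorem scal_mul_eigenvector {x : B} {d : ℤ} (hx : (X : B) * x = q ^ d • (x * X))
    (c : ZMod N → k) :
    scal (completeOrthogonalIdempotents_idem hq hX) c * x =
      x * scal (completeOrthogonalIdempotents_idem hq hX) fun i => c (i + d) := by
  -- The element `x 1_j` is an eigenvector of left multiplication by `X` with eigenvalue `q ^ (j +
  -- d)`, so only `1_(j+d)` survives in front of it.
  have h : ∀ i j : ZMod N, idem N q X i.val * (x * idem N q X j.val) =
      if i = j + d then x * idem N q X j.val else 0 := fun i j => by
    refine idem_mul_of_eigenvector hq X i (j + d) _ ?_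
    have h1 := zpow_mul_idem hq hX 1 j
    rw [zpow_one, one_mul] at h1
    rw [← mul_assoc, hx, smul_mul_assoc, mul_assoc, h1, mul_smul_comm, smul_smul,
      ← zpow_add₀ (hq.ne_zero (NeZero.ne N)), ← pow_val_intCast hq]
    congr 3
    push_cast
    rw [ZMod.natCast_zmod_val, add_comm]
  rw [scal_apply, scal_apply]
  conv_lhs => rw [← mul_one x, ← (completeOrthogonalIdempotents_idem hq hX).complete]
  rw [Finset.mul_sum, Finset.mul_sum, Finset.mul_sum]
  refine Finset.sum_congr rfl fun j _ => ?_
  rw [Finset.sum_mul, Finset.sum_eq_single (j + d)]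
  · rw [smul_mul_assoc, h, if_pos rfl, mul_smul_comm]
  · intro i _ hi
    rw [smul_mul_assoc, h, if_neg hi, smul_zero]
  · exact fun h => absurd (Finset.mem_univ _) h

/-- `Δ(1_n)` is the `n`-th idempotent of the grouplike `X ⊗ X`, which acts on `1_i ⊗ 1_j` by `q ^ (i
+ j)`. It is therefore the sum of the `1_i ⊗ 1_j` with `i + j = n`. -/
theorem comul_idem (Δ : B →ₐ[k] B ⊗[k] B) (hq : IsPrimitiveRoot q N) (hX : X ^ N = 1)
    (hΔ : Δ X = (X : B) ⊗ₜ[k] (X : B)) (n : ZMod N) :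
    Δ (idem N q X n.val) = ∑ i : ZMod N, idem N q X i.val ⊗ₜ[k] idem N q X (n - i).val := by
  have h1 : ∀ j : ZMod N, (X : B) * idem N q X j.val = q ^ (j.val : ℤ) • idem N q X j.val :=
    fun j => by simpa using zpow_mul_idem hq hX 1 j
  have h : ∀ i j : ZMod N,
      Δ (idem N q X n.val) * (idem N q X i.val ⊗ₜ[k] idem N q X j.val) =
        if n = i + j then idem N q X i.val ⊗ₜ[k] idem N q X j.val else 0 := fun i j => by
    rw [map_idem]
    refine idem_mul_of_eigenvector hq _ n (i + j) _ ?_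
    rw [coe_unitsMap, hΔ, Algebra.TensorProduct.tmul_mul_tmul, h1, h1,
      TensorProduct.smul_tmul_smul, ← zpow_add₀ (hq.ne_zero (NeZero.ne N)),
      ← pow_val_intCast hq]
    congr 3
    push_cast
    rw [ZMod.natCast_zmod_val, ZMod.natCast_zmod_val]
  rw [← mul_one (Δ _), Algebra.TensorProduct.one_def,
    ← (completeOrthogonalIdempotents_idem hq hX).complete, TensorProduct.sum_tmul,
    Finset.mul_sum]
  refine Finset.sum_congr rfl fun i _ => ?_
  rw [TensorProduct.tmul_sum, Finset.mul_sum, Finset.sum_eq_single (n - i)]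
  · rw [h, if_pos (by ring)]
  · intro j _ hj
    rw [h, if_neg fun h' => hj (by rw [h']; ring)]
  · exact fun h => absurd (Finset.mem_univ _) h

/-- The coproduct of a function on `ZMod N` is its pullback along addition, by linearity from the
case of an idempotent. -/
theorem comul_scal (Δ : B →ₐ[k] B ⊗[k] B) (hΔ : Δ X = (X : B) ⊗ₜ[k] (X : B)) (c : ZMod N → k) :
    Δ (scal (completeOrthogonalIdempotents_idem hq hX) c) =
      scal₂ (completeOrthogonalIdempotents_idem hq hX) fun i j => c (i + j) := by
  rw [scal_apply, map_sum, scal₂_apply]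
  simp only [map_smul, comul_idem Δ hq hX hΔ, Finset.smul_sum]
  rw [Finset.sum_comm]
  refine Finset.sum_congr rfl fun i _ => ?_
  rw [scal_apply, TensorProduct.tmul_sum, ← Equiv.sum_comp (Equiv.addLeft i)]
  refine Finset.sum_congr rfl fun j _ => ?_
  rw [TensorProduct.tmul_smul, Equiv.coe_addLeft, add_sub_cancel_left]

theorem idTensor_scal₂ (Δ : B →ₐ[k] B ⊗[k] B) (hΔ : Δ X = (X : B) ⊗ₜ[k] (X : B))
    (c : ZMod N → ZMod N → k) :
    idTensor B Δ (scal₂ (completeOrthogonalIdempotents_idem hq hX) c) =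
      scal₃ (completeOrthogonalIdempotents_idem hq hX) fun i j l => c i (j + l) := by
  rw [scal₂_apply, map_sum, scal₃_apply]
  refine Finset.sum_congr rfl fun i _ => ?_
  rw [Algebra.TensorProduct.map_tmul, comul_scal hq hX Δ hΔ]
  rfl

theorem comulLeft_scal₂ (Δ : B →ₐ[k] B ⊗[k] B) (hΔ : Δ X = (X : B) ⊗ₜ[k] (X : B))
    (c : ZMod N → ZMod N → k) :
    comulLeft B Δ (scal₂ (completeOrthogonalIdempotents_idem hq hX) c) =
      scal₃ (completeOrthogonalIdempotents_idem hq hX) fun i j l => c (i + j) l := by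
  rw [scal₂_apply, map_sum, scal₃_apply]
  simp only [comulLeft_tmul, comul_idem Δ hq hX hΔ, TensorProduct.sum_tmul, map_sum,
    Algebra.TensorProduct.assoc_tmul]
  rw [Finset.sum_comm]
  refine Finset.sum_congr rfl fun i _ => ?_
  rw [scal₂_apply, TensorProduct.tmul_sum, ← Equiv.sum_comp (Equiv.addLeft i)]
  refine Finset.sum_congr rfl fun j _ => ?_
  rw [Equiv.coe_addLeft, add_sub_cancel_left]

/-- `S(1_i)` is the `i`-th idempotent of `X⁻¹`, and `X⁻¹` acts on `1_j` by `q ^ (-j)`; only `j = -i`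
contributes. -/
theorem antipode_idem (S : B →ₐ[k] Bᵐᵒᵖ) (hq : IsPrimitiveRoot q N) (hX : X ^ N = 1)
    (hS : (S X).unop = (X⁻¹ : Bˣ)) (i : ZMod N) :
    (S (idem N q X i.val)).unop = idem N q X (-i).val := by
  have h0 : (S (idem N q X i.val)).unop = idem N q X⁻¹ i.val := by
    have h : ∀ l : ℕ, (S ((X : B) ^ l)).unop = ((X⁻¹ : Bˣ) : B) ^ l := fun l => by
      rw [map_pow, MulOpposite.unop_pow, hS]
    simp only [idem, map_smul, map_sum, MulOpposite.unop_smul, Finset.unop_sum, h]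
  have h : ∀ j : ZMod N, idem N q X⁻¹ i.val * idem N q X j.val =
      if i = -j then idem N q X j.val else 0 := fun j => by
    refine idem_mul_of_eigenvector hq _ i (-j) _ ?_
    have h1 := zpow_mul_idem hq hX (-1) j
    rw [zpow_neg_one] at h1
    rw [h1, ← pow_val_intCast hq]
    congr 3
    push_cast
    rw [ZMod.natCast_zmod_val, neg_one_mul]
  rw [h0, ← mul_one (idem N q X⁻¹ i.val), ← (completeOrthogonalIdempotents_idem hq hX).complete,
    Finset.mul_sum, Finset.sum_eq_single (-i)]
  · rw [h, if_pos (neg_neg i).symm]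
  · intro j _ hj
    rw [h, if_neg fun h' => hj (by rw [h', neg_neg])]
  · exact fun h => absurd (Finset.mem_univ _) h

theorem antipode_scal (S : B →ₐ[k] Bᵐᵒᵖ) (hS : (S X).unop = (X⁻¹ : Bˣ)) (c : ZMod N → k) :
    (S (scal (completeOrthogonalIdempotents_idem hq hX) c)).unop =
      scal (completeOrthogonalIdempotents_idem hq hX) fun i => c (-i) := by
  rw [scal_apply, scal_apply, map_sum, Finset.unop_sum, ← Equiv.sum_comp (Equiv.neg _)]
  refine Finset.sum_congr rfl fun i _ => ?_
  rw [map_smul, MulOpposite.unop_smul, antipode_idem S hq hX hS, Equiv.neg_apply, neg_neg]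

/-- In `1_i S(1_j) = 1_i 1_(-j)` only `j = -i` survives, so a function of two variables is
restricted to the antidiagonal. This computes `β` of a diagonal twist; the next lemma does the same
for `α`. -/
theorem rightForm_scal₂ (S : B →ₐ[k] Bᵐᵒᵖ) (hS : (S X).unop = (X⁻¹ : Bˣ))
    (c : ZMod N → ZMod N → k) :
    rightForm S 1 (scal₂ (completeOrthogonalIdempotents_idem hq hX) c) =
      scal (completeOrthogonalIdempotents_idem hq hX) fun i => c i (-i) := by
  rw [scal₂_apply, map_sum, scal_apply]
  refine Finset.sum_congr rfl fun i _ => ?_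
  rw [rightForm_tmul, mul_one, antipode_scal hq hX S hS, scal_apply, Finset.mul_sum,
    Finset.sum_eq_single i]
  · rw [mul_smul_comm, ((completeOrthogonalIdempotents_idem hq hX).idem i).eq]
  · intro j _ hj
    rw [mul_smul_comm, (completeOrthogonalIdempotents_idem hq hX).ortho hj.symm, smul_zero]
  · exact fun h => absurd (Finset.mem_univ _) h

theorem leftForm_scal₂ (S : B →ₐ[k] Bᵐᵒᵖ) (hS : (S X).unop = (X⁻¹ : Bˣ))
    (c : ZMod N → ZMod N → k) :
    leftForm S 1 (scal₂ (completeOrthogonalIdempotents_idem hq hX) c) =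
      scal (completeOrthogonalIdempotents_idem hq hX) fun i => c (-i) i := by
  rw [scal₂_apply, map_sum, scal_apply, ← Equiv.sum_comp (Equiv.neg _)]
  refine Finset.sum_congr rfl fun i _ => ?_
  rw [leftForm_tmul, mul_one, antipode_idem S hq hX hS, Equiv.neg_apply, neg_neg, scal_apply,
    Finset.mul_sum, Finset.sum_eq_single i]
  · rw [mul_smul_comm, ((completeOrthogonalIdempotents_idem hq hX).idem i).eq]
  · intro j _ hj
    rw [mul_smul_comm, (completeOrthogonalIdempotents_idem hq hX).ortho hj.symm, smul_zero]
  · exact fun h => absurd (Finset.mem_univ _) h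

end CyclicIdempotents

end QuasiHopfAlg

namespace QuasiHopfAlg

/-! ### Periodic diagonal elements -/

section Periodic

set_option maxSynthPendingDepth 10

variable {k : Type u} [Field k] {m : ℕ} {q : k} {B : Type v} [Ring B] [Algebra k B] {X : Bˣ}

theorem idem_pow_mem {A : Subalgebra k B} (hA : ((X ^ m : Bˣ) : B) ∈ A) (a : ℕ) :
    idem m (q ^ m) (X ^ m) a ∈ A :=
  A.smul_mem (A.sum_mem fun l _ => A.smul_mem (A.pow_mem hA l) _) _

variable [NeZero m]

/-- The coefficients `q^(s j (i - i'))` of `J_s`. -/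
def twistFun (m : ℕ) (q : k) (s : ℕ) (i j : ZMod (m ^ 2)) : k := twistCoeff m q i.val j.val ^ s

/-- The coefficient may be computed from any integers representing the two classes; this replaces
the canonical representatives by free integer variables. -/
theorem twistFun_intCast (hq : IsPrimitiveRoot q (m ^ 2)) (s : ℕ) (a b : ℤ) :
    twistFun m q s (a : ZMod (m ^ 2)) (b : ZMod (m ^ 2)) = q ^ (s * (b * (a - a % m))) := by
  have hle : (a : ZMod (m ^ 2)).val % m ≤ (a : ZMod (m ^ 2)).val := Nat.mod_le _ _
  rw [twistFun, twistCoeff, ← pow_mul, ← zpow_natCast]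
  refine zpow_eq_zpow hq (Int.ModEq.dvd (Int.ModEq.symm ?_))
  push_cast [Nat.cast_sub hle, ZMod.val_intCast]
  -- Reducing `a` modulo `m ^ 2` does not change its remainder modulo `m`, so `a - a'` is well
  -- defined modulo `m ^ 2`.
  rw [Int.emod_emod_of_dvd a (Dvd.intro_left _ (pow_succ (m : ℤ) 1).symm), mul_comm]
  exact ((Int.mod_modEq b _).mul ((Int.mod_modEq a _).sub_right _)).mul_left _


theorem eq_of_periodic {M : Type*} {c : ZMod (m ^ 2) → M} (hc : ∀ i, c (i + m) = c i)
    (i : ZMod (m ^ 2)) : c i = c ((i.val : ZMod m).val : ℕ) := by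
  have h : ∀ (t : ℕ) (i : ZMod (m ^ 2)), c (i + ((m * t : ℕ) : ZMod (m ^ 2))) = c i := fun t => by
    induction t with
    | zero => simp
    | succ t ih =>
      intro i
      rw [← ih i, ← hc (i + ((m * t : ℕ) : ZMod (m ^ 2)))]
      congr 1
      push_cast
      ring
  rw [ZMod.val_natCast, ← h (i.val / m) ((i.val % m : ℕ) : ZMod (m ^ 2)), ← Nat.cast_add,
    Nat.mod_add_div, ZMod.natCast_zmod_val]

variable [CharZero k]

/-- `χ ^ m` acts on `1_i` by `(q ^ m) ^ i`, which depends only on `i` modulo `m`. The idempotents of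
`σ` are thus the sums of the `1_i` over residue classes. -/
theorem idem_pow_eq_sum (hq : IsPrimitiveRoot q (m ^ 2)) (hX : X ^ m ^ 2 = 1) (a : ZMod m) :
    idem m (q ^ m) (X ^ m) a.val =
      ∑ i : ZMod (m ^ 2), if a = (i.val : ZMod m) then idem (m ^ 2) q X i.val else 0 := by
  have hq' : IsPrimitiveRoot (q ^ m) m :=
    hq.pow (Nat.pos_of_ne_zero (NeZero.ne _)) (pow_two m)
  rw [← mul_one (idem m (q ^ m) (X ^ m) a.val),
    ← (completeOrthogonalIdempotents_idem hq hX).complete, Finset.mul_sum]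
  refine Finset.sum_congr rfl fun i _ => idem_mul_of_eigenvector hq' _ a _ _ ?_
  rw [Units.val_pow_eq_pow_val, pow_mul_idem (NeZero.ne _) hq hX, ZMod.val_natCast, pow_mul,
    ← pow_eq_pow_mod _ hq'.pow_eq_one]

variable (A : Subalgebra k B)

/-- Grouping a periodic sum by residue classes modulo `m` leaves the idempotents of `σ`, which lie
in `A`. The coefficients are allowed in the image of any algebra map `g`, so that membership in
tensor powers of `A` follows one variable at a time. -/
theorem diag_mem_range (hq : IsPrimitiveRoot q (m ^ 2)) (hX : X ^ m ^ 2 = 1)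
    (hA : ((X ^ m : Bˣ) : B) ∈ A) {C D : Type*} [Ring C] [Algebra k C] [Ring D] [Algebra k D]
    (g : C →ₐ[k] D) {c : ZMod (m ^ 2) → D} (hc : ∀ i, c (i + m) = c i) (hg : ∀ i, c i ∈ g.range) :
    diag (completeOrthogonalIdempotents_idem hq hX) c ∈
      (Algebra.TensorProduct.map A.val g).range := by
  have h : diag (completeOrthogonalIdempotents_idem hq hX) c =
      ∑ a : ZMod m, idem m (q ^ m) (X ^ m) a.val ⊗ₜ[k] c (a.val : ℕ) := by
    simp only [diag_apply, idem_pow_eq_sum hq hX, TensorProduct.sum_tmul]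
    rw [Finset.sum_comm]
    refine Finset.sum_congr rfl fun i _ => ?_
    rw [Finset.sum_eq_single (i.val : ZMod m), if_pos rfl, ← eq_of_periodic hc]
    · intro a _ ha
      rw [if_neg ha, TensorProduct.zero_tmul]
    · exact fun h => absurd (Finset.mem_univ _) h
  rw [h]
  refine Subalgebra.sum_mem _ fun a _ => ?_
  obtain ⟨y, hy⟩ := hg (a.val : ℕ)
  exact ⟨⟨_, idem_pow_mem hA a.val⟩ ⊗ₜ y, by
    change Algebra.TensorProduct.map A.val g _ = _
    rw [Algebra.TensorProduct.map_tmul]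
    exact congrArg _ hy⟩

theorem scal_mem (hq : IsPrimitiveRoot q (m ^ 2)) (hX : X ^ m ^ 2 = 1)
    (hA : ((X ^ m : Bˣ) : B) ∈ A) {c : ZMod (m ^ 2) → k} (hc : ∀ i, c (i + m) = c i) :
    scal (completeOrthogonalIdempotents_idem hq hX) c ∈ A := by
  obtain ⟨y, hy⟩ := diag_mem_range A hq hX hA (AlgHom.id k k) hc fun i => ⟨c i, rfl⟩
  have h : ∀ y : A ⊗[k] k, Algebra.TensorProduct.rid k k B
      (Algebra.TensorProduct.map A.val (AlgHom.id k k) y) ∈ A := by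
    intro y
    induction y with
    | zero => simp
    | add x y hx hy => rw [map_add, map_add]; exact A.add_mem hx hy
    | tmul x r => simpa using A.smul_mem x.2 r
  have hy' := h y
  change Algebra.TensorProduct.map A.val (AlgHom.id k k) y = _ at hy
  rwa [hy] at hy'

theorem scal₂_mem_range (hq : IsPrimitiveRoot q (m ^ 2)) (hX : X ^ m ^ 2 = 1)
    (hA : ((X ^ m : Bˣ) : B) ∈ A) {c : ZMod (m ^ 2) → ZMod (m ^ 2) → k}
    (h1 : ∀ i j, c (i + m) j = c i j) (h2 : ∀ i j, c i (j + m) = c i j) :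
    scal₂ (completeOrthogonalIdempotents_idem hq hX) c ∈ (tensor₂ A.val).range :=
  diag_mem_range A hq hX hA A.val
    (fun i => congrArg (scal (completeOrthogonalIdempotents_idem hq hX)) (funext (h1 i)))
    fun i => ⟨⟨_, scal_mem A hq hX hA (h2 i)⟩, rfl⟩

theorem scal₃_mem_range (hq : IsPrimitiveRoot q (m ^ 2)) (hX : X ^ m ^ 2 = 1)
    (hA : ((X ^ m : Bˣ) : B) ∈ A) {c : ZMod (m ^ 2) → ZMod (m ^ 2) → ZMod (m ^ 2) → k}
    (h1 : ∀ i j l, c (i + m) j l = c i j l) (h2 : ∀ i j l, c i (j + m) l = c i j l)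
    (h3 : ∀ i j l, c i j (l + m) = c i j l) :
    scal₃ (completeOrthogonalIdempotents_idem hq hX) c ∈ (tensor₃ A.val).range :=
  diag_mem_range A hq hX hA (tensor₂ A.val)
    (fun i => congrArg (scal₂ (completeOrthogonalIdempotents_idem hq hX))
      (funext fun j => funext (h1 i j)))
    fun i => scal₂_mem_range A hq hX hA (h2 i) (h3 i)

end Periodic

end QuasiHopfAlg

namespace QuasiHopfAlg

/-! ### The coefficients of the twisted structure are periodic -/

section Coefficients

theorem zmod_add_self {m : ℕ} (a : ℤ) :
    (a : ZMod (m ^ 2)) + (m : ZMod (m ^ 2)) = ((a + m : ℤ) : ZMod (m ^ 2)) := by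
  push_cast; rfl

variable {k : Type u} [Field k] {m : ℕ} [NeZero m] {q : k}

/-- Since `a - a' = m ⌊a/m⌋`, the exponent is bilinear in `b` and `⌊a/m⌋`. A shift of `a` by `m`
raises the floor by one, and a shift of `b` by `m` changes the exponent by a multiple of `m ^ 2`. -/
theorem twistFun_eq (hq : IsPrimitiveRoot q (m ^ 2)) (s : ℕ) (a b : ℤ) :
    twistFun m q s (a : ZMod (m ^ 2)) (b : ZMod (m ^ 2)) = q ^ (s * b * m * (a / m)) := by
  rw [twistFun_intCast hq, Int.emod_def]
  congr 1
  ring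

theorem zpow_mul_val (hq : IsPrimitiveRoot q (m ^ 2)) (n a : ℤ) :
    q ^ (n * ((a : ZMod (m ^ 2)).val : ℤ)) = q ^ (n * a) := by
  rw [mul_comm, zpow_mul, zpow_natCast, pow_val_intCast hq, ← zpow_mul, mul_comm]

theorem add_self_ediv (a : ℤ) : (a + m) / m = a / m + 1 :=
  Int.add_ediv_of_dvd_right (dvd_refl _) |>.trans <| by
    rw [Int.ediv_self (Nat.cast_ne_zero.2 (NeZero.ne m))]

/-- These ratios are the coefficients of the term of the twisted `Δ(x_i)` that comes from `x_i ⊗ 1`.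
Shifting `i` by `m` raises both floors by one, and the two resulting factors cancel. -/
theorem twistFun_shift_periodic_left (hq : IsPrimitiveRoot q (m ^ 2)) (s : ℕ) (d : ℤ)
    (i j : ZMod (m ^ 2)) :
    twistFun m q s (i + (m : ZMod (m ^ 2)) + (d : ZMod (m ^ 2))) j *
      (twistFun m q s (i + (m : ZMod (m ^ 2))) j)⁻¹ =
      twistFun m q s (i + (d : ZMod (m ^ 2))) j * (twistFun m q s i j)⁻¹ := by
  obtain ⟨a, rfl⟩ := ZMod.intCast_surjective i
  obtain ⟨b, rfl⟩ := ZMod.intCast_surjective j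
  have hq0 : q ≠ 0 := hq.ne_zero (NeZero.ne _)
  rw [add_right_comm, zmod_add_self, ← Int.cast_add, zmod_add_self]
  simp only [twistFun_eq hq, add_self_ediv, ← zpow_neg, ← zpow_add₀ hq0]
  congr 1
  ring

theorem twistFun_shift_periodic_right (hq : IsPrimitiveRoot q (m ^ 2)) (s : ℕ) (d : ℤ)
    (i j : ZMod (m ^ 2)) :
    twistFun m q s (i + (d : ZMod (m ^ 2))) (j + (m : ZMod (m ^ 2))) *
      (twistFun m q s i (j + (m : ZMod (m ^ 2))))⁻¹ =
      twistFun m q s (i + (d : ZMod (m ^ 2))) j * (twistFun m q s i j)⁻¹ := by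
  obtain ⟨a, rfl⟩ := ZMod.intCast_surjective i
  obtain ⟨b, rfl⟩ := ZMod.intCast_surjective j
  have hq0 : q ≠ 0 := hq.ne_zero (NeZero.ne _)
  rw [zmod_add_self, ← Int.cast_add]
  simp only [twistFun_eq hq, ← zpow_neg, ← zpow_add₀ hq0]
  -- A shift of `j` by `m` changes the exponent by `m ^ 2` times this integer.
  refine zpow_eq_zpow hq ⟨s * ((a + d) / m - a / m), ?_⟩
  push_cast
  ring

/-- Here the hypothesis on `s` enters the coproduct. Shifting `i` by `m` changes the exponent by `s
d m` through the twist and by `-b m` through `χ ^ (-b)`; the total `m (s d - b)` is a multiple of `m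
^ 2` because `m` divides `s d - b`. -/
theorem twistFun_char_periodic_left (hq : IsPrimitiveRoot q (m ^ 2)) {s : ℕ} {b d : ℤ}
    (hb : b ≡ s * d [ZMOD m]) (i j : ZMod (m ^ 2)) :
    twistFun m q s (i + (m : ZMod (m ^ 2))) (j + (d : ZMod (m ^ 2))) *
      q ^ (-b * ((i + (m : ZMod (m ^ 2))).val : ℤ)) *
        (twistFun m q s (i + (m : ZMod (m ^ 2))) j)⁻¹ =
      twistFun m q s i (j + (d : ZMod (m ^ 2))) * q ^ (-b * (i.val : ℤ)) *
        (twistFun m q s i j)⁻¹ := by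
  obtain ⟨a, rfl⟩ := ZMod.intCast_surjective i
  obtain ⟨c, rfl⟩ := ZMod.intCast_surjective j
  have hq0 : q ≠ 0 := hq.ne_zero (NeZero.ne _)
  obtain ⟨t, ht⟩ := hb.dvd
  rw [zmod_add_self, ← Int.cast_add]
  simp only [twistFun_eq hq, zpow_mul_val hq, add_self_ediv, ← zpow_neg, ← zpow_add₀ hq0]
  refine zpow_eq_zpow hq ⟨t, ?_⟩
  push_cast
  linear_combination (m : ℤ) * ht

theorem twistFun_char_periodic_right (hq : IsPrimitiveRoot q (m ^ 2)) (s : ℕ) (b d : ℤ)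
    (i j : ZMod (m ^ 2)) :
    twistFun m q s i (j + (m : ZMod (m ^ 2)) + (d : ZMod (m ^ 2))) * q ^ (-b * (i.val : ℤ)) *
      (twistFun m q s i (j + (m : ZMod (m ^ 2))))⁻¹ =
      twistFun m q s i (j + (d : ZMod (m ^ 2))) * q ^ (-b * (i.val : ℤ)) *
        (twistFun m q s i j)⁻¹ := by
  obtain ⟨a, rfl⟩ := ZMod.intCast_surjective i
  obtain ⟨c, rfl⟩ := ZMod.intCast_surjective j
  have hq0 : q ≠ 0 := hq.ne_zero (NeZero.ne _)
  rw [zmod_add_self, ← Int.cast_add, ← Int.cast_add]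
  simp only [twistFun_eq hq, zpow_mul_val hq, ← zpow_neg, ← zpow_add₀ hq0]
  congr 1
  ring

/-- The coefficients of the associator of `H_{J_s}`. -/
def assocFun (m : ℕ) (q : k) (s : ℕ) (i j l : ZMod (m ^ 2)) : k :=
  twistFun m q s j l * twistFun m q s i (j + l) * (twistFun m q s (i + j) l)⁻¹ *
    (twistFun m q s i j)⁻¹

/-- In `J_(23) (id ⊗ Δ)(J)` and the inverses, the terms with `b ⌊a/m⌋` cancel. What is left is the
negative of the carry of `a + b` modulo `m`, times `s c m`: the familiar 3-cocycle of the cyclic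
group of order `m`, from which all three periodicities can be read off. -/
theorem assocFun_eq (hq : IsPrimitiveRoot q (m ^ 2)) (s : ℕ) (a b c : ℤ) :
    assocFun m q s (a : ZMod (m ^ 2)) b c = q ^ (s * c * m * (a / m + b / m - (a + b) / m)) := by
  have hq0 : q ≠ 0 := hq.ne_zero (NeZero.ne _)
  rw [assocFun, ← Int.cast_add, ← Int.cast_add]
  simp only [twistFun_eq hq, ← zpow_neg, ← zpow_add₀ hq0]
  congr 1
  ring

theorem assocFun_periodic_left (hq : IsPrimitiveRoot q (m ^ 2)) (s : ℕ) (i j l : ZMod (m ^ 2)) :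
    assocFun m q s (i + (m : ZMod (m ^ 2))) j l = assocFun m q s i j l := by
  obtain ⟨a, rfl⟩ := ZMod.intCast_surjective i
  obtain ⟨b, rfl⟩ := ZMod.intCast_surjective j
  obtain ⟨c, rfl⟩ := ZMod.intCast_surjective l
  rw [zmod_add_self, assocFun_eq hq, assocFun_eq hq, add_right_comm a, add_self_ediv,
    add_self_ediv]
  congr 1
  ring

theorem assocFun_periodic_middle (hq : IsPrimitiveRoot q (m ^ 2)) (s : ℕ)
    (i j l : ZMod (m ^ 2)) :
    assocFun m q s i (j + (m : ZMod (m ^ 2))) l = assocFun m q s i j l := by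
  obtain ⟨a, rfl⟩ := ZMod.intCast_surjective i
  obtain ⟨b, rfl⟩ := ZMod.intCast_surjective j
  obtain ⟨c, rfl⟩ := ZMod.intCast_surjective l
  rw [zmod_add_self, assocFun_eq hq, assocFun_eq hq, ← add_assoc a, add_self_ediv,
    add_self_ediv]
  congr 1
  ring

theorem assocFun_periodic_right (hq : IsPrimitiveRoot q (m ^ 2)) (s : ℕ) (i j l : ZMod (m ^ 2)) :
    assocFun m q s i j (l + (m : ZMod (m ^ 2))) = assocFun m q s i j l := by
  obtain ⟨a, rfl⟩ := ZMod.intCast_surjective i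
  obtain ⟨b, rfl⟩ := ZMod.intCast_surjective j
  obtain ⟨c, rfl⟩ := ZMod.intCast_surjective l
  rw [zmod_add_self, assocFun_eq hq, assocFun_eq hq]
  refine zpow_eq_zpow hq ⟨s * (a / m + b / m - (a + b) / m), ?_⟩
  push_cast
  ring

/-- The coefficients of the element `β` of `H_{J_s}`. -/
def betaFun (m : ℕ) (q : k) (s : ℕ) (i : ZMod (m ^ 2)) : k := twistFun m q s i (-i)

/-- The exponent is quadratic in `a`: a shift by `m` multiplies the value by `q ^ (-s a m)`, which
need not be `1`. So `β` itself need not be periodic, which is the reason for normalizing the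
antipode to `β = 1`. -/
theorem betaFun_eq (hq : IsPrimitiveRoot q (m ^ 2)) (s : ℕ) (a : ℤ) :
    betaFun m q s (a : ZMod (m ^ 2)) = q ^ (-(s * a * m * (a / m))) := by
  rw [betaFun, ← Int.cast_neg, twistFun_eq hq]
  congr 1
  ring

theorem twistFun_ne_zero (hq : IsPrimitiveRoot q (m ^ 2)) (s : ℕ) (i j : ZMod (m ^ 2)) :
    twistFun m q s i j ≠ 0 :=
  pow_ne_zero _ (pow_ne_zero _ (hq.ne_zero (NeZero.ne _)))

/-- In the product `β α` the exponent becomes `-s a m (⌊a/m⌋ + ⌊-a/m⌋)`. The bracket is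
`m`-periodic, so a shift of `a` by `m` changes the exponent by a multiple of `m ^ 2`. -/
theorem betaFun_alpha_periodic (hq : IsPrimitiveRoot q (m ^ 2)) (s : ℕ) (i : ZMod (m ^ 2)) :
    betaFun m q s (i + (m : ZMod (m ^ 2))) *
      (twistFun m q s (-(i + (m : ZMod (m ^ 2)))) (i + (m : ZMod (m ^ 2))))⁻¹ =
      betaFun m q s i * (twistFun m q s (-i) i)⁻¹ := by
  obtain ⟨a, rfl⟩ := ZMod.intCast_surjective i
  have hq0 : q ≠ 0 := hq.ne_zero (NeZero.ne _)
  have h : -a / (m : ℤ) = -(a + m) / m + 1 := by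
    rw [← add_self_ediv, neg_add_rev, neg_add_cancel_comm]
  rw [zmod_add_self, ← Int.cast_neg, ← Int.cast_neg]
  simp only [twistFun_eq hq, betaFun_eq hq, h, add_self_ediv, ← zpow_neg, ← zpow_add₀ hq0]
  refine zpow_eq_zpow hq ⟨-s * (a / m + -(a + m) / m + 1), ?_⟩
  push_cast
  ring

/-- These are the coefficients of the normalized antipode of `x_i`. A shift of `i` by `m` changes
the exponent by `m (b - s d)` modulo `m ^ 2`: the linear terms of the two values of `β` differ by
`-s d m`, and `χ ^ b` contributes `b m`. The congruence makes this vanish modulo `m ^ 2`. -/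
theorem betaFun_antipode_periodic (hq : IsPrimitiveRoot q (m ^ 2)) {s : ℕ} {b d : ℤ}
    (hb : b ≡ s * d [ZMOD m]) (i : ZMod (m ^ 2)) :
    betaFun m q s (i + (m : ZMod (m ^ 2)) + (d : ZMod (m ^ 2))) *
      q ^ (b * ((i + (m : ZMod (m ^ 2)) + (d : ZMod (m ^ 2))).val : ℤ)) *
      (betaFun m q s (i + (m : ZMod (m ^ 2))))⁻¹ =
      betaFun m q s (i + (d : ZMod (m ^ 2))) * q ^ (b * ((i + (d : ZMod (m ^ 2))).val : ℤ)) *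
        (betaFun m q s i)⁻¹ := by
  obtain ⟨a, rfl⟩ := ZMod.intCast_surjective i
  have hq0 : q ≠ 0 := hq.ne_zero (NeZero.ne _)
  obtain ⟨t, ht⟩ := hb.dvd
  rw [add_right_comm, zmod_add_self, ← Int.cast_add, zmod_add_self]
  simp only [betaFun_eq hq, zpow_mul_val hq, add_self_ediv, ← zpow_neg, ← zpow_add₀ hq0]
  refine zpow_eq_zpow hq ⟨-t + s * (a / m - (a + d) / m), ?_⟩
  push_cast
  linear_combination (-m : ℤ) * ht

end Coefficients

end QuasiHopfAlg

namespace QuasiHopfAlg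

/-! ### The quasi-Hopf subalgebra `A(H,s)` of `H_{J_s}` -/

section EigenTensor

set_option maxSynthPendingDepth 10

variable {k : Type u} [Field k] [CharZero k] {N : ℕ} [NeZero N] {q : k} {B : Type v} [Ring B]
  [Algebra k B] {X : Bˣ} (hq : IsPrimitiveRoot q N) (hX : X ^ N = 1)

theorem idem_mul_eigenvector (hq : IsPrimitiveRoot q N) (hX : X ^ N = 1) {x : B} {d : ℤ}
    (hx : (X : B) * x = q ^ d • (x * X)) (i : ZMod N) :
    idem N q X (i + d).val * x = x * idem N q X i.val := by
  have he := completeOrthogonalIdempotents_idem hq hX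
  rw [idem_eq_scal (k := k) he (i + d), idem_eq_scal (k := k) he i,
    scal_mul_eigenvector hq hX hx]
  congr 2
  funext j
  simp [Pi.single_apply]

/-- Moving `x` from the right to the left of `1_(i+d)` turns it into `1_i`; the sum is reindexed by
`i ↦ i + d`. This is the shift rule in the first tensor factor, with the remaining factors kept as
coefficients. -/
theorem diag_mul_tmul_one {C : Type*} [Ring C] [Algebra k C] {x : B} {d : ℤ}
    (hx : (X : B) * x = q ^ d • (x * X)) (c : ZMod N → C) :
    diag (completeOrthogonalIdempotents_idem hq hX) c * (x ⊗ₜ[k] 1) =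
      (x ⊗ₜ[k] 1) * diag (completeOrthogonalIdempotents_idem hq hX) fun i => c (i + d) := by
  rw [diag_apply, diag_apply, Finset.sum_mul, Finset.mul_sum,
    ← Equiv.sum_comp (Equiv.addRight (d : ZMod N))]
  refine Finset.sum_congr rfl fun i _ => ?_
  rw [Equiv.coe_addRight, Algebra.TensorProduct.tmul_mul_tmul,
    Algebra.TensorProduct.tmul_mul_tmul, idem_mul_eigenvector hq hX hx, mul_one, one_mul]

theorem scal₂_mul_tmul_one {x : B} {d : ℤ} (hx : (X : B) * x = q ^ d • (x * X))
    (c : ZMod N → ZMod N → k) :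
    scal₂ (completeOrthogonalIdempotents_idem hq hX) c * (x ⊗ₜ[k] 1) =
      (x ⊗ₜ[k] 1) *
        scal₂ (completeOrthogonalIdempotents_idem hq hX) fun i j => c (i + d) j :=
  diag_mul_tmul_one hq hX hx _

theorem scal₂_mul_one_tmul {x : B} {d : ℤ} (hx : (X : B) * x = q ^ d • (x * X))
    (c : ZMod N → ZMod N → k) :
    scal₂ (completeOrthogonalIdempotents_idem hq hX) c * (1 ⊗ₜ[k] x) =
      (1 ⊗ₜ[k] x) *
        scal₂ (completeOrthogonalIdempotents_idem hq hX) fun i j => c i (j + d) := by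
  rw [scal₂_apply, scal₂_apply, Finset.sum_mul, Finset.mul_sum]
  refine Finset.sum_congr rfl fun i _ => ?_
  rw [Algebra.TensorProduct.tmul_mul_tmul, Algebra.TensorProduct.tmul_mul_tmul,
    scal_mul_eigenvector hq hX hx, mul_one, one_mul]

end EigenTensor

/-! ### The structure maps of `H_{J_s}` on the generators -/

namespace IsCyclicBosonization

set_option maxSynthPendingDepth 10

variable {k : Type u} [Field k] {H : Type v} [Ring H] [HopfAlgebra k H] {m r : ℕ} {q : k}
  {χ : Hˣ} {x : Fin r → H} {b d : Fin r → ℤ} {𝒢 : ℕ → Submodule k H} [GradedAlgebra 𝒢]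

theorem pow_eq_one (h : IsCyclicBosonization m q χ x b d 𝒢) : χ ^ m ^ 2 = 1 :=
  h.order ▸ pow_orderOf_eq_one χ

theorem eigenvector (h : IsCyclicBosonization m q χ x b d 𝒢) (i : Fin r) :
    (χ : H) * x i = q ^ d i • (x i * χ) := by
  rw [← smul_mul_assoc, ← h.conj, Units.inv_mul_cancel_right]

theorem sigma_mem (χ : Hˣ) (x : Fin r → H) :
    ((χ ^ m : Hˣ) : H) ∈ basicSubalgebra (k := k) m χ x :=
  Algebra.subset_adjoin (Set.mem_insert _ _)

theorem x_mem (χ : Hˣ) (x : Fin r → H) (i : Fin r) : x i ∈ basicSubalgebra (k := k) m χ x :=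
  Algebra.subset_adjoin (Set.mem_insert_of_mem _ ⟨i, rfl⟩)

theorem basicSubalgebra_le {χ : Hˣ} {x : Fin r → H} {S : Subalgebra k H}
    (h1 : ((χ ^ m : Hˣ) : H) ∈ S) (h2 : ∀ i, x i ∈ S) : basicSubalgebra (k := k) m χ x ≤ S := by
  refine Algebra.adjoin_le fun y hy => ?_
  rcases hy with rfl | ⟨i, rfl⟩
  · exact h1
  · exact h2 i

theorem comul_zpow (h : IsCyclicBosonization m q χ x b d 𝒢) (n : ℤ) :
    Bialgebra.comulAlgHom k H ((χ ^ n : Hˣ) : H) =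
      ((χ ^ n : Hˣ) : H) ⊗ₜ[k] ((χ ^ n : Hˣ) : H) := by
  have hl : ∀ l : ℕ, Bialgebra.comulAlgHom k H ((χ ^ l : Hˣ) : H) =
      ((χ ^ l : Hˣ) : H) ⊗ₜ[k] ((χ ^ l : Hˣ) : H) := fun l => by
    rw [Units.val_pow_eq_pow_val, map_pow, ← Algebra.TensorProduct.tmul_pow]
    exact congrArg (· ^ l) h.grouplike.comul_eq_tmul_self
  obtain ⟨l, rfl | rfl⟩ := n.eq_nat_or_neg
  · exact hl l
  · rw [zpow_neg, zpow_natCast]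
    refine left_inv_eq_right_inv (a := Bialgebra.comulAlgHom k H ((χ ^ l : Hˣ) : H)) ?_ ?_
    · rw [← map_mul, Units.inv_mul, map_one]
    · rw [hl, Algebra.TensorProduct.tmul_mul_tmul, Units.mul_inv, Algebra.TensorProduct.one_def]

theorem counit_zpow (h : IsCyclicBosonization m q χ x b d 𝒢) (n : ℤ) :
    Bialgebra.counitAlgHom k H ((χ ^ n : Hˣ) : H) = 1 := by
  have h1 : unitsMap (Bialgebra.counitAlgHom k H) χ = 1 := Units.ext h.grouplike.counit_eq_one
  have h2 := map_zpow (unitsMap (Bialgebra.counitAlgHom k H)) χ n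
  rw [h1, one_zpow] at h2
  exact congrArg Units.val h2

theorem antipode_zpow (h : IsCyclicBosonization m q χ x b d 𝒢) (n : ℤ) :
    (HopfAlgebra.antipodeAlgHomOp k H ((χ ^ n : Hˣ) : H)).unop = ((χ ^ (-n) : Hˣ) : H) := by
  have h1 := (QuasiHopf.ofHopf k H).antipode.left ((χ ^ n : Hˣ) : H)
  have h2 : (QuasiHopf.ofHopf k H).Δ ((χ ^ n : Hˣ) : H) =
    ((χ ^ n : Hˣ) : H) ⊗ₜ[k] ((χ ^ n : Hˣ) : H) := h.comul_zpow n
  have h3 : (QuasiHopf.ofHopf k H).ε ((χ ^ n : Hˣ) : H) = 1 := h.counit_zpow n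
  rw [h2, h3, leftForm_tmul, one_smul] at h1
  change (HopfAlgebra.antipodeAlgHomOp k H ((χ ^ n : Hˣ) : H)).unop * 1 * _ = 1 at h1
  rw [mul_one] at h1
  rw [zpow_neg]
  exact Units.eq_inv_of_mul_eq_one_right h1

/-- The counit axiom for a skew primitive element gives `ε(x_i) 1 = 0`; the antipode axiom then
reads `S(x_i) + χ ^ b_i x_i = 0`. -/
theorem antipode_x (h : IsCyclicBosonization m q χ x b d 𝒢) (i : Fin r) :
    (HopfAlgebra.antipodeAlgHomOp k H (x i)).unop = -(((χ ^ b i : Hˣ) : H) * x i) := by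
  have hΔ : (QuasiHopf.ofHopf k H).Δ (x i) =
      x i ⊗ₜ[k] 1 + ((χ ^ (-b i) : Hˣ) : H) ⊗ₜ[k] x i := h.comul i
  have h0 : (QuasiHopf.ofHopf k H).ε (x i) • (1 : H) = 0 := by
    have h1 := (QuasiHopf.ofHopf k H).counit_left (x i)
    have h3 : (QuasiHopf.ofHopf k H).ε ((χ ^ (-b i) : Hˣ) : H) = 1 := h.counit_zpow _
    rwa [hΔ, map_add, counitLeft_tmul, counitLeft_tmul, h3, one_smul, add_eq_right] at h1
  have h1 := (QuasiHopf.ofHopf k H).antipode.left (x i)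
  change leftForm (HopfAlgebra.antipodeAlgHomOp k H) 1 _ = _ • (1 : H) at h1
  rw [h0, hΔ, map_add, leftForm_tmul, leftForm_tmul, h.antipode_zpow, neg_neg, mul_one, mul_one,
    mul_one] at h1
  exact eq_neg_of_add_eq_zero_left h1

theorem antipode_χ (h : IsCyclicBosonization m q χ x b d 𝒢) :
    (HopfAlgebra.antipodeAlgHomOp k H (χ : H)).unop = (χ⁻¹ : Hˣ) := by
  simpa using h.antipode_zpow 1

variable [NeZero m]

theorem assocFun_ne_zero (h : IsCyclicBosonization m q χ x b d 𝒢) (s : ℕ)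
    (i j l : ZMod (m ^ 2)) : assocFun m q s i j l ≠ 0 := by
  have := twistFun_ne_zero h.primitiveRoot s
  simp [assocFun, this]

/-- `σ ^ m = 1`, so negative powers of `σ` are positive ones and lie in the algebra generated by
`σ`. -/
theorem sigma_zpow_mem (h : IsCyclicBosonization m q χ x b d 𝒢) (n : ℤ) :
    (((χ ^ m) ^ n : Hˣ) : H) ∈ basicSubalgebra (k := k) m χ x := by
  have hl : ∀ l : ℕ, (((χ ^ m) ^ l : Hˣ) : H) ∈ basicSubalgebra (k := k) m χ x := fun l => by
    rw [Units.val_pow_eq_pow_val]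
    exact Subalgebra.pow_mem _ (sigma_mem χ x) l
  have hm : (χ ^ m) ^ m = 1 := by rw [← pow_mul, ← pow_two, h.pow_eq_one]
  obtain ⟨l, rfl | rfl⟩ := n.eq_nat_or_neg
  · exact hl l
  · have : (χ ^ m) ^ (-(l : ℤ)) = (χ ^ m) ^ (l * (m - 1)) := by
      rw [zpow_neg, zpow_natCast, inv_eq_iff_mul_eq_one, ← pow_add, add_comm, ← Nat.mul_succ,
        Nat.succ_eq_add_one, Nat.sub_add_cancel (NeZero.one_le), mul_comm, pow_mul, hm, one_pow]
    rw [this]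
    exact hl _

variable [CharZero k]

/-- The twist `J_s`. -/
noncomputable def twist (h : IsCyclicBosonization m q χ x b d 𝒢) (s : ℕ) :
    Twist (QuasiHopf.ofHopf k H).toQuasiBialgebra :=
  cyclicTwist (NeZero.ne m) h.primitiveRoot h.grouplike h.pow_eq_one s

theorem idems (h : IsCyclicBosonization m q χ x b d 𝒢) :
    CompleteOrthogonalIdempotents fun i : ZMod (m ^ 2) => idem (m ^ 2) q χ i.val :=
  completeOrthogonalIdempotents_idem h.primitiveRoot h.pow_eq_one

theorem twist_J (h : IsCyclicBosonization m q χ x b d 𝒢) (s : ℕ) :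
    ((h.twist s).J : H ⊗[k] H) = scal₂ h.idems (twistFun m q s) :=
  idemSum_eq_scal₂ h.primitiveRoot h.pow_eq_one _

theorem twist_J_inv (h : IsCyclicBosonization m q χ x b d 𝒢) (s : ℕ) :
    (((h.twist s).J⁻¹ : (H ⊗[k] H)ˣ) : H ⊗[k] H) =
      scal₂ h.idems fun i j => (twistFun m q s i j)⁻¹ :=
  idemSum_eq_scal₂ h.primitiveRoot h.pow_eq_one fun i j => (twistCoeff m q i j ^ s)⁻¹

theorem twisted_Δ (h : IsCyclicBosonization m q χ x b d 𝒢) (s : ℕ) (a : H) :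
    (h.twisted s).Δ a = (h.twist s).J * Bialgebra.comulAlgHom k H a *
      (((h.twist s).J⁻¹ : (H ⊗[k] H)ˣ) : H ⊗[k] H) := rfl

theorem zpow_eq_scal (h : IsCyclicBosonization m q χ x b d 𝒢) (n : ℤ) :
    ((χ ^ n : Hˣ) : H) = scal h.idems fun i => q ^ (n * i.val) :=
  QuasiHopfAlg.zpow_eq_scal h.primitiveRoot h.pow_eq_one n

/-- `J_s` and `χ ^ n ⊗ χ ^ n` are both diagonal, hence commute: powers of `χ` stay grouplike after
the twist. -/
theorem twisted_Δ_zpow (h : IsCyclicBosonization m q χ x b d 𝒢) (s : ℕ) (n : ℤ) :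
    (h.twisted s).Δ ((χ ^ n : Hˣ) : H) = ((χ ^ n : Hˣ) : H) ⊗ₜ[k] ((χ ^ n : Hˣ) : H) := by
  rw [twisted_Δ, Units.mul_inv_eq_iff_eq_mul, comul_zpow h, h.twist_J, h.zpow_eq_scal,
    scal_tmul_scal, ← map_mul, ← map_mul, mul_comm]

/-- Conjugating by `J_s`, the factor `J_s` is moved to the right past `x_i ⊗ 1` or `1 ⊗ x_i`, which
shifts one argument by `d_i`. All diagonal factors are then collected on the right. -/
theorem twisted_Δ_x (h : IsCyclicBosonization m q χ x b d 𝒢) (s : ℕ) (i : Fin r) :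
    (h.twisted s).Δ (x i) =
      (x i ⊗ₜ[k] 1) * scal₂ h.idems (fun p j =>
        twistFun m q s (p + (d i : ZMod (m ^ 2))) j * (twistFun m q s p j)⁻¹) +
      (1 ⊗ₜ[k] x i) * scal₂ h.idems (fun p j =>
        twistFun m q s p (j + (d i : ZMod (m ^ 2))) * q ^ (-b i * (p.val : ℤ)) *
          (twistFun m q s p j)⁻¹) := by
  -- The term `χ ^ (-b_i) ⊗ x_i` is split so that its diagonal factor also stands on the right.
  have hΔ : Bialgebra.comulAlgHom k H (x i) =
      x i ⊗ₜ[k] 1 + (1 ⊗ₜ[k] x i) * (((χ ^ (-b i) : Hˣ) : H) ⊗ₜ[k] 1) := by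
    rw [Algebra.TensorProduct.tmul_mul_tmul, one_mul, mul_one]
    exact h.comul i
  rw [twisted_Δ, hΔ, h.twist_J, h.twist_J_inv, mul_add, add_mul, ← mul_assoc,
    scal₂_mul_tmul_one h.primitiveRoot h.pow_eq_one (h.eigenvector i),
    scal₂_mul_one_tmul h.primitiveRoot h.pow_eq_one (h.eigenvector i), h.zpow_eq_scal,
    scal_tmul_one, mul_assoc, mul_assoc, mul_assoc, ← map_mul, ← map_mul, ← map_mul]
  rw [← mul_assoc]
  rfl

/-- The associator of `H` is trivial, so `Φ_s` is a product of four diagonal elements and its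
coefficients are multiplied pointwise. -/
theorem twisted_Φ (h : IsCyclicBosonization m q χ x b d 𝒢) (s : ℕ) :
    ((h.twisted s).Φ : H ⊗[k] (H ⊗[k] H)) = scal₃ h.idems (assocFun m q s) := by
  have hΔ : Bialgebra.comulAlgHom k H (χ : H) = (χ : H) ⊗ₜ[k] (χ : H) :=
    h.grouplike.comul_eq_tmul_self
  change oneLeft H (H ⊗[k] H) ((h.twist s).J : H ⊗[k] H) *
    idTensor H (Bialgebra.comulAlgHom k H) ((h.twist s).J : H ⊗[k] H) * 1 *
    comulLeft H (Bialgebra.comulAlgHom k H) (((h.twist s).J⁻¹ : (H ⊗[k] H)ˣ) : H ⊗[k] H) *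
    oneRight₂ k H (((h.twist s).J⁻¹ : (H ⊗[k] H)ˣ) : H ⊗[k] H) = _
  rw [h.twist_J, h.twist_J_inv, Algebra.TensorProduct.includeRight_apply, one_tmul_scal₂,
    idTensor_scal₂ h.primitiveRoot h.pow_eq_one _ hΔ,
    comulLeft_scal₂ h.primitiveRoot h.pow_eq_one _ hΔ, oneRight₂_scal₂, mul_one, ← map_mul,
    ← map_mul, ← map_mul]
  rfl

theorem twisted_Φ_inv (h : IsCyclicBosonization m q χ x b d 𝒢) (s : ℕ) :
    (((h.twisted s).Φ⁻¹ : (H ⊗[k] (H ⊗[k] H))ˣ) : H ⊗[k] (H ⊗[k] H)) =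
      scal₃ h.idems fun i j l => (assocFun m q s i j l)⁻¹ := by
  rw [Units.inv_eq_of_mul_eq_one_right]
  rw [h.twisted_Φ, ← map_mul, ← map_one (scal₃ (k := k) h.idems)]
  congr 1
  funext i j l
  exact mul_inv_cancel₀ (h.assocFun_ne_zero s i j l)

/-- The element `β` of `H_{J_s}`, as a unit. -/
noncomputable def betaUnit (h : IsCyclicBosonization m q χ x b d 𝒢) (s : ℕ) : Hˣ where
  val := scal h.idems (betaFun m q s)
  inv := scal h.idems fun i => (betaFun m q s i)⁻¹
  val_inv := by
    rw [← map_mul, ← map_one (scal (k := k) h.idems)]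
    congr 1
    funext i
    exact mul_inv_cancel₀ (twistFun_ne_zero h.primitiveRoot s _ _)
  inv_val := by
    rw [← map_mul, ← map_one (scal (k := k) h.idems)]
    congr 1
    funext i
    exact inv_mul_cancel₀ (twistFun_ne_zero h.primitiveRoot s _ _)

theorem twisted_β (h : IsCyclicBosonization m q χ x b d 𝒢) (s : ℕ) :
    (h.twisted s).antipode.β = h.betaUnit s := by
  change rightForm (HopfAlgebra.antipodeAlgHomOp k H) 1 ((h.twist s).J : H ⊗[k] H) = _
  rw [h.twist_J, rightForm_scal₂ h.primitiveRoot h.pow_eq_one _ h.antipode_χ]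
  rfl

theorem twisted_α (h : IsCyclicBosonization m q χ x b d 𝒢) (s : ℕ) :
    (h.twisted s).antipode.α = scal h.idems fun i => (twistFun m q s (-i) i)⁻¹ := by
  change leftForm (HopfAlgebra.antipodeAlgHomOp k H) 1
    (((h.twist s).J⁻¹ : (H ⊗[k] H)ˣ) : H ⊗[k] H) = _
  rw [h.twist_J_inv, leftForm_scal₂ h.primitiveRoot h.pow_eq_one _ h.antipode_χ]

/-- The antipode of `H_{J_s}`, normalized to `β = 1`. -/
noncomputable def antipode (h : IsCyclicBosonization m q χ x b d 𝒢) (s : ℕ) :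
    Antipode (h.twisted s).toQuasiBialgebra :=
  (h.twisted s).antipode.conj (h.betaUnit s)

theorem antipode_S (h : IsCyclicBosonization m q χ x b d 𝒢) (s : ℕ) (a : H) :
    ((h.antipode s).S a).unop = h.betaUnit s * (HopfAlgebra.antipodeAlgHomOp k H a).unop *
      ((h.betaUnit s)⁻¹ : Hˣ) := conjAntipode_apply _ _ a

theorem antipode_β (h : IsCyclicBosonization m q χ x b d 𝒢) (s : ℕ) :
    (h.antipode s).β = 1 := by
  change (h.twisted s).antipode.β * _ = 1
  rw [h.twisted_β, Units.mul_inv]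

theorem antipode_α (h : IsCyclicBosonization m q χ x b d 𝒢) (s : ℕ) :
    (h.antipode s).α =
      scal h.idems fun i => betaFun m q s i * (twistFun m q s (-i) i)⁻¹ := by
  change _ * (h.twisted s).antipode.α = _
  rw [h.twisted_α]
  exact (map_mul (scal h.idems) _ _).symm

theorem antipode_S_zpow (h : IsCyclicBosonization m q χ x b d 𝒢) (s : ℕ) (n : ℤ) :
    ((h.antipode s).S ((χ ^ n : Hˣ) : H)).unop = ((χ ^ (-n) : Hˣ) : H) := by
  rw [antipode_S, h.antipode_zpow, Units.mul_inv_eq_iff_eq_mul, h.zpow_eq_scal]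
  exact scal_mul_comm h.idems _ _

/-- Conjugation by `β` is evaluated by moving `β` and `χ ^ b_i` past `x_i`, which shifts their
arguments by `d_i`. -/
theorem antipode_S_x (h : IsCyclicBosonization m q χ x b d 𝒢) (s : ℕ) (i : Fin r) :
    ((h.antipode s).S (x i)).unop = -(x i * scal h.idems fun j =>
      betaFun m q s (j + (d i : ZMod (m ^ 2))) *
        q ^ (b i * ((j + (d i : ZMod (m ^ 2))).val : ℤ)) * (betaFun m q s j)⁻¹) := by
  rw [antipode_S, h.antipode_x, mul_neg, neg_mul, h.zpow_eq_scal]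
  change -(scal h.idems (betaFun m q s) * _ * scal h.idems fun i => (betaFun m q s i)⁻¹) = _
  rw [← mul_assoc, ← map_mul,
    scal_mul_eigenvector h.primitiveRoot h.pow_eq_one (h.eigenvector i), mul_assoc, ← map_mul]
  rfl

/-- The elements whose coproduct lies in `A ⊗ A` form a subalgebra, so the generators suffice: `σ`
is grouplike, and the coefficients for `x_i` are periodic in both variables. -/
theorem twisted_Δ_mem (h : IsCyclicBosonization m q χ x b d 𝒢) {s : ℕ}
    (hs : ∀ i, b i ≡ s * d i [ZMOD m]) {a : H} (ha : a ∈ basicSubalgebra (k := k) m χ x) :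
    (h.twisted s).Δ a ∈ (tensor₂ (basicSubalgebra (k := k) m χ x).val).range := by
  have hle : basicSubalgebra (k := k) m χ x ≤
      (tensor₂ (basicSubalgebra (k := k) m χ x).val).range.comap (h.twisted s).Δ := by
    refine basicSubalgebra_le ?_ fun i => ?_
    · have h1 := h.twisted_Δ_zpow s m
      rw [zpow_natCast] at h1
      refine Subalgebra.mem_comap _ _ _ |>.2 ?_
      rw [h1]
      exact ⟨⟨_, sigma_mem χ x⟩ ⊗ₜ ⟨_, sigma_mem χ x⟩, rfl⟩
    · refine Subalgebra.mem_comap _ _ _ |>.2 ?_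
      rw [h.twisted_Δ_x]
      refine Subalgebra.add_mem _ (Subalgebra.mul_mem _ ⟨⟨_, x_mem χ x i⟩ ⊗ₜ 1, rfl⟩ ?_)
        (Subalgebra.mul_mem _ ⟨1 ⊗ₜ ⟨_, x_mem χ x i⟩, rfl⟩ ?_)
      · exact scal₂_mem_range _ h.primitiveRoot h.pow_eq_one (sigma_mem χ x)
          (twistFun_shift_periodic_left h.primitiveRoot s (d i))
          (twistFun_shift_periodic_right h.primitiveRoot s (d i))
      · exact scal₂_mem_range _ h.primitiveRoot h.pow_eq_one (sigma_mem χ x)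
          (twistFun_char_periodic_left h.primitiveRoot (hs i))
          (twistFun_char_periodic_right h.primitiveRoot s (b i) (d i))
  exact hle ha

/-- As `S` reverses products, the test on generators uses the preimage of `A.op`, again a
subalgebra. -/
theorem antipode_S_mem (h : IsCyclicBosonization m q χ x b d 𝒢) {s : ℕ}
    (hs : ∀ i, b i ≡ s * d i [ZMOD m]) {a : H} (ha : a ∈ basicSubalgebra (k := k) m χ x) :
    ((h.antipode s).S a).unop ∈ basicSubalgebra (k := k) m χ x := by
  have hle : basicSubalgebra (k := k) m χ x ≤
      (basicSubalgebra (k := k) m χ x).op.comap (h.antipode s).S := by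
    refine basicSubalgebra_le ?_ fun i => ?_
    · change ((h.antipode s).S _).unop ∈ basicSubalgebra (k := k) m χ x
      have h1 := h.antipode_S_zpow s m
      rw [zpow_natCast] at h1
      rw [h1]
      have h2 := h.sigma_zpow_mem (-1)
      rwa [zpow_neg_one, ← zpow_natCast, ← zpow_neg] at h2
    · change ((h.antipode s).S _).unop ∈ basicSubalgebra (k := k) m χ x
      rw [h.antipode_S_x]
      exact Subalgebra.neg_mem _ (Subalgebra.mul_mem _ (x_mem χ x i)
        (scal_mem _ h.primitiveRoot h.pow_eq_one (sigma_mem χ x)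
          (betaFun_antipode_periodic h.primitiveRoot (hs i))))
  exact hle ha

/-- `A(H,s)` is a quasi-Hopf subalgebra of `H_{J_s}`, with the antipode normalized to `β = 1`. -/
theorem exists_quasiHopf (h : IsCyclicBosonization m q χ x b d 𝒢) {s : ℕ}
    (hs : ∀ i, b i ≡ s * d i [ZMOD m]) :
    ∃ Q : QuasiHopf k (basicSubalgebra (k := k) m χ x),
      IsQuasiBialgebraHom Q.toQuasiBialgebra (h.twisted s).toQuasiBialgebra
        (basicSubalgebra (k := k) m χ x).val ∧
      (∀ a, ((Q.antipode.S a).unop : H) = ((h.antipode s).S a).unop) ∧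
      (Q.antipode.α : H) = (h.antipode s).α ∧ (Q.antipode.β : H) = (h.antipode s).β := by
  have hι : Function.Injective (basicSubalgebra (k := k) m χ x).val := Subtype.val_injective
  obtain ⟨Δ, hΔ⟩ := exists_algHom_lift (tensor₂ (basicSubalgebra (k := k) m χ x).val)
    (tensor₂_injective hι) ((h.twisted s).Δ.comp (basicSubalgebra (k := k) m χ x).val)
    fun a => h.twisted_Δ_mem hs a.2
  have hΦ₁ : ((h.twisted s).Φ : H ⊗[k] (H ⊗[k] H)) ∈
      (tensor₃ (basicSubalgebra (k := k) m χ x).val).range := by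
    rw [h.twisted_Φ]
    exact scal₃_mem_range _ h.primitiveRoot h.pow_eq_one (sigma_mem χ x)
      (assocFun_periodic_left h.primitiveRoot s) (assocFun_periodic_middle h.primitiveRoot s)
      (assocFun_periodic_right h.primitiveRoot s)
  -- Periodicity of the inverse coefficients is needed as well, so that `Φ` is a unit of `A ⊗ A ⊗ A`
  -- and not just an element.
  have hΦ₂ : (((h.twisted s).Φ⁻¹ : (H ⊗[k] (H ⊗[k] H))ˣ) : H ⊗[k] (H ⊗[k] H)) ∈
      (tensor₃ (basicSubalgebra (k := k) m χ x).val).range := by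
    rw [h.twisted_Φ_inv]
    exact scal₃_mem_range _ h.primitiveRoot h.pow_eq_one (sigma_mem χ x)
      (fun i j l => congrArg _ (assocFun_periodic_left h.primitiveRoot s i j l))
      (fun i j l => congrArg _ (assocFun_periodic_middle h.primitiveRoot s i j l))
      (fun i j l => congrArg _ (assocFun_periodic_right h.primitiveRoot s i j l))
  obtain ⟨Φ, hΦ⟩ := exists_unit_lift _ (tensor₃_injective hι) _ hΦ₁ hΦ₂
  obtain ⟨S, hS⟩ := exists_algHom_lift (AlgHom.op (basicSubalgebra (k := k) m χ x).val)
    (fun a a' haa' => MulOpposite.unop_injective (hι (MulOpposite.op_injective haa')))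
    ((h.antipode s).S.comp (basicSubalgebra (k := k) m χ x).val)
    fun a => ⟨MulOpposite.op ⟨_, h.antipode_S_mem hs a.2⟩, rfl⟩
  have hS' : ∀ a, ((S a).unop : H) = ((h.antipode s).S a).unop := fun a =>
    congrArg MulOpposite.unop (hS a)
  have hα : (h.antipode s).α ∈ basicSubalgebra (k := k) m χ x := by
    rw [h.antipode_α]
    exact scal_mem _ h.primitiveRoot h.pow_eq_one (sigma_mem χ x)
      (betaFun_alpha_periodic h.primitiveRoot s)
  have hβ : (h.antipode s).β ∈ basicSubalgebra (k := k) m χ x := by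
    rw [h.antipode_β]
    exact one_mem _
  have hhom := (h.twisted s).isQuasiBialgebraHom_pullback _ hι Δ (fun a => (hΔ a).symm) Φ hΦ
  exact ⟨⟨_, (h.antipode s).pullback hι hhom S hS' ⟨_, hα⟩ ⟨_, hβ⟩ rfl rfl⟩, hhom, hS', rfl, rfl⟩

end IsCyclicBosonization

end QuasiHopfAlg

namespace QuasiHopfAlg

/-! ### Crossed systems from grouplike sections -/

section Sections

set_option maxSynthPendingDepth 10

variable {k : Type u} [Field k] {B : Type v} [Ring B] [Algebra k B]

namespace QuasiBialgebra

variable {R : QuasiBialgebra k B} {a b : Bˣ}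

theorem grouplike_mul (ha : R.Δ a = (a : B) ⊗ₜ[k] (a : B)) (hb : R.Δ b = (b : B) ⊗ₜ[k] (b : B)) :
    R.Δ (a * b : Bˣ) = ((a * b : Bˣ) : B) ⊗ₜ[k] ((a * b : Bˣ) : B) := by
  rw [Units.val_mul, map_mul, ha, hb, Algebra.TensorProduct.tmul_mul_tmul]

theorem grouplike_inv (ha : R.Δ a = (a : B) ⊗ₜ[k] (a : B)) :
    R.Δ (a⁻¹ : Bˣ) = ((a⁻¹ : Bˣ) : B) ⊗ₜ[k] ((a⁻¹ : Bˣ) : B) := by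
  refine left_inv_eq_right_inv (a := R.Δ a) ?_ ?_
  · rw [← map_mul, Units.inv_mul, map_one]
  · rw [ha, Algebra.TensorProduct.tmul_mul_tmul, Units.mul_inv, Algebra.TensorProduct.one_def]

theorem counit_inv (ha : R.ε a = 1) : R.ε (a⁻¹ : Bˣ) = 1 := by
  have h : R.ε a * R.ε (a⁻¹ : Bˣ) = 1 := by rw [← map_mul, Units.mul_inv, map_one]
  rwa [ha, one_mul] at h

theorem comul_conjHom (ha : R.Δ a = (a : B) ⊗ₜ[k] (a : B)) (y : B) :
    R.Δ (conjHom (k := k) a y) = tensor₂ (conjHom a) (R.Δ y) := by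
  rw [conjHom_apply, map_mul, map_mul, grouplike_inv ha, ha]
  generalize R.Δ y = p
  induction p with
  | zero => simp
  | add x y hx hy => simp only [map_add, mul_add, add_mul, hx, hy]
  | tmul x y => simp

end QuasiBialgebra

/-- Grouplike elements `e_σ` of a quasi-bialgebra that normalize a subalgebra, commute with the
associator, and are multiplicative modulo the subalgebra. -/
structure GrouplikeSection (G : Type w) [Group G] (R : QuasiBialgebra k B) (A : Subalgebra k B)
    where
  e : G → Bˣ
  one : e 1 = 1
  conj_mem : ∀ σ, ∀ a ∈ A, (e σ : B) * a * ((e σ)⁻¹ : Bˣ) ∈ A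
  inv_conj_mem : ∀ σ, ∀ a ∈ A, ((e σ)⁻¹ : Bˣ) * a * (e σ : B) ∈ A
  cocycle_mem : ∀ σ τ, ((e σ * e τ * (e (σ * τ))⁻¹ : Bˣ) : B) ∈ A
  inv_cocycle_mem : ∀ σ τ, (((e σ * e τ * (e (σ * τ))⁻¹)⁻¹ : Bˣ) : B) ∈ A
  comul : ∀ σ, R.Δ (e σ) = (e σ : B) ⊗ₜ[k] (e σ : B)
  counit : ∀ σ, R.ε (e σ) = 1
  associator : ∀ σ, tensor₃ (conjHom (k := k) (e σ)) (R.Φ : B ⊗[k] (B ⊗[k] B)) = R.Φ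

namespace GrouplikeSection

variable {G : Type w} [Group G] {R : QuasiBialgebra k B} {A : Subalgebra k B}

/-- Conjugation by `e_σ`. -/
def act (E : GrouplikeSection G R A) (σ : G) : A ≃ₐ[k] A :=
  AlgEquiv.ofAlgHom
    (((conjHom (E.e σ)).comp A.val).codRestrict A fun a => E.conj_mem σ a a.2)
    (((conjHom (E.e σ)⁻¹).comp A.val).codRestrict A fun a => by
      have h := E.inv_conj_mem σ a a.2
      simpa using h)
    (AlgHom.ext fun a => Subtype.ext <| by
      change (E.e σ : B) * (((E.e σ)⁻¹ : Bˣ) * (a : B) * (((E.e σ)⁻¹)⁻¹ : Bˣ)) *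
        ((E.e σ)⁻¹ : Bˣ) = a
      simp [mul_assoc])
    (AlgHom.ext fun a => Subtype.ext <| by
      change ((E.e σ)⁻¹ : Bˣ) * ((E.e σ : B) * (a : B) * ((E.e σ)⁻¹ : Bˣ)) *
        (((E.e σ)⁻¹)⁻¹ : Bˣ) = (a : B)
      simp [mul_assoc])

@[simp] theorem coe_act (E : GrouplikeSection G R A) (σ : G) (a : A) :
    (E.act σ a : B) = (E.e σ : B) * a * ((E.e σ)⁻¹ : Bˣ) := rfl

/-- The cocycle `e_σ e_τ e_(στ)⁻¹`. -/
def θ (E : GrouplikeSection G R A) (σ τ : G) : Aˣ where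
  val := ⟨_, E.cocycle_mem σ τ⟩
  inv := ⟨_, E.inv_cocycle_mem σ τ⟩
  val_inv := Subtype.ext (Units.mul_inv (E.e σ * E.e τ * (E.e (σ * τ))⁻¹))
  inv_val := Subtype.ext (Units.inv_mul (E.e σ * E.e τ * (E.e (σ * τ))⁻¹))

@[simp] theorem coe_θ (E : GrouplikeSection G R A) (σ τ : G) :
    ((E.θ σ τ : A) : B) = ((E.e σ * E.e τ * (E.e (σ * τ))⁻¹ : Bˣ) : B) := rfl

theorem tensor₂_act (E : GrouplikeSection G R A) (σ : G) (z : A ⊗[k] A) :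
    tensor₂ A.val (tensor₂ (E.act σ : A →ₐ[k] A) z) =
      tensor₂ (conjHom (E.e σ)) (tensor₂ A.val z) := by
  induction z with
  | zero => simp
  | add x y hx hy => simp only [map_add, hx, hy]
  | tmul x y => simp

theorem tensor₃_act (E : GrouplikeSection G R A) (σ : G) (z : A ⊗[k] (A ⊗[k] A)) :
    tensor₃ A.val (tensor₃ (E.act σ : A →ₐ[k] A) z) =
      tensor₃ (conjHom (E.e σ)) (tensor₃ A.val z) := by
  induction z with
  | zero => simp
  | add x y hx hy => simp only [map_add, hx, hy]
  | tmul x z =>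
    rw [Algebra.TensorProduct.map_tmul, Algebra.TensorProduct.map_tmul,
      Algebra.TensorProduct.map_tmul, Algebra.TensorProduct.map_tmul, tensor₂_act]
    rfl

variable {Q : QuasiBialgebra k A}

/-- Conjugation by a grouplike element respects coproduct and counit, and it fixes `Φ` by
assumption. So it is an automorphism with trivial `J`; the identities are checked inside `B`. -/
theorem isTwistedHom (E : GrouplikeSection G R A) (hQ : IsQuasiBialgebraHom Q R A.val) (σ : G) :
    IsTwistedHom Q Q (E.act σ : A →ₐ[k] A) 1 where
  associator := by
    rw [Units.val_one, map_one, map_one, map_one, map_one, mul_one, mul_one, one_mul, one_mul]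
    apply tensor₃_injective (f := A.val) Subtype.val_injective
    rw [tensor₃_act, hQ.associator, E.associator]
  counit_left := by rw [Units.val_one, map_one]
  counit_right := by rw [Units.val_one, map_one]
  counit a := by
    rw [← hQ.counit, ← hQ.counit]
    change R.ε ((E.e σ : B) * a * ((E.e σ)⁻¹ : Bˣ)) = R.ε a
    rw [map_mul, map_mul, E.counit, QuasiBialgebra.counit_inv (E.counit σ), one_mul, mul_one]
  comul a := by
    rw [Units.val_one, mul_one, one_mul]
    apply tensor₂_injective (f := A.val) Subtype.val_injective
    rw [tensor₂_act, ← hQ.comul, ← hQ.comul]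
    exact QuasiBialgebra.comul_conjHom (E.comul σ) (a : B)

/-- The crossed system of a grouplike section. -/
noncomputable def crossedSystem (E : GrouplikeSection G R A)
    (hQ : IsQuasiBialgebraHom Q R A.val) : CrossedSystem G Q where
  act := E.act
  J _ := 1
  θ := E.θ
  twisted := E.isTwistedHom hQ
  counit_θ σ τ := by
    rw [← hQ.counit]
    change R.ε ((E.e σ * E.e τ * (E.e (σ * τ))⁻¹ : Bˣ) : B) = 1
    rw [Units.val_mul, Units.val_mul, map_mul, map_mul, E.counit, E.counit,
      QuasiBialgebra.counit_inv (E.counit _), one_mul, one_mul]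
  act_one := AlgEquiv.ext fun a => Subtype.ext <| by simp [E.one]
  J_one := rfl
  θ_act σ τ a := Subtype.ext <| by simp [mul_assoc]
  -- Both sides are `e_σ e_τ e_ρ e_(στρ)⁻¹`.
  θ_assoc σ τ ρ := Subtype.ext <| by simp [mul_assoc]
  θ_one_left σ := Units.ext <| Subtype.ext <| by simp [E.one]
  θ_one_right σ := Units.ext <| Subtype.ext <| by simp [E.one]
  comul_θ σ τ := by
    rw [Units.val_one, map_one, mul_one, mul_one, one_mul]
    apply tensor₂_injective (f := A.val) Subtype.val_injective
    rw [← hQ.comul]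
    exact QuasiBialgebra.grouplike_mul (QuasiBialgebra.grouplike_mul (E.comul σ) (E.comul τ))
      (QuasiBialgebra.grouplike_inv (E.comul _))

/-- The algebra map `a # σ ↦ a e_σ`. -/
noncomputable def toAlgebra (E : GrouplikeSection G R A) (hQ : IsQuasiBialgebraHom Q R A.val) :
    (E.crossedSystem hQ).Product →ₐ[k] B :=
  (E.crossedSystem hQ).liftHom A.val (fun σ => (E.e σ : B))
    (by rw [E.one, Units.val_one])
    (fun σ a => by simp [crossedSystem])
    (fun σ τ => by simp [crossedSystem])

@[simp] theorem toAlgebra_incl (E : GrouplikeSection G R A)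
    (hQ : IsQuasiBialgebraHom Q R A.val) (σ : G) (a : A) :
    E.toAlgebra hQ ((E.crossedSystem hQ).incl σ a) = a * E.e σ :=
  CrossedSystem.liftHom_incl ..

theorem tensor₂_toAlgebra_incl₂ (E : GrouplikeSection G R A)
    (hQ : IsQuasiBialgebraHom Q R A.val) (σ : G) (z : A ⊗[k] A) :
    tensor₂ (E.toAlgebra hQ) ((E.crossedSystem hQ).incl₂ σ z) =
      tensor₂ A.val z * ((E.e σ : B) ⊗ₜ[k] (E.e σ : B)) := by
  induction z with
  | zero => simp
  | add x y hx hy => simp only [map_add, add_mul, hx, hy]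
  | tmul x y => simp

theorem tensor₃_toAlgebra (E : GrouplikeSection G R A)
    (hQ : IsQuasiBialgebraHom Q R A.val) (z : A ⊗[k] (A ⊗[k] A)) :
    tensor₃ (E.toAlgebra hQ) (tensor₃ (E.crossedSystem hQ).inclOne z) = tensor₃ A.val z := by
  induction z with
  | zero => simp
  | add x y hx hy => simp only [map_add, hx, hy]
  | tmul x z =>
    induction z with
    | zero => simp
    | add x y hx hy => simp only [map_add, TensorProduct.tmul_add, hx, hy]
    | tmul y z => simp [CrossedSystem.inclOne_apply, E.one]

/-- As `J = 1`, the coproduct of `a # σ` maps to `Δ(a) (e_σ ⊗ e_σ)`, which is the coproduct of `a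
e_σ` since `e_σ` is grouplike. -/
theorem isQuasiBialgebraHom_toAlgebra (E : GrouplikeSection G R A)
    (hQ : IsQuasiBialgebraHom Q R A.val) :
    IsQuasiBialgebraHom (E.crossedSystem hQ).product R (E.toAlgebra hQ) where
  comul z := by
    induction z using (E.crossedSystem hQ).induction with
    | h0 => simp only [map_zero]
    | hadd x y hx hy => simp only [map_add, hx, hy]
    | hs σ x =>
      change _ = tensor₂ (E.toAlgebra hQ) ((E.crossedSystem hQ).comulHom _)
      rw [toAlgebra_incl, map_mul, E.comul, CrossedSystem.comulHom_incl, tensor₂_toAlgebra_incl₂]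
      change R.Δ (A.val x) * _ = tensor₂ A.val (Q.Δ x * 1) * _
      rw [hQ.comul, mul_one]
  counit z := by
    induction z using (E.crossedSystem hQ).induction with
    | h0 => simp only [map_zero]
    | hadd x y hx hy => simp only [map_add, hx, hy]
    | hs σ x =>
      change _ = (E.crossedSystem hQ).counitHom _
      rw [toAlgebra_incl, map_mul, E.counit, CrossedSystem.counitHom_incl, mul_one]
      exact hQ.counit x
  associator := (E.tensor₃_toAlgebra hQ _).trans hQ.associator

/-- The algebra map `a # σ ↦ a e_σ` is injective as soon as some endomorphism of `B` fixes `A` and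
scales the `e_σ` by distinct factors. -/
theorem toAlgebra_injective (E : GrouplikeSection G R A) (hQ : IsQuasiBialgebraHom Q R A.val)
    (f : B →ₐ[k] B) (hf : ∀ a ∈ A, f a = a) (c : G → k) (hc : Function.Injective c)
    (hfe : ∀ σ, f (E.e σ) = c σ • (E.e σ : B)) : Function.Injective (E.toAlgebra hQ) := by
  have hsum : ∀ z : (E.crossedSystem hQ).Product,
      E.toAlgebra hQ z = Finsupp.sum (α := G) (M := A) z fun σ a => (a : B) * E.e σ := fun z => by
    induction z using (E.crossedSystem hQ).induction with
    | h0 => rw [map_zero]; exact (Finsupp.sum_zero_index).symm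
    | hadd x y hx hy =>
      rw [map_add, hx, hy]
      refine (Finsupp.sum_add_index' (h := fun (σ : G) (a : A) => (a : B) * E.e σ)
        (fun σ => ?_) fun σ a b => ?_).symm
      · exact zero_mul _
      · exact add_mul (a : B) b _
    | hs σ x =>
      rw [toAlgebra_incl]
      refine (Finsupp.sum_single_index (h := fun (σ : G) (a : A) => (a : B) * E.e σ) ?_).symm
      exact zero_mul _
  have key : ∀ z : G →₀ A, (z.sum fun σ a => (a : B) * E.e σ) = 0 → z = 0 := fun z hz => by
    by_contra hz0
    obtain ⟨σ, hσ⟩ := Finsupp.ne_iff.1 hz0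
    -- The nonzero summands `z_τ e_τ` are eigenvectors of `f` for the distinct eigenvalues `c τ`;
    -- they are nonzero because `e_τ` is invertible.
    have hli : LinearIndependent k fun τ : z.support => ((z τ : A) : B) * E.e τ :=
      Module.End.eigenvectors_linearIndependent' f.toLinearMap (fun τ : z.support => c τ)
        (hc.comp Subtype.val_injective) _ fun τ => by
          refine ⟨Module.End.mem_eigenspace_iff.2 ?_, fun h0 => ?_⟩
          · change f _ = _
            rw [map_mul, hf _ (SetLike.coe_mem _), hfe, mul_smul_comm]
          · rw [Units.mul_left_eq_zero] at h0
            exact Finsupp.mem_support_iff.1 τ.2 (Subtype.ext h0)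
    -- The vanishing sum is a linear relation with all coefficients `1`, impossible for a nonempty
    -- support.
    have h1 := Fintype.linearIndependent_iff.1 hli (fun _ => 1) (by
      simp only [one_smul]
      rw [← hz, Finsupp.sum]
      exact Finset.sum_coe_sort z.support fun τ => ((z τ : A) : B) * E.e τ)
        ⟨σ, Finsupp.mem_support_iff.2 hσ⟩
    exact one_ne_zero h1
  exact (injective_iff_map_eq_zero _).2 fun z hz => key z ((hsum z).symm.trans hz)

theorem toAlgebra_surjective (E : GrouplikeSection G R A) (hQ : IsQuasiBialgebraHom Q R A.val)
    {s : Set B} (hs : Algebra.adjoin k s = ⊤)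
    (h : ∀ y ∈ s, y ∈ A ∨ ∃ σ, y = E.e σ) : Function.Surjective (E.toAlgebra hQ) := by
  rw [← AlgHom.range_eq_top, eq_top_iff, ← hs]
  refine Algebra.adjoin_le fun y hy => ?_
  rcases h y hy with hy | ⟨σ, rfl⟩
  · exact ⟨(E.crossedSystem hQ).incl 1 ⟨y, hy⟩, by simp [E.one]⟩
  · exact ⟨(E.crossedSystem hQ).incl σ 1, by simp⟩

end GrouplikeSection

/-- The antipode is transported along the bijection `a # g ↦ a e_g`. Its form comes from `S(a e_g) =
e_g⁻¹ S(a) = (e_g⁻¹ e_(g⁻¹)⁻¹) (e_(g⁻¹) S(a) e_(g⁻¹)⁻¹) e_(g⁻¹)`. Taking `G` in `Type` keeps `A # G`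
in the universe of `B`. -/
theorem GrouplikeSection.exists_antipode {G : Type} [Group G] {R : QuasiBialgebra k B}
    {A : Subalgebra k B} (E : GrouplikeSection G R A) {Q : QuasiHopf k A}
    (hQ : IsQuasiBialgebraHom Q.toQuasiBialgebra R A.val) (W : Antipode R)
    (hS : ∀ a, ((Q.antipode.S a).unop : B) = (W.S a).unop) (hα : (Q.antipode.α : B) = W.α)
    (hβ : (Q.antipode.β : B) = W.β) (hW : ∀ σ, (W.S (E.e σ)).unop = ((E.e σ)⁻¹ : Bˣ))
    (hb : Function.Bijective (E.toAlgebra hQ)) :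
    ∃ (υ : G → Aˣ) (T : Antipode (E.crossedSystem hQ).product),
      (∀ g a, (T.S ((E.crossedSystem hQ).incl g a)).unop =
        (E.crossedSystem hQ).incl g⁻¹
          (υ g * (E.crossedSystem hQ).act g⁻¹ (Q.antipode.S a).unop)) ∧
      T.α = (E.crossedSystem hQ).incl 1 Q.antipode.α ∧
      T.β = (E.crossedSystem hQ).incl 1 Q.antipode.β ∧
      (∀ z, E.toAlgebra hQ (T.S z).unop = (W.S (E.toAlgebra hQ z)).unop) ∧
      E.toAlgebra hQ T.α = W.α ∧ E.toAlgebra hQ T.β = W.β := by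
  let e := AlgEquiv.ofBijective (E.toAlgebra hQ) hb
  have hα' : E.toAlgebra hQ ((E.crossedSystem hQ).incl 1 Q.antipode.α) = W.α := by
    simp [E.one, hα]
  have hβ' : E.toAlgebra hQ ((E.crossedSystem hQ).incl 1 Q.antipode.β) = W.β := by
    simp [E.one, hβ]
  have hS' : ∀ z, E.toAlgebra hQ
      (((AlgHom.op (e.symm : B →ₐ[k] _)).comp (W.S.comp (E.toAlgebra hQ))) z).unop =
        (W.S (E.toAlgebra hQ z)).unop := fun z => e.apply_symm_apply _
  -- The factor `e_g⁻¹ e_(g⁻¹)⁻¹` is the inverse of `θ g⁻¹ g`, because `e_1 = 1`.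
  refine ⟨fun g => (E.θ g⁻¹ g)⁻¹, W.pullback hb.1 (E.isQuasiBialgebraHom_toAlgebra hQ) _ hS'
    _ _ hα' hβ', fun g a => hb.1 ?_, rfl, rfl, hS', hα', hβ'⟩
  refine (hS' _).trans ?_
  have h1 : (((E.θ g⁻¹ g)⁻¹ : Aˣ) : B) = ((E.e g⁻¹ * E.e g * (E.e (g⁻¹ * g))⁻¹)⁻¹ : Bˣ) := rfl
  have h2 : ((E.crossedSystem hQ).act g⁻¹ (Q.antipode.S a).unop : B) =
    (E.e g⁻¹ : B) * (Q.antipode.S a).unop * ((E.e g⁻¹)⁻¹ : Bˣ) := rfl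
  rw [toAlgebra_incl, toAlgebra_incl, map_mul, MulOpposite.unop_mul, hW, Subalgebra.coe_mul, h1,
    h2, hS]
  simp [E.one, mul_assoc]


end Sections

end QuasiHopfAlg

namespace QuasiHopfAlg

/-! ### Inverse homomorphisms and invariance of diagonal elements -/

section

set_option maxSynthPendingDepth 10

/-- The inverse of a bijective homomorphism of quasi-bialgebras is a homomorphism. -/
theorem IsQuasiBialgebraHom.symm {k : Type u} [Field k] {A : Type v} {B : Type w} [Ring A]
    [Algebra k A] [Ring B] [Algebra k B] {Q : QuasiBialgebra k A} {R : QuasiBialgebra k B}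
    {e : A ≃ₐ[k] B} (h : IsQuasiBialgebraHom Q R e.toAlgHom) :
    IsQuasiBialgebraHom R Q e.symm.toAlgHom where
  comul b := by
    have h1 := h.comul (e.symm b)
    change R.Δ (e (e.symm b)) = _ at h1
    rw [e.apply_symm_apply] at h1
    rw [h1]
    change Q.Δ (e.symm b) = _
    generalize Q.Δ (e.symm b) = z
    induction z with
    | zero => simp
    | add x y hx hy => rw [map_add, map_add, ← hx, ← hy]
    | tmul x y => simp
  counit b := by
    rw [← h.counit]
    exact congrArg R.ε (e.apply_symm_apply b)
  associator := by
    rw [← h.associator]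
    generalize (Q.Φ : A ⊗[k] (A ⊗[k] A)) = z
    induction z with
    | zero => simp
    | add x y hx hy => simp only [map_add, hx, hy]
    | tmul x z =>
      induction z with
      | zero => simp
      | add x y hx hy => simp only [TensorProduct.tmul_add, map_add, hx, hy]
      | tmul x y => simp

theorem tensor₃_scal₃ {k : Type u} [Field k] {B : Type v} [Ring B] [Algebra k B] {ι : Type*}
    [Fintype ι] {e : ι → B} (he : CompleteOrthogonalIdempotents e) (f : B →ₐ[k] B)
    (hf : ∀ i, f (e i) = e i) (c : ι → ι → ι → k) :
    tensor₃ f (scal₃ he c) = scal₃ he c := by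
  simp [scal₃_apply, scal₂_apply, scal_apply, hf]

end

/-! ### The powers of `χ` as a grouplike section, and the isomorphism with the crossed product -/

namespace IsCyclicBosonization

set_option maxSynthPendingDepth 10

variable {k : Type u} [Field k] {H : Type v} [Ring H] [HopfAlgebra k H] {m r : ℕ} {q : k}
  {χ : Hˣ} {x : Fin r → H} {b d : Fin r → ℤ} {𝒢 : ℕ → Submodule k H} [GradedAlgebra 𝒢]

/-- Conjugation by `χ` fixes `σ` and scales each `x_i`, so it preserves `A`; powers follow by
induction. -/
theorem conj_pow_mem (h : IsCyclicBosonization m q χ x b d 𝒢) (n : ℕ) {a : H}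
    (ha : a ∈ basicSubalgebra (k := k) m χ x) :
    ((χ ^ n : Hˣ) : H) * a * ((χ ^ n)⁻¹ : Hˣ) ∈ basicSubalgebra (k := k) m χ x := by
  have h1 : basicSubalgebra (k := k) m χ x ≤
      (basicSubalgebra (k := k) m χ x).comap (conjHom χ) := by
    refine basicSubalgebra_le ?_ fun i => ?_
    · have h2 : (χ : H) * ((χ ^ m : Hˣ) : H) * (χ⁻¹ : Hˣ) = ((χ ^ m : Hˣ) : H) := by
        rw [← Units.val_mul, ← Units.val_mul, ← pow_succ', pow_succ, mul_inv_cancel_right]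
      exact (congrArg (· ∈ basicSubalgebra (k := k) m χ x) h2).mpr (sigma_mem χ x)
    · exact (congrArg (· ∈ basicSubalgebra (k := k) m χ x) (h.conj i)).mpr
        (Subalgebra.smul_mem _ (x_mem χ x i) _)
  induction n with
  | zero => simpa using ha
  | succ n ih =>
    have h2 := h1 ih
    have h3 : ((χ ^ (n + 1) : Hˣ) : H) * a * ((χ ^ (n + 1))⁻¹ : Hˣ) =
        conjHom (k := k) χ (((χ ^ n : Hˣ) : H) * a * ((χ ^ n)⁻¹ : Hˣ)) := by
      rw [conjHom_apply, pow_succ', mul_inv_rev, Units.val_mul, Units.val_mul]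
      simp only [mul_assoc]
    rw [h3]
    exact h2

/-- Reduces stability of `A` under conjugation by inverses to the case of natural powers. -/
theorem exists_inv_pow_eq (h : IsCyclicBosonization m q χ x b d 𝒢) [NeZero m] (n : ℕ) :
    ∃ l : ℕ, (χ ^ n)⁻¹ = χ ^ l := by
  refine ⟨n * (m ^ 2 - 1), ?_⟩
  rw [inv_eq_iff_mul_eq_one, ← pow_add, add_comm, ← Nat.mul_succ, Nat.succ_eq_add_one,
    Nat.sub_add_cancel (NeZero.one_le), mul_comm, pow_mul, h.pow_eq_one, one_pow]

/-- The exponents add up to `i + j - (i + j)'`, a multiple of `m`, so the cocycle is a power of `σ`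
whose exponent is the carry. -/
theorem pow_val_mul_pow_val [NeZero m] (χ : Hˣ) (g g' : Multiplicative (ZMod m)) :
    χ ^ g.toAdd.val * χ ^ g'.toAdd.val * (χ ^ (g * g').toAdd.val)⁻¹ =
      (χ ^ m) ^ ((g.toAdd.val + g'.toAdd.val - (g.toAdd.val + g'.toAdd.val) % m) / m) := by
  rw [mul_inv_eq_iff_eq_mul, ← pow_add, ← pow_mul, ← pow_add, toAdd_mul, ZMod.val_add]
  congr 1
  rw [Nat.mul_div_cancel' (Nat.dvd_sub_mod _), Nat.sub_add_cancel (Nat.mod_le _ _)]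

theorem conjHom_idem [NeZero m] [CharZero k] (h : IsCyclicBosonization m q χ x b d 𝒢) (n : ℕ)
    (i : ZMod (m ^ 2)) :
    conjHom (k := k) (χ ^ n) (idem (m ^ 2) q χ i.val) = idem (m ^ 2) q χ i.val := by
  have h1 : ((χ ^ n : Hˣ) : H) = scal h.idems fun i => q ^ ((n : ℤ) * i.val) := by
    rw [← h.zpow_eq_scal, zpow_natCast]
  rw [conjHom_apply, Units.mul_inv_eq_iff_eq_mul, h1, idem_eq_scal (k := k) h.idems i]
  exact scal_mul_comm _ _ _

/-- The elements `χ^i`, `0 ≤ i < m`. -/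
def powSection [NeZero m] [CharZero k] (h : IsCyclicBosonization m q χ x b d 𝒢) (s : ℕ) :
    GrouplikeSection (Multiplicative (ZMod m)) (h.twisted s).toQuasiBialgebra
      (basicSubalgebra (k := k) m χ x) where
  e g := χ ^ g.toAdd.val
  one := by rw [toAdd_one, ZMod.val_zero, pow_zero]
  conj_mem g _ ha := h.conj_pow_mem _ ha
  inv_conj_mem g a ha := by
    obtain ⟨l, hl⟩ := h.exists_inv_pow_eq g.toAdd.val
    rw [← inv_inv (χ ^ g.toAdd.val), hl, inv_inv]
    exact h.conj_pow_mem l ha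
  cocycle_mem g g' := by
    rw [pow_val_mul_pow_val, ← zpow_natCast]
    exact h.sigma_zpow_mem _
  inv_cocycle_mem g g' := by
    rw [pow_val_mul_pow_val, ← zpow_natCast, ← zpow_neg]
    exact h.sigma_zpow_mem _
  comul g := by
    have h1 := h.twisted_Δ_zpow s g.toAdd.val
    rwa [zpow_natCast] at h1
  counit g := by
    have h1 := h.counit_zpow g.toAdd.val
    rwa [zpow_natCast] at h1
  associator g := by
    rw [h.twisted_Φ]
    exact tensor₃_scal₃ _ _ (fun i => h.conjHom_idem _ i) _

/-- Distinct grouplike elements are linearly independent, and the powers of `χ` below its order are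
distinct; the coefficient of `χ ^ 0` in `1_n` is nonzero. -/
theorem idem_ne_zero (h : IsCyclicBosonization m q χ x b d 𝒢) [NeZero m] [CharZero k] (n : ℕ) :
    idem (m ^ 2) q χ n ≠ 0 := by
  intro h0
  have hN : ((m ^ 2 : ℕ) : k) ≠ 0 := Nat.cast_ne_zero.2 (NeZero.ne _)
  have hli : LinearIndependent k fun l : Fin (m ^ 2) => (χ : H) ^ (l : ℕ) := by
    have hg : ∀ l : ℕ, IsGroupLikeElem k ((χ : H) ^ l) := fun l => h.grouplike.pow
    have h1 := (linearIndepOn_isGroupLikeElem (R := k) (A := H)).linearIndependent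
    refine h1.comp (fun l : Fin (m ^ 2) => ⟨(χ : H) ^ (l : ℕ), hg l⟩) fun l l' hll => ?_
    have h2 : (χ : H) ^ (l : ℕ) = (χ : H) ^ (l' : ℕ) := congrArg Subtype.val hll
    rw [← Units.val_pow_eq_pow_val, ← Units.val_pow_eq_pow_val] at h2
    refine Fin.ext (pow_injOn_Iio_orderOf (x := χ) ?_ ?_ (Units.ext h2))
    · rw [h.order]; exact l.2
    · rw [h.order]; exact l'.2
  rw [idem, smul_eq_zero_iff_right (inv_ne_zero hN), Finset.sum_range] at h0
  have h3 := Fintype.linearIndependent_iff.1 hli _ h0 ⟨0, Nat.pos_of_ne_zero (NeZero.ne _)⟩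
  simp at h3

/-- The character of `H` with `χ ↦ q^n` and `x_i ↦ 0`. -/
theorem exists_character (h : IsCyclicBosonization m q χ x b d 𝒢) [NeZero m] [CharZero k]
    (n : ℕ) : ∃ f : H →ₐ[k] k, f χ = q ^ n ∧ ∀ i, f (x i) = 0 := by
  have he := h.idem_ne_zero n
  generalize hE : idem (m ^ 2) q χ n = E at he
  have hχ : ∀ l : ℕ, (χ : H) ^ l * E = q ^ (l * n) • E := fun l =>
    hE ▸ pow_mul_idem (NeZero.ne _) h.primitiveRoot h.pow_eq_one n l
  have hχ0 : ∀ l : ℕ, (χ : H) ^ l ∈ 𝒢 0 := fun l => by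
    rw [h.degree_zero]
    exact Submodule.subset_span ⟨l, rfl⟩
  -- The projection of `H` onto `H(0)` is a ring homomorphism that kills the `x_i`, and `H(0)`,
  -- spanned by the powers of `χ`, acts by scalars on the line of `1_n`. The character is the
  -- resulting scalar.
  have hc : ∀ y : H, ∃ c : k, GradedRing.projZeroRingHom 𝒢 y * E = c • E := fun y => by
    have hy : GradedRing.projZeroRingHom 𝒢 y ∈ 𝒢 0 := SetLike.coe_mem _
    rw [h.degree_zero] at hy
    generalize GradedRing.projZeroRingHom 𝒢 y = z at hy
    induction hy using Submodule.span_induction with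
    | mem z hz =>
      obtain ⟨l, rfl⟩ := hz
      exact ⟨_, hχ l⟩
    | zero => exact ⟨0, by rw [zero_mul, zero_smul]⟩
    | add z w _ _ hz hw =>
      obtain ⟨c, hc⟩ := hz
      obtain ⟨c', hc'⟩ := hw
      exact ⟨c + c', by rw [add_mul, hc, hc', add_smul]⟩
    | smul t z _ hz =>
      obtain ⟨c, hc⟩ := hz
      exact ⟨t * c, by rw [smul_mul_assoc, hc, smul_smul]⟩
  choose f hf using hc
  -- The scalar is unique because `1_n` is nonzero, which makes the chosen function linear and
  -- multiplicative.
  have huniq : ∀ {y : H} {c : k}, GradedRing.projZeroRingHom 𝒢 y * E = c • E → f y = c :=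
    fun {y c} hyc => smul_left_injective k he ((hf y).symm.trans hyc)
  have hfs : ∀ c : k, ∀ y, f (c • y) = c * f y := fun c y => huniq <| by
    have : GradedRing.projZeroRingHom 𝒢 (c • y) = c • GradedRing.projZeroRingHom 𝒢 y :=
      (GradedAlgebra.proj 𝒢 0).map_smul c y
    rw [this, smul_mul_assoc, hf, smul_smul]
  have hf1 : f 1 = 1 := huniq <| by rw [map_one, one_mul, one_smul]
  let F : H →ₐ[k] k :=
    { toFun := f
      map_one' := hf1
      map_mul' := fun y z => huniq <| by
        rw [map_mul, mul_assoc, hf, mul_smul_comm, hf, smul_smul, mul_comm]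
      map_zero' := huniq <| by rw [map_zero, zero_mul, zero_smul]
      map_add' := fun y z => huniq <| by rw [map_add, add_mul, hf, hf, add_smul]
      commutes' := fun c => by
        rw [Algebra.algebraMap_eq_smul_one, hfs, hf1, mul_one]
        rfl }
  refine ⟨F, huniq ?_, fun i => huniq ?_⟩
  · have h1 := hχ 1
    have h2 : GradedRing.projZeroRingHom 𝒢 (χ : H) = χ :=
      DirectSum.decompose_of_mem_same 𝒢 (by simpa using hχ0 1)
    rwa [pow_one, one_mul, ← h2] at h1
  · have h2 : GradedRing.projZeroRingHom 𝒢 (x i) = 0 :=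
      DirectSum.decompose_of_mem_ne 𝒢 (h.degree_one i) one_ne_zero
    rw [h2, zero_mul, zero_smul]

/-- Surjectivity comes from the generators. Injectivity uses the endomorphism `(id ⊗ f) Δ` of the
algebra `H`, formed with the untwisted coproduct, to separate the subspaces `A χ ^ i`. -/
theorem bijective_toAlgebra [NeZero m] [CharZero k] (h : IsCyclicBosonization m q χ x b d 𝒢)
    (hm : 1 < m) (s : ℕ) {Q : QuasiBialgebra k (basicSubalgebra (k := k) m χ x)}
    (hQ : IsQuasiBialgebraHom Q (h.twisted s).toQuasiBialgebra
      (basicSubalgebra (k := k) m χ x).val) :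
    Function.Bijective ((h.powSection s).toAlgebra hQ) := by
  constructor
  -- The character with `χ ↦ q ^ m` is the right one: `σ` is fixed since `q ^ (m ^ 2) = 1`, while
  -- the values `(q ^ m) ^ i` for `0 ≤ i < m` are distinct.
  · obtain ⟨f, hfχ, hfx⟩ := h.exists_character m
    have hχ : ∀ n : ℕ, counitRight f (Bialgebra.comulAlgHom k H ((χ ^ n : Hˣ) : H)) =
        (q ^ m) ^ n • ((χ ^ n : Hˣ) : H) := fun n => by
      have h1 := h.comul_zpow n
      rw [zpow_natCast] at h1
      rw [h1, counitRight_tmul, Units.val_pow_eq_pow_val, map_pow, hfχ]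
    have hm1 : (q ^ m) ^ m = 1 := by rw [← pow_mul, ← pow_two, h.primitiveRoot.pow_eq_one]
    refine (h.powSection s).toAlgebra_injective hQ
      ((counitRight f).comp (Bialgebra.comulAlgHom k H)) (fun a ha => ?_)
      (fun g => (q ^ m) ^ g.toAdd.val) (fun g g' hgg => ?_) fun g => hχ _
    · have hle : basicSubalgebra (k := k) m χ x ≤ AlgHom.equalizer
          ((counitRight f).comp (Bialgebra.comulAlgHom k H)) (AlgHom.id k H) := by
        refine basicSubalgebra_le ?_ fun i => ?_
        · refine (hχ m).trans ?_
          rw [hm1, one_smul]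
          rfl
        · refine (congrArg (counitRight f) (h.comul i)).trans ?_
          rw [map_add, counitRight_tmul, counitRight_tmul, hfx, map_one, one_smul, zero_smul,
            add_zero]
          rfl
      exact hle ha
    · have hpr : IsPrimitiveRoot (q ^ m) m :=
        h.primitiveRoot.pow (Nat.pos_of_ne_zero (NeZero.ne _)) (pow_two m)
      exact Multiplicative.toAdd.injective (ZMod.val_injective m
        (hpr.pow_inj (ZMod.val_lt _) (ZMod.val_lt _) hgg))
  · refine (h.powSection s).toAlgebra_surjective hQ h.generated fun y hy => ?_
    rcases hy with rfl | ⟨i, rfl⟩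
    -- The generator `χ` is the section at `h`; this needs `m > 1`, for otherwise the representative
    -- of `1` is `0`.
    · refine Or.inr ⟨Multiplicative.ofAdd 1, ?_⟩
      have : Fact (1 < m) := ⟨hm⟩
      change _ = ((χ ^ (1 : ZMod m).val : Hˣ) : H)
      rw [ZMod.val_one, pow_one]
    · exact Or.inl (x_mem χ x i)

/-- Homomorphisms into `H_{J_s}` that respect the antipode normalized to `β = 1`. -/
theorem isQuasiHopfHom_of_antipode [NeZero m] [CharZero k]
    (h : IsCyclicBosonization m q χ x b d 𝒢) (s : ℕ) {A : Type w} [Ring A] [Algebra k A]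
    {Q : QuasiHopf k A} {f : A →ₐ[k] H}
    (hf : IsQuasiBialgebraHom Q.toQuasiBialgebra (h.twisted s).toQuasiBialgebra f)
    (hS : ∀ a, f (Q.antipode.S a).unop = ((h.antipode s).S (f a)).unop)
    (hα : f Q.antipode.α = (h.antipode s).α) (hβ : f Q.antipode.β = (h.antipode s).β) :
    IsQuasiHopfHom Q (h.twisted s) f where
  toIsQuasiBialgebraHom := hf
  antipode := ⟨h.betaUnit s, fun a => (hS a).trans (h.antipode_S s _), hα, hβ⟩

end IsCyclicBosonization

end QuasiHopfAlg

/-! ### The theorem -/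

theorem mainTheorem3 {k : Type u} [Field k] [IsAlgClosed k] [CharZero k]
    {H : Type v} [Ring H] [HopfAlgebra k H] [FiniteDimensional k H]
    (m r : ℕ) [NeZero m] (q : k) (χ : Hˣ) (x : Fin r → H) (b d : Fin r → ℤ)
    (𝒢 : ℕ → Submodule k H) [GradedAlgebra 𝒢]
    (h : IsCyclicBosonization m q χ x b d 𝒢)
    (s : ℕ) (hs : s ∈ upsilonSet m b d) :
    -- `A(H,s)`, with its structure of quasi-Hopf subalgebra of `H_{J_s}`
    ∃ 𝒜 : QuasiHopf k (basicSubalgebra (k := k) m χ x),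
      IsQuasiHopfHom 𝒜 (h.twisted s)
        (basicSubalgebra (k := k) m χ x).val ∧
    -- the crossed system
    ∃ 𝒞 : CrossedSystem (Multiplicative (ZMod m)) 𝒜.toQuasiBialgebra,
      (∀ g a, ((𝒞.act g a : basicSubalgebra (k := k) m χ x) : H) =
        ((χ ^ g.toAdd.val : Hˣ) : H) * a * ((χ ^ g.toAdd.val)⁻¹ : Hˣ)) ∧
      (∀ g, 𝒞.J g = 1) ∧
      (∀ g g', ((𝒞.θ g g' : basicSubalgebra (k := k) m χ x) : H) =
        (((χ ^ m) ^ ((g.toAdd.val + g'.toAdd.val - (g.toAdd.val + g'.toAdd.val) % m) / m) :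
          Hˣ) : H)) ∧
    -- the quasi-Hopf algebra `A(H,s) # C_m` is isomorphic to `H_{J_s}`
      (∃ (υ : Multiplicative (ZMod m) → (basicSubalgebra (k := k) m χ x)ˣ)
          (T : Antipode 𝒞.product),
        (∀ g a, (T.S (𝒞.incl g a)).unop =
          𝒞.incl g⁻¹ (υ g * 𝒞.act g⁻¹ (𝒜.antipode.S a).unop)) ∧
        T.α = 𝒞.incl 1 𝒜.antipode.α ∧ T.β = 𝒞.incl 1 𝒜.antipode.β ∧
        ∃ φ : 𝒞.Product ≃ₐ[k] H,
          IsQuasiHopfHom ⟨𝒞.product, T⟩ (h.twisted s) φ.toAlgHom) ∧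
    -- the tensor equivalence
      ∃ (hθ : ∀ g g', 𝒞.θ g g' = 𝒞.θ g' g)
        (F : Equivariant (𝒞.action hθ) ⥤
          QuasiHopfAlg.Rep (QuasiHopf.ofHopf k H).toQuasiBialgebra),
        F.IsEquivalence ∧ F.Additive ∧
          (∀ (M N : Equivariant (𝒞.action hθ)) (c : k) (f : M ⟶ N),
            F.map (c • f) = c • F.map f) ∧
          Nonempty F.Monoidal := by
  obtain ⟨hs1, hsm, hbd⟩ := hs
  have hm : 1 < m := by omega
  obtain ⟨𝒜, hι, hS, hα, hβ⟩ := h.exists_quasiHopf hbd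
  have hθ₀ : ∀ g g', (((h.powSection s).crossedSystem hι).θ g g' : H) =
      (((χ ^ m) ^ ((g.toAdd.val + g'.toAdd.val - (g.toAdd.val + g'.toAdd.val) % m) / m) :
        Hˣ) : H) := fun g g' =>
    congrArg Units.val (IsCyclicBosonization.pow_val_mul_pow_val χ g g')
  have hθ : ∀ g g', ((h.powSection s).crossedSystem hι).θ g g' =
      ((h.powSection s).crossedSystem hι).θ g' g := fun g g' =>
    -- The exponent of `σ` depends only on `i + j`.
    Units.ext <| Subtype.ext <| by rw [hθ₀, hθ₀, add_comm]
  have hb := h.bijective_toAlgebra hm s hι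
  have hW : ∀ g, ((h.antipode s).S ((h.powSection s).e g)).unop =
      (((h.powSection s).e g)⁻¹ : Hˣ) := fun g => by
    have h1 := h.antipode_S_zpow s g.toAdd.val
    rw [zpow_neg, zpow_natCast] at h1
    exact h1
  obtain ⟨υ, T, hT, hTα, hTβ, hTS, hTα', hTβ'⟩ :=
    (h.powSection s).exists_antipode hι (h.antipode s) hS hα hβ hW hb
  have hφ := (h.powSection s).isQuasiBialgebraHom_toAlgebra hι
  let φ : ((h.powSection s).crossedSystem hι).Product ≃ₐ[k] H := AlgEquiv.ofBijective _ hb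
  refine ⟨𝒜, h.isQuasiHopfHom_of_antipode s hι hS hα hβ, (h.powSection s).crossedSystem hι,
    fun _ _ => rfl, fun _ => rfl, hθ₀, ⟨υ, T, hT, hTα, hTβ, φ,
      h.isQuasiHopfHom_of_antipode s hφ hTS hTα' hTβ'⟩, hθ, ?_⟩
  -- The isomorphism is read backwards, from `H_{J_s}` to the crossed product; combined with the
  -- twist `J_s` it is a twisted homomorphism starting from the Hopf algebra `H` itself.
  have hψ : IsQuasiBialgebraHom
      ((QuasiHopf.ofHopf k H).toQuasiBialgebra.twist (h.twist s))
      ((h.powSection s).crossedSystem hι).product φ.symm.toAlgHom :=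
    IsQuasiBialgebraHom.symm (e := φ) hφ
  have hE := CrossedSystem.toProductRep_isEquivalence (C := (h.powSection s).crossedSystem hι)
    (hθ := hθ)
  have hE' := Rep.restriction_isEquivalence (QuasiHopf.ofHopf k H).toQuasiBialgebra
    ((h.powSection s).crossedSystem hι).product φ.symm
  let _ := CrossedSystem.toProductRepMonoidal (C := (h.powSection s).crossedSystem hι) (hθ := hθ)
  let _ := Rep.restrictionMonoidal (isTwistedHom_of_twist (h.twist s) hψ)
  -- Both functors leave the vector spaces and the linear maps unchanged, so `k`-linearity holds by
  -- definition; the tensor structure of the composite is the action of `J_s`.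
  exact ⟨CrossedSystem.toProductRep _ hθ ⋙ Rep.restriction _ _ φ.symm.toAlgHom, inferInstance,
    inferInstance, fun _ _ _ _ => rfl, ⟨inferInstance⟩⟩
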